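/- **Conventions.** A hypergraph $G=(V,E,i)$ consists of finite sets $V=V(G)$ (vertices), $E=E(G)$ (edges) and an incidence function $i_G:E\to 2^V$ with $|i_G(e)|\ge 2$ for all $e\in E$ (parallel edges are allowed). Subhypergraphs, unions, and the subhypergraph $G[S]$ induced by $S\subseteq V(G)$ (whose edges are the $e$ with $i_G(e)\subseteq S$) are defined as usual; two hypergraphs are disjoint if they have no vertex and no edge in common. The set $S$ is independent if $G[S]$ has no edge, and $d_G(v)$ is the number of edges incident to $v$. $G$ is connected if any two vertices $a,b$ are joined by a hyperpath, i.e. there are distinct vertices $a=v_1,\dots,v_{q+1}=b$ and distinct edges $e_1,\dots,e_q$ ($q\ge 0$) with $v_j,v_{j+1}\in i_G(e_j)$. A vertex $v$ is separating if $G$ is the union of two induced subhypergraphs, each with at least two vertices, whose only common vertex is $v$. A block of $G$ is a maximal connected subhypergraph of $G$ without separating vertex; $\mathcal B(G)$ is the set of blocks. $A(G)$ is the set of pairs $\{u,v\}$, $u\neq v$, with $i_G(e)=\{u,v\}$ for some $e\in E(G)$. For a simple graph $\Gamma$, $t\Gamma$ arises from $\Gamma$ by replacing each edge by $t$ parallel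 edges. $K_{(n,t)}$ is the (simple) complete $n$-partite graph with all partite sets of size $t$, and $K_{t,t}=K_{(2,t)}$. **Covers.** A cover of $G$ is a pair $(X,H)$ of a hypergraph $H$ and pairwise disjoint sets $X_v\subseteq V(H)$ ($v\in V(G)$) such that $V(H)=\bigcup_v X_v$, each $X_v$ is independent in $H$, and for each $e\in E(G)$ there is a (possibly empty) matching $M_e$ in $H[\bigcup_{v\in i_G(e)}X_v]$ (a set of edges such that every vertex lies in at most one of them) with $|i_H(\tilde e)\cap X_v|=1$ for all $v\in i_G(e)$, $\tilde e\in M_e$, and $E(H)=\bigcup_{e}M_e$. The triple $(G,X,H)$ is a *degree-feasible configuration* if $G$ is connected, $(X,H)$ is a cover of $G$, and $|X_v|\ge d_G(v)$ for all $v\in V(G)$. It is *colorable* if there is a set $T\subseteq V(H)$, independent in $H$, with $|T\cap X_v|=1$ for all $v\in V(G)$. It is *minimal uncolorable* if it is not colorable but $(G,X,H-e)$ is colorable for each $e\in E(H)$. **Basic configurations.** Let $(X,H)$ be a cover of $G$. * $(G,X,H)$ is a *K-configuration* if $G=tK_n$ for some $t,n\ge 1$ and every $X_v$ has a partition $(X_v^1,\dots,X_v^{n-1})$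 such that, for each $j$, $H^j=H[\bigcup_{v}X_v^j]$ is a $K_{(n,t)}$ with partite sets $X_v^j$ ($v\in V(G)$), and $H=H^1\cup\dots\cup H^{n-1}$. * $(G,X,H)$ is an *odd C-configuration* if $G=tC_n$ for some $t\ge 1$ and odd $n\ge 5$ and every $X_v$ has a partition $(X_v^1,X_v^2)$ such that, for $j\in\{1,2\}$ and $\{u,v\}\in A(G)$, $H[X_u^j\cup X_v^j]$ is a $K_{t,t}$ with partite sets $X_u^j,X_v^j$, and $H$ is the union of all these graphs. * $(G,X,H)$ is an *even C-configuration* if $G=tC_n$ for some $t\ge 1$ and even $n\ge 4$ and there are a pair $\{w,w'\}\in A(G)$ and partitions $(X_v^1,X_v^2)$ of all $X_v$ such that, for $j\in\{1,2\}$ and $\{u,v\}\in A(G)$ different from $\{w,w'\}$, $H[X_u^j\cup X_v^j]$ is a $K_{t,t}$ with partite sets $X_u^j,X_v^j$; $H[X_w^1\cup X_{w'}^2]$ is a $K_{t,t}$ with partite sets $X_w^1,X_{w'}^2$; $H[X_w^2\cup X_{w'}^1]$ is a $K_{t,t}$ with partite sets $X_w^2,X_{w'}^1$; and $H$ is the union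 of all these graphs. * A *C-configuration* is an odd or even C-configuration. * $(G,X,H)$ is an *E-configuration* if $E(G)=\{e\}$ with $i_G(e)=V(G)$, $|X_v|=1$ for all $v\in V(G)$, and $H\cong G$. **Corollary.** Let $(G,X,H)$ be a degree-feasible configuration. If $(G,X,H)$ is minimal uncolorable, then there is exactly one family $(X^B,H^B)_{B\in\mathcal B(G)}$, where $(X^B,H^B)$ is a cover of $B$ for each block $B$, such that the following statements hold. (a) For every block $B\in\mathcal B(G)$, the triple $(B,X^B,H^B)$ is a K-configuration, a C-configuration, or an E-configuration. (b) The hypergraphs $H^B$ with $B\in\mathcal B(G)$ are pairwise disjoint and $H=\bigcup_{B\in\mathcal B(G)}H^B$. (c) For each vertex $v\in V(G)$ it holds $X_v=\bigcup_{B\in\mathcal B(G),\,v\in V(B)}X_v^B$. -/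

import Mathlib

/-- A (finite, loopless) hypergraph `(V, E, i)`, possibly with parallel edges: `V` and `E` are finite
sets and `i` assigns to every edge a subset of `V` with at least two elements.
The incidence function is a function on `E`; outside `E` it is given the value `∅`, so that
equality of structures is equality of hypergraphs. -/
@[ext]
structure MultiHypergraph (α β : Type*) where
  V : Set α
  E : Set β
  inc : β → Set α
  finite_V : V.Finite
  finite_E : E.Finite
  inc_subset : ∀ e ∈ E, inc e ⊆ V
  two_le_inc : ∀ e ∈ E, 2 ≤ (inc e).ncard
  inc_eq_empty : ∀ e, e ∉ E → inc e = ∅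

namespace MultiHypergraph

variable {α β γ δ : Type*}

/-- `G' ≤ G` means that `G'` is a subhypergraph of `G`. -/
instance : PartialOrder (MultiHypergraph α β) where
  le G' G := G'.V ⊆ G.V ∧ G'.E ⊆ G.E ∧ ∀ e ∈ G'.E, G'.inc e = G.inc e
  le_refl G := ⟨subset_rfl, subset_rfl, fun _ _ => rfl⟩
  le_trans G₁ G₂ G₃ h h' :=
    ⟨h.1.trans h'.1, h.2.1.trans h'.2.1,
      fun e he => (h.2.2 e he).trans (h'.2.2 e (h.2.1 he))⟩
  le_antisymm G₁ G₂ h h' := by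
    have hE : G₁.E = G₂.E := h.2.1.antisymm h'.2.1
    refine MultiHypergraph.ext (h.1.antisymm h'.1) hE (funext fun e => ?_)
    by_cases he : e ∈ G₁.E
    · exact h.2.2 e he
    · rw [G₁.inc_eq_empty e he, G₂.inc_eq_empty e (hE ▸ he)]

/-- `H` is the union of the set `F` of hypergraphs. -/
def IsUnion (H : MultiHypergraph α β) (F : Set (MultiHypergraph α β)) : Prop :=
  (∀ K ∈ F, K ≤ H) ∧ H.V = ⋃ K ∈ F, K.V ∧ H.E = ⋃ K ∈ F, K.E

/-- Two hypergraphs are disjoint if they have no vertex and no edge in common. -/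
def IsDisjoint (H K : MultiHypergraph α β) : Prop :=
  Disjoint H.V K.V ∧ Disjoint H.E K.E

/-- The subhypergraph `G[S]` induced by `S` (by `S ∩ V(G)`, if `S` is not contained in `V(G)`). -/
def induce (G : MultiHypergraph α β) (S : Set α) : MultiHypergraph α β where
  V := G.V ∩ S
  E := {e | e ∈ G.E ∧ G.inc e ⊆ S}
  inc e := {v | (e ∈ G.E ∧ G.inc e ⊆ S) ∧ v ∈ G.inc e}
  finite_V := G.finite_V.inter_of_left S
  finite_E := G.finite_E.subset fun _ h => h.1
  inc_subset := fun e he _ hv => ⟨G.inc_subset e he.1 hv.2, he.2 hv.2⟩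
  two_le_inc := fun e he => by
    have h : {v | (e ∈ G.E ∧ G.inc e ⊆ S) ∧ v ∈ G.inc e} = G.inc e :=
      Set.ext fun v => ⟨fun h => h.2, fun h => ⟨he, h⟩⟩
    rw [h]
    exact G.two_le_inc e he.1
  inc_eq_empty := fun _ he => Set.eq_empty_of_forall_notMem fun _ hv => he hv.1

/-- `G - e`, obtained by deleting the edge `e`. -/
def deleteEdge (G : MultiHypergraph α β) (e : β) : MultiHypergraph α β where
  V := G.V
  E := G.E \ {e}
  inc f := {v | f ≠ e ∧ v ∈ G.inc f}
  finite_V := G.finite_V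
  finite_E := G.finite_E.subset Set.sdiff_subset
  inc_subset := fun f hf _ hv => G.inc_subset f hf.1 hv.2
  two_le_inc := fun f hf => by
    have h : {v | f ≠ e ∧ v ∈ G.inc f} = G.inc f :=
      Set.ext fun v => ⟨fun h => h.2, fun h => ⟨hf.2, h⟩⟩
    rw [h]
    exact G.two_le_inc f hf.1
  inc_eq_empty := fun f hf => Set.eq_empty_of_forall_notMem fun v hv => by
    by_cases h : f ∈ G.E
    · exact hf ⟨h, hv.1⟩
    · have := hv.2
      rw [G.inc_eq_empty f h] at this
      exact this

/-- The degree of a vertex: the number of edges incident to it. -/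
noncomputable def degree (G : MultiHypergraph α β) (v : α) : ℕ :=
  {e | e ∈ G.E ∧ v ∈ G.inc e}.ncard

/-- `T` is independent in `G` if `G[T]` has no edge. -/
def IsIndependent (G : MultiHypergraph α β) (T : Set α) : Prop :=
  (G.induce T).E = ∅

/-- A (hyper-)matching: every vertex is contained in at most one edge of `M`. -/
def IsMatching (G : MultiHypergraph α β) (M : Set β) : Prop :=
  M ⊆ G.E ∧ ∀ v ∈ G.V, ∀ e ∈ M, ∀ e' ∈ M, v ∈ G.inc e → v ∈ G.inc e' → e = e'

/-- A hyperpath `(v 0, e 0, v 1, …, e (q-1), v q)` with distinct vertices and distinct edges. -/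
structure IsHyperpath (G : MultiHypergraph α β) (q : ℕ) (v : Fin (q + 1) → α) (e : Fin q → β) :
    Prop where
  vertex_mem : ∀ j, v j ∈ G.V
  edge_mem : ∀ j, e j ∈ G.E
  vertex_injective : Function.Injective v
  edge_injective : Function.Injective e
  left_mem : ∀ j : Fin q, v j.castSucc ∈ G.inc (e j)
  right_mem : ∀ j : Fin q, v j.succ ∈ G.inc (e j)

/-- `G` is connected: there is a hyperpath between any two vertices. -/
def IsConnected (G : MultiHypergraph α β) : Prop :=
  ∀ a ∈ G.V, ∀ b ∈ G.V, ∃ (q : ℕ) (v : Fin (q + 1) → α) (e : Fin q → β),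
    G.IsHyperpath q v e ∧ v 0 = a ∧ v (Fin.last q) = b

/-- `v` is a separating vertex: `G` is the union of two induced subhypergraphs, each with at least
two vertices, that have exactly the vertex `v` in common. -/
def IsSeparatingVertex (G : MultiHypergraph α β) (v : α) : Prop :=
  ∃ S₁ S₂ : Set α, S₁ ⊆ G.V ∧ S₂ ⊆ G.V ∧ G.IsUnion {G.induce S₁, G.induce S₂} ∧
    S₁ ∩ S₂ = {v} ∧ 2 ≤ S₁.ncard ∧ 2 ≤ S₂.ncard

/-- The set of blocks of `G`: the maximal connected subhypergraphs without separating vertex. -/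
def blocks (G : MultiHypergraph α β) : Set (MultiHypergraph α β) :=
  {B | Maximal (fun K => K ≤ G ∧ K.IsConnected ∧ ∀ v, ¬ K.IsSeparatingVertex v) B}

/-- `u` and `v` are distinct and joined by an ordinary edge, that is `{u, v} ∈ A(G)`. -/
def OrdAdj (G : MultiHypergraph α β) (u v : α) : Prop :=
  u ≠ v ∧ ∃ e ∈ G.E, G.inc e = {u, v}

/-- `G = t Γ` (up to isomorphism) for a simple graph `Γ`: every edge of `Γ` is replaced by `t`
parallel edges. -/
def IsMultiple (G : MultiHypergraph α β) (t : ℕ) {W : Type*} (Γ : SimpleGraph W) : Prop :=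
  ∃ φ : W ≃ G.V,
    (∀ e ∈ G.E, ∃ a b : W, Γ.Adj a b ∧ G.inc e = {(φ a : α), (φ b : α)}) ∧
    ∀ a b : W, Γ.Adj a b → {e | e ∈ G.E ∧ G.inc e = {(φ a : α), (φ b : α)}}.ncard = t

/-- `K` is a complete multipartite (simple) graph with partite sets `P j`, all of size `t`. With
`n` indices this says that `K` is a `K_{(n,t)}`, and in particular a `K_{t,t}` if `n = 2`. -/
structure IsCompleteMultipartite (K : MultiHypergraph α β) (t : ℕ) {ι : Type*} (P : ι → Set α) :
    Prop where
  vertices : K.V = ⋃ j, P j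
  disjoint : Pairwise fun j k => Disjoint (P j) (P k)
  card : ∀ j, (P j).ncard = t
  edges : ∀ e ∈ K.E, ∃ j k, j ≠ k ∧ ∃ x ∈ P j, ∃ y ∈ P k, K.inc e = {x, y}
  joined : ∀ j k, j ≠ k → ∀ x ∈ P j, ∀ y ∈ P k, ∃! e, e ∈ K.E ∧ K.inc e = {x, y}

/-- Isomorphism of hypergraphs. -/
def IsIsomorphic (G : MultiHypergraph α β) (H : MultiHypergraph γ δ) : Prop :=
  ∃ (f : G.V ≃ H.V) (g : G.E ≃ H.E),
    ∀ (v : G.V) (e : G.E), (v : α) ∈ G.inc e ↔ (f v : γ) ∈ H.inc (g e)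

/-- A cover `(X, H)` of `G`. The map `X` is a function on `V(G)`; outside `V(G)` it is given the
value `∅`, so that equality of structures is equality of covers. -/
@[ext]
structure Cover (G : MultiHypergraph α β) (γ δ : Type*) where
  X : α → Set γ
  H : MultiHypergraph γ δ
  X_eq_empty : ∀ v, v ∉ G.V → X v = ∅
  X_disjoint : ∀ u ∈ G.V, ∀ v ∈ G.V, u ≠ v → Disjoint (X u) (X v)
  vertices : H.V = ⋃ v ∈ G.V, X v
  independent : ∀ v ∈ G.V, H.IsIndependent (X v)
  matchings : ∃ M : β → Set δ,
    (∀ e ∈ G.E, (H.induce (⋃ v ∈ G.inc e, X v)).IsMatching (M e) ∧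
      ∀ f ∈ M e, ∀ v ∈ G.inc e, (H.inc f ∩ X v).ncard = 1) ∧
    H.E = ⋃ e ∈ G.E, M e

/-- `(X, H)`-colorability of `G`: there is an independent transversal of `(X, H)`. -/
def IsColorable (G : MultiHypergraph α β) (X : α → Set γ) (H : MultiHypergraph γ δ) : Prop :=
  ∃ T ⊆ H.V, (∀ v ∈ G.V, (T ∩ X v).ncard = 1) ∧ H.IsIndependent T

namespace Cover

variable {G : MultiHypergraph α β}

/-- `(G, X, H)` is a degree-feasible configuration. -/
def IsDegreeFeasible (C : G.Cover γ δ) : Prop :=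
  G.IsConnected ∧ ∀ v ∈ G.V, G.degree v ≤ (C.X v).ncard

/-- `(G, X, H)` is uncolorable, but `(G, X, H - e)` is colorable for each edge `e` of `H`. -/
def IsMinimalUncolorable (C : G.Cover γ δ) : Prop :=
  ¬ G.IsColorable C.X C.H ∧ ∀ e ∈ C.H.E, G.IsColorable C.X (C.H.deleteEdge e)

/-- For every vertex `v`, the sets `P j v` form a partition of `X v`. -/
def IsPartition (C : G.Cover γ δ) {ι : Type*} (P : ι → α → Set γ) : Prop :=
  ∀ v ∈ G.V, C.X v = ⋃ j, P j v ∧ (∀ j, (P j v).Nonempty) ∧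
    Pairwise fun j k => Disjoint (P j v) (P k v)

/-- `H[Y ∪ Z]` is a `K_{t,t}` with partite sets `Y` and `Z`. -/
def IsCompleteBetween (C : G.Cover γ δ) (t : ℕ) (Y Z : Set γ) : Prop :=
  (C.H.induce (Y ∪ Z)).IsCompleteMultipartite t ![Y, Z]

/-- K-configurations. -/
def IsKConfiguration (C : G.Cover γ δ) : Prop :=
  ∃ t n : ℕ, 1 ≤ t ∧ 1 ≤ n ∧ G.IsMultiple t (⊤ : SimpleGraph (Fin n)) ∧
    ∃ P : Fin (n - 1) → α → Set γ, C.IsPartition P ∧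
      (∀ j, (C.H.induce (⋃ v ∈ G.V, P j v)).IsCompleteMultipartite t
        (fun v : G.V => P j v)) ∧
      C.H.IsUnion (Set.range fun j => C.H.induce (⋃ v ∈ G.V, P j v))

/-- Odd C-configurations. -/
def IsOddCConfiguration (C : G.Cover γ δ) : Prop :=
  ∃ t n : ℕ, 1 ≤ t ∧ 5 ≤ n ∧ Odd n ∧ G.IsMultiple t (SimpleGraph.cycleGraph n) ∧
    ∃ P : Fin 2 → α → Set γ, C.IsPartition P ∧
      (∀ j u v, G.OrdAdj u v → C.IsCompleteBetween t (P j u) (P j v)) ∧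
      C.H.IsUnion {K | ∃ j u v, G.OrdAdj u v ∧ K = C.H.induce (P j u ∪ P j v)}

/-- Even C-configurations; `{w, w'}` is the pair of adjacent vertices where the cover is
twisted. -/
def IsEvenCConfiguration (C : G.Cover γ δ) : Prop :=
  ∃ t n : ℕ, 1 ≤ t ∧ 4 ≤ n ∧ Even n ∧ G.IsMultiple t (SimpleGraph.cycleGraph n) ∧
    ∃ (P : Fin 2 → α → Set γ) (w w' : α), C.IsPartition P ∧ G.OrdAdj w w' ∧
      (∀ j u v, G.OrdAdj u v → ({u, v} : Set α) ≠ {w, w'} →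
        C.IsCompleteBetween t (P j u) (P j v)) ∧
      C.IsCompleteBetween t (P 0 w) (P 1 w') ∧
      C.IsCompleteBetween t (P 1 w) (P 0 w') ∧
      C.H.IsUnion ({K | ∃ j u v, G.OrdAdj u v ∧ ({u, v} : Set α) ≠ {w, w'} ∧
          K = C.H.induce (P j u ∪ P j v)} ∪
        {C.H.induce (P 0 w ∪ P 1 w'), C.H.induce (P 1 w ∪ P 0 w')})

/-- C-configurations. -/
def IsCConfiguration (C : G.Cover γ δ) : Prop :=
  C.IsOddCConfiguration ∨ C.IsEvenCConfiguration

/-- E-configurations: `G` consists of a single edge containing all vertices, every `X v` has one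
element, and `H` is isomorphic to `G`. -/
def IsEConfiguration (C : G.Cover γ δ) : Prop :=
  (∃ e, G.E = {e} ∧ G.inc e = G.V) ∧ (∀ v ∈ G.V, (C.X v).ncard = 1) ∧ C.H.IsIsomorphic G

end Cover

end MultiHypergraph

/-! Call a coloring of all vertices but one a state, and the uncolored vertex `v` its hole.
Connectivity and `|X_u| ≥ d(u)` give states greedily: color vertices so that each still has an edge
leading to an uncolored vertex (`exists_extension`). In an uncolorable configuration every color `x`
of the hole completes some edge at `v` to an edge of `H`. Matchings make the map from colors to
edges injective, and `|X_v| ≥ d(v)` makes it a bijection (`exists_hit_of_mem_inc`). Hence if `x`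
completes only `e`, one may give `v` the color `x` and uncolor any other vertex of `e`
(`proper_move`). Moving the hole around and comparing the states that result yields the whole
structure.

Suppose first that `G` is connected without separating vertex. If some edge `e₀` has at least three
vertices and meets another edge, the hole can leave `e₀` at one vertex `u` and return at another,
changing the color of `u` and of no other vertex of `e₀` except the hole. A third vertex of `e₀`
then detects a contradiction, so `e₀` is the only edge (`singleton_edge`), which gives an
E-configuration.

Otherwise `G` is a multigraph, and its states satisfy the axioms `StateSystem`. Taking the hole out
of `v` through one neighbor and back through another shows that all multiplicities at `v` agree and
that the conflict sets in `X_v` coming from colors of neighbors coincide or are disjoint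
(`nbr_eq_of_mem`). So there is a constant multiplicity `t`, and double counting makes the underlying
simple graph regular. Two nonadjacent neighbors of a vertex must separate the graph
(`not_preconnOn`), while Lovász's lemma from the proof of Brooks' theorem finds a nonseparating pair
when the degree is at least three and the graph is not complete. What remains is a complete graph or
a cycle (`complete_or_cycle`). In the complete case a round trip through a triangle makes the
classes of colors consistent. On a cycle the two classes are transported around, and an alternating
coloring decides by parity whether the last edge is twisted. Minimality rules out parallel edges of
`H`, which gives K- and C-configurations.

If `v` separates `G` into sides `S₁` and `S₂`, every color of `v` fails to extend to at least one
side. At most `d_{G[S_i]}(v)` colors fail on side `i`, and these degrees sum to at most `d(v)`. The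
failing sets therefore partition `X_v` with exactly these sizes, and the configuration splits into
two smaller minimal ones (`exists_isSplit`). Induction on the number of vertices gives existence.

For uniqueness, an edge of `H` projects to an edge of `G`, which has two vertices and therefore
determines its block. In a basic configuration every vertex of `H` lies on an edge, so the edges
determine the covers. -/

namespace MultiHypergraph

open Relation Function

/-! ### Connectivity by walks and by paths -/

variable {α β γ δ : Type*}

/-- A step of the relation `r` with both ends in `W`. -/
def Within (r : α → α → Prop) (W : Set α) (x y : α) : Prop := x ∈ W ∧ y ∈ W ∧ r x y

/-- Any two elements of `W` are joined by an `r`-walk inside `W`. -/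
def PreconnOn (r : α → α → Prop) (W : Set α) : Prop :=
  ∀ a ∈ W, ∀ b ∈ W, ReflTransGen (Within r W) a b

/-- The form in which connectivity is used throughout: a walk that leaves `T` does so at some step.
-/
theorem PreconnOn.exists_crossing {r : α → α → Prop} {W T : Set α} (h : PreconnOn r W) {a b : α}
    (ha : a ∈ W) (hb : b ∈ W) (haT : a ∈ T) (hbT : b ∉ T) :
    ∃ x ∈ W, ∃ y ∈ W, x ∈ T ∧ y ∉ T ∧ r x y := by
  by_contra! hcon
  have key : ∀ c, ReflTransGen (Within r W) a c → c ∈ T := by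
    intro c hc
    induction hc with
    | refl => exact haT
    | tail _ hs ih =>
      by_contra hn
      exact hcon _ hs.1 _ hs.2.1 ih hn hs.2.2
  exact hbT (key b (h a ha b hb))

theorem preconnOn_of_no_separation {r : α → α → Prop} {W : Set α}
    (h : ∀ R ⊆ W, R.Nonempty → (W \ R).Nonempty → ∃ x ∈ R, ∃ y ∈ W \ R, r x y) :
    PreconnOn r W := by
  intro a ha b hb
  by_contra hab
  obtain ⟨x, hx, y, hy, hxy⟩ := h {c | c ∈ W ∧ ReflTransGen (Within r W) a c}
    (fun c hc => hc.1) ⟨a, ha, .refl⟩ ⟨b, hb, fun hc => hab hc.2⟩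
  exact hy.2 ⟨hy.1, hx.2.tail ⟨hx.1, hy.1, hxy⟩⟩

/-- `a` and `b` lie on a common edge. -/
def Link (G : MultiHypergraph α β) (a b : α) : Prop := ∃ e ∈ G.E, a ∈ G.inc e ∧ b ∈ G.inc e

theorem Link.symm {G : MultiHypergraph α β} {a b : α} (h : G.Link a b) : G.Link b a := by
  obtain ⟨e, he, ha, hb⟩ := h
  exact ⟨e, he, hb, ha⟩

theorem Link.left_mem {G : MultiHypergraph α β} {a b : α} (h : G.Link a b) : a ∈ G.V := by
  obtain ⟨e, he, ha, hb⟩ := h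
  exact G.inc_subset e he ha

theorem Link.right_mem {G : MultiHypergraph α β} {a b : α} (h : G.Link a b) : b ∈ G.V :=
  h.symm.left_mem

/-- A hyperpath indexed by natural numbers. -/
def IsNatPath (G : MultiHypergraph α β) (q : ℕ) (v : ℕ → α) (e : ℕ → β) : Prop :=
  (∀ i ≤ q, v i ∈ G.V) ∧ (∀ i < q, e i ∈ G.E) ∧ (∀ i ≤ q, ∀ j ≤ q, v i = v j → i = j) ∧
    (∀ i < q, ∀ j < q, e i = e j → i = j) ∧
    ∀ i < q, v i ∈ G.inc (e i) ∧ v (i + 1) ∈ G.inc (e i)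

theorem IsNatPath.isHyperpath {G : MultiHypergraph α β} {q : ℕ} {v : ℕ → α} {e : ℕ → β}
    (h : G.IsNatPath q v e) : G.IsHyperpath q (fun i => v i) (fun i => e i) where
  vertex_mem j := h.1 j (by omega)
  edge_mem j := h.2.1 j j.2
  vertex_injective i j hij := Fin.ext (h.2.2.1 i (by omega) j (by omega) hij)
  edge_injective i j hij := Fin.ext (h.2.2.2.1 i i.2 j j.2 hij)
  left_mem j := (h.2.2.2.2 j j.2).1
  right_mem j := by simpa using (h.2.2.2.2 j j.2).2

theorem exists_natPath {G : MultiHypergraph α β} {a b : α} [Nonempty β] (ha : a ∈ G.V)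
    (h : ReflTransGen G.Link a b) : ∃ q v e, G.IsNatPath q v e ∧ v 0 = a ∧ v q = b := by
  classical
  induction h with
  | refl =>
    refine ⟨0, fun _ => a, fun _ => Classical.arbitrary β, ⟨?_, ?_, ?_, ?_, ?_⟩, rfl, rfl⟩ <;> grind
  | @tail b c _ hbc ih =>
    obtain ⟨q, v, e, ⟨h1, h2, h3, h4, h5⟩, rfl, rfl⟩ := ih
    obtain ⟨f, hf, hbf, hcf⟩ := hbc
    by_cases hc : ∃ i ≤ q, v i = c
    · obtain ⟨i, hi, rfl⟩ := hc
      exact ⟨i, v, e, ⟨by grind, by grind, by grind, by grind, by grind⟩, rfl, rfl⟩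
    -- The path is cut at its first vertex `v j` on `f` before `f` is appended. The edges kept each
    -- contain an earlier vertex, which is not on `f`, so `f` differs from all of them.
    · have hex : ∃ j, v j ∈ G.inc f := ⟨q, hbf⟩
      have hj : v (Nat.find hex) ∈ G.inc f := Nat.find_spec hex
      have hmin : ∀ i < Nat.find hex, v i ∉ G.inc f := fun i hi => Nat.find_min hex hi
      have hjq : Nat.find hex ≤ q := Nat.find_min' hex hbf
      generalize Nat.find hex = j at hj hmin hjq
      have hcV := G.inc_subset f hf hcf
      refine ⟨j + 1, fun i => if i ≤ j then v i else c, fun i => if i < j then e i else f,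
        ⟨?_, ?_, ?_, ?_, ?_⟩, by simp, by simp⟩
      · grind
      · grind
      · grind
      · grind
      · grind

theorem isConnected_iff {G : MultiHypergraph α β} : G.IsConnected ↔ PreconnOn G.Link G.V := by
  constructor
  · intro h a ha b hb
    obtain ⟨q, v, e, hp, rfl, rfl⟩ := h a ha b hb
    have : ∀ j : Fin (q + 1), ReflTransGen (Within G.Link G.V) (v 0) (v j) := by
      intro j
      induction j using Fin.induction with
      | zero => exact .refl
      | succ i ih =>
        exact ih.tail ⟨hp.vertex_mem _, hp.vertex_mem _, e i, hp.edge_mem i, hp.left_mem i,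
          hp.right_mem i⟩
    exact this _
  · intro h a ha b hb
    -- A path indexed by `ℕ` needs a default edge. If there is none, a walk cannot take a step.
    by_cases hβ : Nonempty β
    · obtain ⟨q, v, e, hp, h0, hq⟩ := exists_natPath ha
        (ReflTransGen.mono (fun _ _ hxy => hxy.2.2) _ _ (h a ha b hb))
      exact ⟨q, _, _, hp.isHyperpath, by simpa using h0, by simpa using hq⟩
    · have hab : a = b := by
        rcases ReflTransGen.cases_head (h a ha b hb) with h | ⟨c, hc, _⟩
        · exact h
        · exact absurd ⟨hc.2.2.choose⟩ hβ
      subst hab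
      exact ⟨0, fun _ => a, Fin.elim0, ⟨fun _ => ha, fun j => j.elim0,
        fun i j _ => (Fin.subsingleton_one).elim i j, fun i => i.elim0, fun i => i.elim0, fun i => i.elim0⟩,
        rfl, rfl⟩

/-! ### Induced subhypergraphs, separations and blocks -/

theorem inc_of_le {K G : MultiHypergraph α β} (h : K ≤ G) {e : β} (he : e ∈ K.E) :
    K.inc e = G.inc e := h.2.2 e he

theorem induce_inc {G : MultiHypergraph α β} {S : Set α} {e : β} (he : e ∈ (G.induce S).E) :
    (G.induce S).inc e = G.inc e :=
  Set.ext fun _ => ⟨fun h => h.2, fun h => ⟨he, h⟩⟩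

theorem induce_le (G : MultiHypergraph α β) (S : Set α) : G.induce S ≤ G :=
  ⟨Set.inter_subset_left, fun _ h => h.1, fun _ h => induce_inc h⟩

theorem le_induce {K G : MultiHypergraph α β} (h : K ≤ G) {S : Set α} (hS : K.V ⊆ S) :
    K ≤ G.induce S := by
  refine ⟨fun x hx => ⟨h.1 hx, hS hx⟩, fun e he => ⟨h.2.1 he, ?_⟩, fun e he => ?_⟩
  · rw [← inc_of_le h he]; exact (K.inc_subset e he).trans hS
  · rw [induce_inc, inc_of_le h he]
    exact ⟨h.2.1 he, by rw [← inc_of_le h he]; exact (K.inc_subset e he).trans hS⟩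

theorem exists_pair {G : MultiHypergraph α β} {e : β} (he : e ∈ G.E) :
    ∃ a ∈ G.inc e, ∃ b ∈ G.inc e, a ≠ b :=
  (Set.one_lt_ncard (G.finite_V.subset (G.inc_subset e he))).1 (G.two_le_inc e he)

/-- `S₁` and `S₂` separate `G` at `v`, except that one of them may have a single vertex. -/
structure IsSeparation (G : MultiHypergraph α β) (v : α) (S₁ S₂ : Set α) : Prop where
  subset_left : S₁ ⊆ G.V
  subset_right : S₂ ⊆ G.V
  cover : G.V ⊆ S₁ ∪ S₂
  edges : ∀ e ∈ G.E, G.inc e ⊆ S₁ ∨ G.inc e ⊆ S₂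
  inter : S₁ ∩ S₂ = {v}

theorem IsSeparation.symm {G : MultiHypergraph α β} {v : α} {S₁ S₂ : Set α}
    (h : G.IsSeparation v S₁ S₂) : G.IsSeparation v S₂ S₁ :=
  ⟨h.2, h.1, by rw [Set.union_comm]; exact h.3, fun e he => (h.4 e he).symm,
    by rw [Set.inter_comm]; exact h.5⟩

theorem IsSeparation.mem_left {G : MultiHypergraph α β} {v : α} {S₁ S₂ : Set α}
    (h : G.IsSeparation v S₁ S₂) : v ∈ S₁ := (h.inter.ge rfl).1

theorem IsSeparation.mem_right {G : MultiHypergraph α β} {v : α} {S₁ S₂ : Set α}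
    (h : G.IsSeparation v S₁ S₂) : v ∈ S₂ := (h.inter.ge rfl).2

theorem IsSeparation.eq_of_mem {G : MultiHypergraph α β} {v x : α} {S₁ S₂ : Set α}
    (h : G.IsSeparation v S₁ S₂) (h1 : x ∈ S₁) (h2 : x ∈ S₂) : x = v := h.inter.le ⟨h1, h2⟩

theorem isSeparatingVertex_iff {G : MultiHypergraph α β} {v : α} :
    G.IsSeparatingVertex v ↔ ∃ S₁ S₂, G.IsSeparation v S₁ S₂ ∧ (∃ a ∈ S₁, a ≠ v) ∧
      ∃ b ∈ S₂, b ≠ v := by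
  have two : ∀ S ⊆ G.V, v ∈ S → (2 ≤ S.ncard ↔ ∃ a ∈ S, a ≠ v) := by
    intro S hS hv
    rw [Nat.succ_le_iff, Set.one_lt_ncard (G.finite_V.subset hS)]
    grind
  constructor
  · rintro ⟨S₁, S₂, h1, h2, ⟨-, hV, hE⟩, hi, hc1, hc2⟩
    have hv : v ∈ S₁ ∩ S₂ := hi.ge rfl
    refine ⟨S₁, S₂, ⟨h1, h2, ?_, ?_, hi⟩, (two _ h1 hv.1).1 hc1, (two _ h2 hv.2).1 hc2⟩
    · intro x hx
      rw [hV] at hx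
      simp [induce] at hx
      grind
    · intro e he
      rw [hE] at he
      simp [induce] at he
      grind
  · rintro ⟨S₁, S₂, h, ha, hb⟩
    refine ⟨S₁, S₂, h.1, h.2, ⟨?_, ?_, ?_⟩, h.5, (two _ h.1 h.mem_left).2 ha,
      (two _ h.2 h.mem_right).2 hb⟩
    · rintro K (rfl | rfl) <;> exact induce_le _ _
    · ext x
      have := @h.3 x
      simp [induce]
      grind
    · ext e
      have := h.4 e
      simp [induce]
      grind

/-- Connected without separating vertex. -/
def IsNonsep (K : MultiHypergraph α β) : Prop := K.IsConnected ∧ ∀ v, ¬ K.IsSeparatingVertex v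

theorem mem_blocks_iff {G B : MultiHypergraph α β} :
    B ∈ G.blocks ↔ (B ≤ G ∧ B.IsNonsep) ∧ ∀ K ≤ G, K.IsNonsep → B ≤ K → K ≤ B :=
  ⟨fun h => ⟨h.1, fun _ h1 h2 h3 => h.2 ⟨h1, h2⟩ h3⟩,
    fun h => ⟨h.1, fun _ hK h3 => h.2 _ hK.1 hK.2 h3⟩⟩

/-- If `K` met both sides outside the other, connectivity would force `v ∈ K`, and the traces of
`S₁` and `S₂` on `K` would make `v` a separating vertex of `K`. -/
theorem IsNonsep.subset_of_isSeparation {G K : MultiHypergraph α β} (hK : K.IsNonsep) (hKG : K ≤ G)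
    {v : α} {S₁ S₂ : Set α} (h : G.IsSeparation v S₁ S₂) : K.V ⊆ S₁ ∨ K.V ⊆ S₂ := by
  by_contra! hcon
  obtain ⟨⟨a, ha, ha1⟩, ⟨b, hb, hb2⟩⟩ := Set.not_subset.1 hcon.1, Set.not_subset.1 hcon.2
  have hcov : ∀ x ∈ K.V, x ∈ S₁ ∨ x ∈ S₂ := fun x hx => h.cover (hKG.1 hx)
  have hedge : ∀ e ∈ K.E, K.inc e ⊆ S₁ ∨ K.inc e ⊆ S₂ := fun e he => by
    rw [inc_of_le hKG he]; exact h.edges e (hKG.2.1 he)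
  have hv : v ∈ K.V := by
    by_contra hv
    obtain ⟨x, hx, y, hy, hx1, hy1, e, he, hxe, hye⟩ :=
      (isConnected_iff.1 hK.1).exists_crossing (T := S₁) hb ha
        ((hcov b hb).resolve_right hb2) ha1
    rcases hedge e he with h' | h'
    · exact hy1 (h' hye)
    · have := h.eq_of_mem hx1 (h' hxe)
      exact hv (this ▸ hx)
  refine hK.2 v (isSeparatingVertex_iff.2 ⟨K.V ∩ S₁, K.V ∩ S₂, ⟨Set.inter_subset_left,
    Set.inter_subset_left, ?_, ?_, ?_⟩, ⟨b, ⟨hb, (hcov b hb).resolve_right hb2⟩, ?_⟩,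
    ⟨a, ⟨ha, (hcov a ha).resolve_left ha1⟩, ?_⟩⟩)
  · intro x hx
    rcases hcov x hx with h' | h'
    · exact .inl ⟨hx, h'⟩
    · exact .inr ⟨hx, h'⟩
  · intro e he
    exact (hedge e he).imp (Set.subset_inter (K.inc_subset e he))
      (Set.subset_inter (K.inc_subset e he))
  · rw [← Set.inter_inter_distrib_left, h.inter]
    simpa using hv
  · rintro rfl; exact hb2 h.mem_right
  · rintro rfl; exact ha1 h.mem_left

/-- Collapsing everything outside `S₁` to `v` turns walks of `G` into walks of `G[S₁]`: an edge
inside `S₂` becomes a stationary step. -/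
theorem IsSeparation.isConnected_induce {G : MultiHypergraph α β} {v : α} {S₁ S₂ : Set α}
    (h : G.IsSeparation v S₁ S₂) (hG : G.IsConnected) : (G.induce S₁).IsConnected := by
  classical
  rw [isConnected_iff]
  intro a ha b hb
  let r : α → α := fun x => if x ∈ S₁ then x else v
  have hr : ∀ x, ReflTransGen (Within G.Link G.V) a x →
      ReflTransGen (Within (G.induce S₁).Link (G.induce S₁).V) a (r x) := by
    intro x hx
    induction hx with
    | refl => simp [r, ha.2]; exact .refl
    | @tail x y _ hxy ih =>
      obtain ⟨hx, hy, e, he, hxe, hye⟩ := hxy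
      rcases h.edges e he with h' | h'
      · refine ih.tail ?_
        have hE : e ∈ (G.induce S₁).E := ⟨he, h'⟩
        simp only [r, h' hxe, h' hye, if_true]
        refine ⟨⟨hx, h' hxe⟩, ⟨hy, h' hye⟩, e, hE, ?_⟩
        rw [induce_inc hE]
        exact ⟨hxe, hye⟩
      · have : ∀ z ∈ G.inc e, r z = v := by
          intro z hz
          by_cases hz1 : z ∈ S₁
          · simp [r, h.eq_of_mem hz1 (h' hz)]
          · simp [r, hz1]
        rw [this y hye, ← this x hxe]
        exact ih
  have := hr b (isConnected_iff.1 hG a ha.1 b hb.1)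
  simpa [r, hb.2] using this

/-- The subhypergraph consisting of one edge and its vertices. -/
def edgeSub (G : MultiHypergraph α β) (e : β) (he : e ∈ G.E) : MultiHypergraph α β where
  V := G.inc e
  E := {e}
  inc f := {x | f = e ∧ x ∈ G.inc e}
  finite_V := G.finite_V.subset (G.inc_subset e he)
  finite_E := Set.finite_singleton e
  inc_subset := fun _ _ _ hx => hx.2
  two_le_inc := fun f hf => by
    rw [Set.mem_singleton_iff] at hf
    subst hf
    simpa using G.two_le_inc f he
  inc_eq_empty := fun f hf => Set.eq_empty_of_forall_notMem fun _ hx => hf hx.1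

theorem edgeSub_le {G : MultiHypergraph α β} {e : β} (he : e ∈ G.E) : G.edgeSub e he ≤ G := by
  refine ⟨G.inc_subset e he, Set.singleton_subset_iff.2 he, fun f hf => ?_⟩
  rw [Set.mem_singleton_iff.1 hf]
  simp [edgeSub]

theorem isNonsep_edgeSub {G : MultiHypergraph α β} {e : β} (he : e ∈ G.E) :
    (G.edgeSub e he).IsNonsep := by
  have hinc : (G.edgeSub e he).inc e = G.inc e := by simp [edgeSub]
  constructor
  · rw [isConnected_iff]
    intro a ha b hb
    refine .single ⟨ha, hb, e, rfl, ?_⟩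
    rw [hinc]
    exact ⟨ha, hb⟩
  · intro v hv
    obtain ⟨S₁, S₂, h, ⟨a, ha, hav⟩, ⟨b, hb, hbv⟩⟩ := isSeparatingVertex_iff.1 hv
    rcases h.edges e rfl with h' | h' <;> rw [hinc] at h'
    · exact hbv (h.eq_of_mem (h' (h.2 hb)) hb)
    · exact hav (h.eq_of_mem ha (h' (h.1 ha)))

theorem exists_edge_of_isConnected {G : MultiHypergraph α β} (hG : G.IsConnected) {a b : α}
    (ha : a ∈ G.V) (hb : b ∈ G.V) (hab : a ≠ b) : ∃ e ∈ G.E, a ∈ G.inc e := by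
  obtain ⟨x, hx, y, hy, rfl, -, e, he, hxe, -⟩ :=
    (isConnected_iff.1 hG).exists_crossing (T := {a}) ha hb rfl hab.symm
  exact ⟨e, he, hxe⟩

/-- A subhypergraph with at most one vertex has no edge, and it is properly contained in a single
edge, which is itself connected without separating vertex. The empty hypergraph counts as connected
here and is excluded in the same way. -/
theorem exists_ne_of_mem_blocks {G B : MultiHypergraph α β} (hG : G.IsConnected)
    (hB : B ∈ G.blocks) {a b : α} (ha : a ∈ G.V) (hb : b ∈ G.V) (hab : a ≠ b) :
    ∃ x ∈ B.V, ∃ y ∈ B.V, x ≠ y := by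
  by_contra! hcon
  rw [mem_blocks_iff] at hB
  have hE : B.E = ∅ := by
    by_contra hne
    obtain ⟨e, he⟩ := Set.nonempty_iff_ne_empty.2 hne
    obtain ⟨x, hx, y, hy, hxy⟩ := exists_pair he
    exact hxy (hcon x (B.inc_subset e he hx) y (B.inc_subset e he hy))
  obtain ⟨z, hz, hBz⟩ : ∃ z ∈ G.V, B.V ⊆ {z} := by
    by_cases hne : B.V.Nonempty
    · obtain ⟨z, hz⟩ := hne
      exact ⟨z, hB.1.1.1 hz, fun x hx => hcon x hx z hz⟩
    · exact ⟨a, ha, by simp [Set.not_nonempty_iff_eq_empty.1 hne]⟩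
  obtain ⟨e, he, hze⟩ : ∃ e ∈ G.E, z ∈ G.inc e := by
    by_cases hza : z = a
    · subst hza; exact exists_edge_of_isConnected hG hz hb hab
    · exact exists_edge_of_isConnected hG hz ha hza
  have hle : B ≤ G.edgeSub e he := by
    refine ⟨fun x hx => ?_, by simp [hE], by simp [hE]⟩
    rw [hBz hx]; exact hze
  have := hB.2 _ (edgeSub_le he) (isNonsep_edgeSub he) hle
  have h2 := this.2.1 (rfl : e ∈ (G.edgeSub e he).E)
  simp [hE] at h2

theorem IsSeparation.mem_blocks_or {G B : MultiHypergraph α β} {v : α} {S₁ S₂ : Set α}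
    (h : G.IsSeparation v S₁ S₂) (hB : B ∈ G.blocks) :
    B ∈ (G.induce S₁).blocks ∨ B ∈ (G.induce S₂).blocks := by
  rw [mem_blocks_iff] at hB
  simp only [mem_blocks_iff]
  exact (hB.1.2.subset_of_isSeparation hB.1.1 h).imp
    (fun hS => ⟨⟨le_induce hB.1.1 hS, hB.1.2⟩, fun K hK => hB.2 K (hK.trans (induce_le _ _))⟩)
    (fun hS => ⟨⟨le_induce hB.1.1 hS, hB.1.2⟩, fun K hK => hB.2 K (hK.trans (induce_le _ _))⟩)

/-- The vertex `a` is needed: if `S₁ = {v}`, the one-vertex block of `G[S₁]` need not be maximal in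
`G`. -/
theorem IsSeparation.mem_blocks {G B : MultiHypergraph α β} {v a : α} {S₁ S₂ : Set α}
    (h : G.IsSeparation v S₁ S₂) (hG : G.IsConnected) (ha : a ∈ S₁) (hav : a ≠ v)
    (hB : B ∈ (G.induce S₁).blocks) : B ∈ G.blocks := by
  obtain ⟨x, hx, y, hy, hxy⟩ := exists_ne_of_mem_blocks (h.isConnected_induce hG) hB
    ⟨h.1 ha, ha⟩ ⟨h.1 h.mem_left, h.mem_left⟩ hav
  rw [mem_blocks_iff] at hB ⊢
  refine ⟨⟨hB.1.1.trans (induce_le _ _), hB.1.2⟩, fun K hK hKn hBK => ?_⟩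
  rcases hKn.subset_of_isSeparation hK h with hS | hS
  · exact hB.2 K (le_induce hK hS) hKn hBK
  · have : ∀ z ∈ B.V, z = v := fun z hz => h.eq_of_mem (hB.1.1.1 hz).2 (hS (hBK.1 hz))
    exact absurd ((this x hx).trans (this y hy).symm) hxy

/-- The union of two subhypergraphs of `G`. -/
def unionSub (G K L : MultiHypergraph α β) (hK : K ≤ G) (hL : L ≤ G) : MultiHypergraph α β where
  V := K.V ∪ L.V
  E := K.E ∪ L.E
  inc e := {x | e ∈ K.E ∪ L.E ∧ x ∈ G.inc e}
  finite_V := K.finite_V.union L.finite_V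
  finite_E := K.finite_E.union L.finite_E
  inc_subset := by
    rintro e (he | he) x ⟨-, hx⟩
    · rw [← inc_of_le hK he] at hx; exact .inl (K.inc_subset e he hx)
    · rw [← inc_of_le hL he] at hx; exact .inr (L.inc_subset e he hx)
  two_le_inc := fun e he => by
    have : {x | e ∈ K.E ∪ L.E ∧ x ∈ G.inc e} = G.inc e :=
      Set.ext fun x => ⟨fun h => h.2, fun h => ⟨he, h⟩⟩
    rw [this]
    exact G.two_le_inc e (he.elim (fun h => hK.2.1 h) fun h => hL.2.1 h)
  inc_eq_empty := fun _ he => Set.eq_empty_of_forall_notMem fun _ hx => he hx.1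

/-- The union of the two blocks has no separating vertex: each block lies on one side of a
separation, and on opposite sides both common vertices would be the separating one. Maximality then
identifies both blocks with the union. -/
theorem eq_of_mem_blocks {G K L : MultiHypergraph α β} (hK : K ∈ G.blocks) (hL : L ∈ G.blocks)
    {a b : α} (haK : a ∈ K.V) (haL : a ∈ L.V) (hbK : b ∈ K.V) (hbL : b ∈ L.V) (hab : a ≠ b) :
    K = L := by
  rw [mem_blocks_iff] at hK hL
  let U := G.unionSub K L hK.1.1 hL.1.1
  have hinc : ∀ e ∈ U.E, U.inc e = G.inc e := fun e he =>
    Set.ext fun x => ⟨fun h => h.2, fun h => ⟨he, h⟩⟩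
  have hUG : U ≤ G := ⟨Set.union_subset hK.1.1.1 hL.1.1.1, Set.union_subset hK.1.1.2.1 hL.1.1.2.1,
    hinc⟩
  have hKU : K ≤ U := ⟨Set.subset_union_left, Set.subset_union_left, fun e he => by
    rw [hinc e (.inl he), inc_of_le hK.1.1 he]⟩
  have hLU : L ≤ U := ⟨Set.subset_union_right, Set.subset_union_right, fun e he => by
    rw [hinc e (.inr he), inc_of_le hL.1.1 he]⟩
  have step : ∀ M : MultiHypergraph α β, M ≤ U → M.IsConnected → ∀ x ∈ M.V, ∀ y ∈ M.V,
      ReflTransGen (Within U.Link U.V) x y := by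
    intro M hM hc x hx y hy
    refine ReflTransGen.mono (fun p q hpq => ?_) _ _ (isConnected_iff.1 hc x hx y hy)
    obtain ⟨hp, hq, e, he, hpe, hqe⟩ := hpq
    rw [inc_of_le hM he] at hpe hqe
    exact ⟨hM.1 hp, hM.1 hq, e, hM.2.1 he, hpe, hqe⟩
  have hU : U.IsNonsep := by
    constructor
    · rw [isConnected_iff]
      rintro x (hx | hx) y (hy | hy)
      · exact step K hKU hK.1.2.1 x hx y hy
      · exact (step K hKU hK.1.2.1 x hx a haK).trans (step L hLU hL.1.2.1 a haL y hy)
      · exact (step L hLU hL.1.2.1 x hx a haL).trans (step K hKU hK.1.2.1 a haK y hy)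
      · exact step L hLU hL.1.2.1 x hx y hy
    · intro v hv
      obtain ⟨S₁, S₂, h, ⟨p, hp, hpv⟩, ⟨q, hq, hqv⟩⟩ := isSeparatingVertex_iff.1 hv
      rcases hK.1.2.subset_of_isSeparation hKU h with h1 | h1 <;>
        rcases hL.1.2.subset_of_isSeparation hLU h with h2 | h2
      · exact hqv (h.eq_of_mem ((h.2 hq).elim (fun h => h1 h) fun h => h2 h) hq)
      · exact hab ((h.eq_of_mem (h1 haK) (h2 haL)).trans (h.eq_of_mem (h1 hbK) (h2 hbL)).symm)
      · exact hab ((h.eq_of_mem (h2 haL) (h1 haK)).trans (h.eq_of_mem (h2 hbL) (h1 hbK)).symm)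
      · exact hpv (h.eq_of_mem hp ((h.1 hp).elim (fun h => h1 h) fun h => h2 h))
  exact le_antisymm (hKU.trans (hL.2 U hUG hU hLU)) (hLU.trans (hK.2 U hUG hU hKU))

theorem blocks_eq_of_isNonsep {G B : MultiHypergraph α β} (hG : G.IsNonsep) (hB : B ∈ G.blocks) :
    B = G := by
  rw [mem_blocks_iff] at hB
  exact le_antisymm hB.1.1 (hB.2 G le_rfl hG hB.1.1)

/-! ### Matching families and partial colorings -/

namespace Cover

variable {G : MultiHypergraph α β}

/-- `M` is a family of matchings as required in the definition of a cover. -/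
def IsMatchingFamily (C : G.Cover γ δ) (M : β → Set δ) : Prop :=
  (∀ e ∈ G.E, (C.H.induce (⋃ v ∈ G.inc e, C.X v)).IsMatching (M e) ∧
    ∀ f ∈ M e, ∀ v ∈ G.inc e, (C.H.inc f ∩ C.X v).ncard = 1) ∧ C.H.E = ⋃ e ∈ G.E, M e

theorem exists_isMatchingFamily (C : G.Cover γ δ) : ∃ M, C.IsMatchingFamily M := C.matchings

theorem X_subset (C : G.Cover γ δ) {v : α} (hv : v ∈ G.V) : C.X v ⊆ C.H.V := by
  rw [C.vertices]
  exact Set.subset_biUnion_of_mem hv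

theorem X_finite (C : G.Cover γ δ) (v : α) : (C.X v).Finite := by
  by_cases hv : v ∈ G.V
  · exact C.H.finite_V.subset (C.X_subset hv)
  · rw [C.X_eq_empty v hv]; exact Set.finite_empty

theorem mem_V_of_mem_X (C : G.Cover γ δ) {v : α} {x : γ} (hx : x ∈ C.X v) : v ∈ G.V := by
  by_contra hv
  rw [C.X_eq_empty v hv] at hx
  exact hx

theorem eq_of_mem_X (C : G.Cover γ δ) {u v : α} {x : γ} (hu : x ∈ C.X u) (hv : x ∈ C.X v) :
    u = v := by
  by_contra h
  exact Set.disjoint_left.1 (C.X_disjoint u (C.mem_V_of_mem_X hu) v (C.mem_V_of_mem_X hv) h) hu hv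

section Matching

variable {C : G.Cover γ δ} {M : β → Set δ}

theorem IsMatchingFamily.mem_E (hM : C.IsMatchingFamily M) {e : β} (he : e ∈ G.E) {f : δ}
    (hf : f ∈ M e) : f ∈ C.H.E := by
  rw [hM.2]
  exact Set.mem_biUnion he hf

theorem IsMatchingFamily.exists_mem (hM : C.IsMatchingFamily M) {f : δ} (hf : f ∈ C.H.E) :
    ∃ e ∈ G.E, f ∈ M e := by
  rw [hM.2] at hf
  simpa using hf

theorem IsMatchingFamily.exists_X (hM : C.IsMatchingFamily M) {e : β} (he : e ∈ G.E) {f : δ}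
    (hf : f ∈ M e) {x : γ} (hx : x ∈ C.H.inc f) : ∃ v ∈ G.inc e, x ∈ C.X v := by
  have := ((hM.1 e he).1.1 hf).2 hx
  simpa using this

theorem IsMatchingFamily.exists_inc (hM : C.IsMatchingFamily M) {e : β} (he : e ∈ G.E) {f : δ}
    (hf : f ∈ M e) {v : α} (hv : v ∈ G.inc e) : ∃ x, C.H.inc f ∩ C.X v = {x} :=
  Set.ncard_eq_one.1 ((hM.1 e he).2 f hf v hv)

theorem IsMatchingFamily.eq_of_inc (hM : C.IsMatchingFamily M) {e : β} (he : e ∈ G.E) {f : δ}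
    (hf : f ∈ M e) {v : α} (hv : v ∈ G.inc e) {x y : γ} (hx : x ∈ C.H.inc f) (hxv : x ∈ C.X v)
    (hy : y ∈ C.H.inc f) (hyv : y ∈ C.X v) : x = y := by
  obtain ⟨z, hz⟩ := hM.exists_inc he hf hv
  exact (hz.le ⟨hx, hxv⟩).trans (hz.le ⟨hy, hyv⟩).symm

theorem IsMatchingFamily.eq_of_mem_inc (hM : C.IsMatchingFamily M) {e : β} (he : e ∈ G.E)
    {f f' : δ} (hf : f ∈ M e) (hf' : f' ∈ M e) {x : γ} (hx : x ∈ C.H.inc f)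
    (hx' : x ∈ C.H.inc f') : f = f' := by
  have hmat := (hM.1 e he).1
  have h1 := hmat.1 hf
  refine hmat.2 x ⟨C.H.inc_subset f h1.1 hx, h1.2 hx⟩ f hf f' hf' ?_ ?_
  · rw [induce_inc h1]; exact hx
  · rw [induce_inc (hmat.1 hf')]; exact hx'

/-- The colors that `φ` assigns to the vertices of `e` all lie on one edge of `M e`. -/
def Hit (C : G.Cover γ δ) (M : β → Set δ) (e : β) (φ : α → γ) : Prop :=
  ∃ f ∈ M e, ∀ v ∈ G.inc e, φ v ∈ C.H.inc f

theorem Hit.congr {e : β} {φ ψ : α → γ} (h : C.Hit M e φ) (hφ : ∀ v ∈ G.inc e, φ v = ψ v) :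
    C.Hit M e ψ := by
  obtain ⟨f, hf, h⟩ := h
  exact ⟨f, hf, fun v hv => by rw [← hφ v hv]; exact h v hv⟩

/-- This is where matchings enter: the color at one vertex of `e` determines the edge of `M e`, and
that edge determines the colors at the other vertices. -/
theorem Hit.agree (hM : C.IsMatchingFamily M) {e : β} (he : e ∈ G.E) {φ ψ : α → γ}
    (h : C.Hit M e φ) (h' : C.Hit M e ψ) {u v : α} (hu : u ∈ G.inc e) (huv : φ u = ψ u)
    (hv : v ∈ G.inc e) (hφ : φ v ∈ C.X v) (hψ : ψ v ∈ C.X v) : φ v = ψ v := by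
  obtain ⟨f, hf, h⟩ := h
  obtain ⟨f', hf', h'⟩ := h'
  have : f = f' := hM.eq_of_mem_inc he hf hf' (h u hu) (huv ▸ h' u hu)
  subst this
  exact hM.eq_of_inc he hf hv (h v hv) hφ (h' v hv) hψ

/-- `φ` restricted to `S` is a partial coloring: `φ '' S` is independent. -/
def Proper (C : G.Cover γ δ) (S : Set α) (φ : α → γ) : Prop :=
  (∀ v ∈ S, φ v ∈ C.X v) ∧ ∀ f ∈ C.H.E, ¬ C.H.inc f ⊆ φ '' S

theorem IsMatchingFamily.subset_image_iff (hM : C.IsMatchingFamily M) {e : β} (he : e ∈ G.E)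
    {f : δ} (hf : f ∈ M e) {S : Set α} {φ : α → γ} (hφ : ∀ v ∈ S, φ v ∈ C.X v) :
    C.H.inc f ⊆ φ '' S ↔ G.inc e ⊆ S ∧ ∀ v ∈ G.inc e, φ v ∈ C.H.inc f := by
  constructor
  · intro h
    have key : ∀ v ∈ G.inc e, v ∈ S ∧ φ v ∈ C.H.inc f := by
      intro v hv
      obtain ⟨x, hx⟩ := hM.exists_inc he hf hv
      have hx' := hx.ge rfl
      obtain ⟨s, hs, rfl⟩ := h hx'.1
      have := C.eq_of_mem_X (hφ s hs) hx'.2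
      subst this
      exact ⟨hs, hx'.1⟩
    exact ⟨fun v hv => (key v hv).1, fun v hv => (key v hv).2⟩
  · rintro ⟨hS, h⟩ x hx
    obtain ⟨v, hv, hxv⟩ := hM.exists_X he hf hx
    exact ⟨v, hS hv, hM.eq_of_inc he hf hv (h v hv) (hφ v (hS hv)) hx hxv⟩

/-- Turns independence in `H` into a condition on the edges of `G` that are completely colored. -/
theorem proper_iff (hM : C.IsMatchingFamily M) {S : Set α} {φ : α → γ} :
    C.Proper S φ ↔ (∀ v ∈ S, φ v ∈ C.X v) ∧ ∀ e ∈ G.E, G.inc e ⊆ S → ¬ C.Hit M e φ := by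
  refine and_congr_right fun hφ => ⟨fun h e he hS ⟨f, hf, hfe⟩ => ?_, fun h f hf hfS => ?_⟩
  · exact h f (hM.mem_E he hf) ((hM.subset_image_iff he hf hφ).2 ⟨hS, hfe⟩)
  · obtain ⟨e, he, hfe⟩ := hM.exists_mem hf
    have := (hM.subset_image_iff he hfe hφ).1 hfS
    exact h e he this.1 ⟨f, hfe, this.2⟩

end Matching

theorem isColorable_of (C : G.Cover γ δ) {H : MultiHypergraph γ δ} {φ : α → γ}
    (hV : ∀ v ∈ G.V, C.X v ⊆ H.V) (hφ : ∀ v ∈ G.V, φ v ∈ C.X v)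
    (h : ∀ f ∈ H.E, ¬ H.inc f ⊆ φ '' G.V) : G.IsColorable C.X H := by
  refine ⟨φ '' G.V, ?_, ?_, ?_⟩
  · rintro _ ⟨v, hv, rfl⟩
    exact hV v hv (hφ v hv)
  · intro v hv
    rw [Set.ncard_eq_one]
    refine ⟨φ v, Set.eq_singleton_iff_unique_mem.2 ⟨⟨⟨v, hv, rfl⟩, hφ v hv⟩, ?_⟩⟩
    rintro _ ⟨⟨u, hu, rfl⟩, hx⟩
    rw [C.eq_of_mem_X (hφ u hu) hx]
  · exact Set.eq_empty_of_forall_notMem fun f hf => h f hf.1 hf.2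

theorem exists_of_isColorable (C : G.Cover γ δ) [Nonempty γ] {H : MultiHypergraph γ δ}
    (h : G.IsColorable C.X H) :
    ∃ φ : α → γ, (∀ v ∈ G.V, φ v ∈ C.X v) ∧ ∀ f ∈ H.E, ¬ H.inc f ⊆ φ '' G.V := by
  classical
  obtain ⟨T, hTV, hT, hind⟩ := h
  have : ∀ v, ∃ x, v ∈ G.V → x ∈ T ∧ x ∈ C.X v := by
    intro v
    by_cases hv : v ∈ G.V
    · obtain ⟨x, hx⟩ := Set.ncard_eq_one.1 (hT v hv)
      exact ⟨x, fun _ => hx.ge rfl⟩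
    · exact ⟨Classical.arbitrary γ, fun h => absurd h hv⟩
  choose φ hφ using this
  refine ⟨φ, fun v hv => (hφ v hv).2, fun f hf hsub => ?_⟩
  have : f ∈ (H.induce T).E := ⟨hf, fun x hx => by
    obtain ⟨v, hv, rfl⟩ := hsub hx
    exact (hφ v hv).1⟩
  rw [hind] at this
  exact this

theorem not_proper_of_not_isColorable {C : G.Cover γ δ} (h : ¬ G.IsColorable C.X C.H) (φ : α → γ) :
    ¬ C.Proper G.V φ :=
  fun hφ => h (C.isColorable_of (fun _ hv => C.X_subset hv) hφ.1 hφ.2)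

/-- Restates minimality through color functions: some choice of colors violates at most the edge
`e`. -/
theorem isColorable_deleteEdge_iff (C : G.Cover γ δ) {e : δ} (he : e ∈ C.H.E) :
    G.IsColorable C.X (C.H.deleteEdge e) ↔
      ∃ φ : α → γ, (∀ v ∈ G.V, φ v ∈ C.X v) ∧ ∀ f ∈ C.H.E, f ≠ e → ¬ C.H.inc f ⊆ φ '' G.V := by
  obtain ⟨a, ha, -⟩ := exists_pair he
  have : Nonempty γ := ⟨a⟩
  have hinc : ∀ f, f ≠ e → (C.H.deleteEdge e).inc f = C.H.inc f := fun f hf =>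
    Set.ext fun x => ⟨fun h => h.2, fun h => ⟨hf, h⟩⟩
  constructor
  · intro h
    obtain ⟨φ, h1, h2⟩ := C.exists_of_isColorable (H := C.H.deleteEdge e) h
    exact ⟨φ, h1, fun f hf hfe => by rw [← hinc f hfe]; exact h2 f ⟨hf, hfe⟩⟩
  · rintro ⟨φ, h1, h2⟩
    exact C.isColorable_of (fun v hv => C.X_subset hv) h1 fun f hf => by
      rw [hinc f hf.2]; exact h2 f hf.1 hf.2

/-! ### Colorings of all vertices but one, and moving the uncolored vertex -/

section State

variable {C : G.Cover γ δ} {M : β → Set δ} [DecidableEq α]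

theorem update_mem_X {S : Set α} {u : α} {φ : α → γ} {x : γ} (hφ : ∀ v ∈ S, φ v ∈ C.X v)
    (hx : x ∈ C.X u) : ∀ v ∈ insert u S, update φ u x v ∈ C.X v := by
  intro v hv
  by_cases h : v = u
  · subst h; simpa using hx
  · rw [update_of_ne h]; exact hφ v (hv.resolve_left h)

theorem update_hit_injective (hM : C.IsMatchingFamily M) {e : β} (he : e ∈ G.E) {φ : α → γ}
    {u : α} (hu : u ∈ G.inc e) {x y : γ} (hx : x ∈ C.X u) (hy : y ∈ C.X u)
    (h : C.Hit M e (update φ u x)) (h' : C.Hit M e (update φ u y)) : x = y := by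
  obtain ⟨w, hw, hwu⟩ : ∃ w ∈ G.inc e, w ≠ u := by
    obtain ⟨a, ha, b, hb, hab⟩ := exists_pair he
    by_cases h : a = u
    · exact ⟨b, hb, fun h' => hab (h.trans h'.symm)⟩
    · exact ⟨a, ha, h⟩
  have := Hit.agree hM he h h' hw (by simp [hwu]) hu (by simpa using hx) (by simpa using hy)
  simpa using this

/-- Each forbidden color of `u` is charged to a completely colored edge at `u`, injectively. The
edge `e₀` still has an uncolored vertex and is never charged, so fewer than `d(u)` colors are
forbidden. -/
theorem exists_color (hM : C.IsMatchingFamily M) {S : Set α} {φ : α → γ} (hφ : C.Proper S φ)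
    {u : α} {e₀ : β} (he₀ : e₀ ∈ G.E) (hu₀ : u ∈ G.inc e₀)
    (hS₀ : ¬ G.inc e₀ ⊆ insert u S) (hdeg : G.degree u ≤ (C.X u).ncard) :
    ∃ x ∈ C.X u, C.Proper (insert u S) (update φ u x) := by
  by_contra! hcon
  have hhit : ∀ x ∈ C.X u, ∃ e ∈ G.E, G.inc e ⊆ insert u S ∧ u ∈ G.inc e ∧
      C.Hit M e (update φ u x) := by
    intro x hx
    have := hcon x hx
    rw [proper_iff hM] at this
    push Not at this
    obtain ⟨e, he, heS, hh⟩ := this (update_mem_X hφ.1 hx)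
    refine ⟨e, he, heS, ?_, hh⟩
    by_contra hue
    refine ((proper_iff hM).1 hφ).2 e he (fun v hv => (heS hv).resolve_left ?_) (hh.congr ?_)
    · rintro rfl; exact hue hv
    · intro v hv
      rw [update_of_ne]
      rintro rfl; exact hue hv
  have : Nonempty β := ⟨e₀⟩
  choose! g hg1 hg2 hg3 hg4 using hhit
  have hfin : {e | e ∈ G.E ∧ u ∈ G.inc e}.Finite := G.finite_E.subset fun e he => he.1
  have hle : (C.X u).ncard ≤ ({e | e ∈ G.E ∧ u ∈ G.inc e} \ {e₀}).ncard := by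
    refine Set.ncard_le_ncard_of_injOn g (fun x hx => ⟨⟨hg1 x hx, hg3 x hx⟩, ?_⟩) ?_ hfin.sdiff
    · intro h
      exact hS₀ (h ▸ hg2 x hx)
    · intro x hx y hy hxy
      refine update_hit_injective hM (hg1 x hx) (hg3 x hx) hx hy (hg4 x hx) ?_
      rw [hxy]
      exact hg4 y hy
  have hlt := Set.ncard_sdiff_singleton_lt_of_mem (s := {e | e ∈ G.E ∧ u ∈ G.inc e})
    ⟨he₀, hu₀⟩ hfin
  unfold degree at hdeg
  omega

/-- Greedy coloring towards `v`: a vertex is colored while some vertex on a common edge with it,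
nearer to `v`, is still uncolored. Nothing is required of the size of `X_v`. -/
theorem exists_extension (hM : C.IsMatchingFamily M) {S : Set α} (hSV : S ⊆ G.V) {φ : α → γ}
    (hφ : C.Proper S φ) {v : α} (hv : v ∈ G.V) (hvS : v ∉ S) (hconn : PreconnOn G.Link (G.V \ S))
    (hdeg : ∀ u ∈ G.V, u ∉ S → u ≠ v → G.degree u ≤ (C.X u).ncard) :
    ∃ ψ, C.Proper (G.V \ {v}) ψ ∧ ∀ s ∈ S, ψ s = φ s := by
  -- The sets that may safely be left uncolored. A maximal one absorbs every vertex joined to it by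
  -- an edge, so connectivity makes it all of `G.V \ S`.
  let P : Set (Set α) := {T | T ⊆ G.V \ S ∧ v ∈ T ∧ ∀ φ, C.Proper (G.V \ T) φ →
    ∃ ψ, C.Proper (G.V \ {v}) ψ ∧ ∀ s ∈ G.V \ T, ψ s = φ s}
  have hfin : P.Finite := (G.finite_V.subset Set.sdiff_subset).finite_subsets.subset fun T hT => hT.1
  obtain ⟨T, hT⟩ := hfin.exists_maximal ⟨{v}, by simp [hv, hvS], rfl, fun φ hφ => ⟨φ, hφ, by simp⟩⟩
  have hTeq : G.V \ S ⊆ T := by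
    by_contra hne
    obtain ⟨w, hw, hwT⟩ := Set.not_subset.1 hne
    obtain ⟨a, ha, u, hu, haT, huT, e, he, hae, hue⟩ :=
      hconn.exists_crossing ⟨hv, hvS⟩ hw hT.1.2.1 hwT
    have hmem : insert u T ∈ P := by
      refine ⟨Set.insert_subset hu hT.1.1, .inr hT.1.2.1, fun φ hφ => ?_⟩
      have hset : insert u (G.V \ insert u T) = G.V \ T := by
        ext x
        have := hu.1
        simp only [Set.mem_insert_iff, Set.mem_sdiff]
        grind
      obtain ⟨x, hx, hpx⟩ := exists_color hM hφ he hue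
        (fun h => by rw [hset] at h; exact (h hae).2 haT)
        (hdeg u hu.1 hu.2 (by rintro rfl; exact huT hT.1.2.1))
      rw [hset] at hpx
      obtain ⟨ψ, hψ, hψ'⟩ := hT.1.2.2 _ hpx
      refine ⟨ψ, hψ, fun s hs => ?_⟩
      rw [hψ' s ⟨hs.1, fun h => hs.2 (.inr h)⟩, update_of_ne]
      rintro rfl; exact hs.2 (.inl rfl)
    exact huT (hT.2 hmem (Set.subset_insert u T) (.inl rfl))
  have hVT : G.V \ T = S := by
    ext x
    have h1 := @hTeq x
    have h2 := @hT.1.1 x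
    have h3 := @hSV x
    simp only [Set.mem_sdiff] at *
    tauto
  have := hT.1.2.2 φ (by rw [hVT]; exact hφ)
  rwa [hVT] at this

theorem exists_hit (hM : C.IsMatchingFamily M) (hC : ∀ φ, ¬ C.Proper G.V φ) {v : α} (hv : v ∈ G.V)
    {φ : α → γ} (hφ : C.Proper (G.V \ {v}) φ) {x : γ} (hx : x ∈ C.X v) :
    ∃ e ∈ G.E, v ∈ G.inc e ∧ C.Hit M e (update φ v x) := by
  have h := hC (update φ v x)
  rw [proper_iff hM] at h
  push Not at h
  obtain ⟨e, he, -, hh⟩ := h fun u hu => update_mem_X hφ.1 hx u (by simp [hu])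
  refine ⟨e, he, ?_, hh⟩
  by_contra hve
  have hne : ∀ u ∈ G.inc e, u ≠ v := by rintro u hu rfl; exact hve hu
  exact ((proper_iff hM).1 hφ).2 e he (fun u hu => ⟨G.inc_subset e he hu, hne u hu⟩)
    (hh.congr fun u hu => by rw [update_of_ne (hne u hu)])

theorem exists_hit_bijection [Nonempty β] (hM : C.IsMatchingFamily M) (hC : ∀ φ, ¬ C.Proper G.V φ) {v : α}
    (hv : v ∈ G.V) {φ : α → γ} (hφ : C.Proper (G.V \ {v}) φ) :
    ∃ g : γ → β, (∀ x ∈ C.X v, g x ∈ {e | e ∈ G.E ∧ v ∈ G.inc e}) ∧ Set.InjOn g (C.X v) ∧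
      ∀ x ∈ C.X v, C.Hit M (g x) (update φ v x) := by
  have := fun x (hx : x ∈ C.X v) => exists_hit hM hC hv hφ hx
  choose! g hg1 hg2 hg3 using this
  refine ⟨g, fun x hx => ⟨hg1 x hx, hg2 x hx⟩, fun x hx y hy hxy => ?_, hg3⟩
  refine update_hit_injective hM (hg1 x hx) (hg2 x hx) hx hy (hg3 x hx) ?_
  rw [hxy]
  exact hg3 y hy

theorem ncard_le_degree (hM : C.IsMatchingFamily M) (hC : ∀ φ, ¬ C.Proper G.V φ) {v : α}
    (hv : v ∈ G.V) {φ : α → γ} (hφ : C.Proper (G.V \ {v}) φ) : (C.X v).ncard ≤ G.degree v := by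
  obtain hX | ⟨x, hx⟩ := (C.X v).eq_empty_or_nonempty
  · simp [hX]
  have : Nonempty β := ⟨(exists_hit hM hC hv hφ hx).choose⟩
  obtain ⟨g, hg, hinj, -⟩ := exists_hit_bijection hM hC hv hφ
  exact Set.ncard_le_ncard_of_injOn g hg hinj (G.finite_E.subset fun e he => he.1)

/-- The injection from colors of `v` to edges at `v` is onto, since there are at least as many
colors as edges. So colors and edges correspond one to one. -/
theorem exists_hit_of_mem_inc (hM : C.IsMatchingFamily M) (hC : ∀ φ, ¬ C.Proper G.V φ) {v : α}
    (hv : v ∈ G.V) {φ : α → γ} (hφ : C.Proper (G.V \ {v}) φ) (hdeg : G.degree v ≤ (C.X v).ncard)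
    {e : β} (he : e ∈ G.E) (hve : v ∈ G.inc e) : ∃ x ∈ C.X v, C.Hit M e (update φ v x) ∧
      ∀ e' ∈ G.E, v ∈ G.inc e' → C.Hit M e' (update φ v x) → e' = e := by
  have : Nonempty β := ⟨e⟩
  obtain ⟨g, hg, hinj, hhit⟩ := exists_hit_bijection hM hC hv hφ
  have hsurj := Set.surj_on_of_inj_on_of_ncard_le (fun x (_ : x ∈ C.X v) => g x) hg
    (fun x y hx hy h => hinj hx hy h) hdeg (G.finite_E.subset fun e he => he.1)
  obtain ⟨x, hx, rfl⟩ := hsurj e ⟨he, hve⟩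
  refine ⟨x, hx, hhit x hx, fun e' he' hve' hh => ?_⟩
  obtain ⟨y, hy, rfl⟩ := hsurj e' ⟨he', hve'⟩
  rw [update_hit_injective hM he' hve' hx hy hh (hhit y hy)]

theorem eq_of_hit (hM : C.IsMatchingFamily M) (hC : ∀ φ, ¬ C.Proper G.V φ) {v : α}
    (hv : v ∈ G.V) {φ : α → γ} (hφ : C.Proper (G.V \ {v}) φ) (hdeg : G.degree v ≤ (C.X v).ncard)
    {x : γ} (hx : x ∈ C.X v) {e e' : β} (he : e ∈ G.E) (hve : v ∈ G.inc e)
    (hh : C.Hit M e (update φ v x)) (he' : e' ∈ G.E) (hve' : v ∈ G.inc e')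
    (hh' : C.Hit M e' (update φ v x)) : e' = e := by
  obtain ⟨y, hy, hy', huniq⟩ := exists_hit_of_mem_inc hM hC hv hφ hdeg he hve
  obtain rfl := update_hit_injective hM he hve hx hy hh hy'
  exact huniq e' he' hve' hh'

/-- The color `x` violates only `e`, and uncoloring `u` repairs `e`. This moves the hole from `v` to
`u`. -/
theorem proper_move (hM : C.IsMatchingFamily M) (hC : ∀ φ, ¬ C.Proper G.V φ) {v : α}
    (hv : v ∈ G.V) {φ : α → γ} (hφ : C.Proper (G.V \ {v}) φ) (hdeg : G.degree v ≤ (C.X v).ncard)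
    {x : γ} (hx : x ∈ C.X v) {e : β} (he : e ∈ G.E) (hve : v ∈ G.inc e)
    (hh : C.Hit M e (update φ v x)) {u : α} (hu : u ∈ G.inc e) :
    C.Proper (G.V \ {u}) (update φ v x) := by
  rw [proper_iff hM] at hφ ⊢
  refine ⟨fun w hw => update_mem_X hφ.1 hx w ?_, fun e' he' hS hh' => ?_⟩
  · have := hw.1
    simp [this]
  · by_cases hve' : v ∈ G.inc e'
    · rw [eq_of_hit hM hC hv ((proper_iff hM).2 hφ) hdeg hx he hve hh he' hve' hh'] at hS
      exact (hS hu).2 rfl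
    · have hne : ∀ u ∈ G.inc e', u ≠ v := by rintro u hu rfl; exact hve' hu
      exact hφ.2 e' he' (fun u hu => ⟨G.inc_subset e' he' hu, hne u hu⟩)
        (hh'.congr fun u hu => by rw [update_of_ne (hne u hu)])

theorem exists_proper_sdiff_singleton [Nonempty γ] (hM : C.IsMatchingFamily M)
    (hG : G.IsConnected) {v : α} (hv : v ∈ G.V)
    (hdeg : ∀ u ∈ G.V, u ≠ v → G.degree u ≤ (C.X u).ncard) :
    ∃ φ, C.Proper (G.V \ {v}) φ := by
  have h0 : C.Proper ∅ (fun _ : α => Classical.arbitrary γ) := by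
    refine ⟨by simp, fun f hf h => ?_⟩
    obtain ⟨a, ha, -⟩ := exists_pair hf
    simpa using h ha
  obtain ⟨ψ, hψ, -⟩ := exists_extension hM (Set.empty_subset G.V) h0 hv (Set.notMem_empty v)
    (by rw [Set.sdiff_empty]; exact isConnected_iff.1 hG) fun u hu _ => hdeg u hu
  exact ⟨ψ, hψ⟩

end State

end Cover

/-! ### Tight configurations and edges with at least three vertices -/

namespace Cover

variable {G : MultiHypergraph α β} {C : G.Cover γ δ} {M : β → Set δ}

/-- A degree-feasible configuration without coloring, with a chosen family of matchings. -/
structure IsTight (C : G.Cover γ δ) (M : β → Set δ) : Prop where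
  matching : C.IsMatchingFamily M
  connected : G.IsConnected
  uncolorable : ∀ φ, ¬ C.Proper G.V φ
  degree_le : ∀ v ∈ G.V, G.degree v ≤ (C.X v).ncard

theorem one_le_degree {e : β} (he : e ∈ G.E) {v : α} (hv : v ∈ G.inc e) : 1 ≤ G.degree v :=
  (Set.ncard_pos (G.finite_E.subset fun _ h => h.1)).2 ⟨e, he, hv⟩

theorem IsTight.X_nonempty (hC : C.IsTight M) {e : β} (he : e ∈ G.E) {v : α} (hv : v ∈ G.inc e) :
    (C.X v).Nonempty :=
  (Set.ncard_pos (C.X_finite v)).1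
    ((one_le_degree he hv).trans (hC.degree_le v (G.inc_subset e he hv)))

theorem IsTight.exists_state (hC : C.IsTight M) [Nonempty γ] {v : α} (hv : v ∈ G.V) :
    ∃ φ, C.Proper (G.V \ {v}) φ := by
  classical
  exact exists_proper_sdiff_singleton hC.matching hC.connected hv fun u hu _ => hC.degree_le u hu

theorem IsTight.ncard_X (hC : C.IsTight M) [Nonempty γ] {v : α} (hv : v ∈ G.V) :
    (C.X v).ncard = G.degree v := by
  classical
  obtain ⟨φ, hφ⟩ := hC.exists_state hv
  exact (ncard_le_degree hC.matching hC.uncolorable hv hφ).antisymm (hC.degree_le v hv)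

/-- If another edge meets `e₀` at `u`, the hole can travel from `u` to a second vertex `v` of `e₀`
without using `e₀`. This changes the color of `u` but not that of a third vertex `w`. The color at
`w` determines which edge of `M e₀` is hit, hence the color at `u`, a contradiction. -/
theorem IsTight.singleton_edge (hC : C.IsTight M) (hG : G.IsNonsep) {e₀ : β} (he₀ : e₀ ∈ G.E)
    (h3 : 3 ≤ (G.inc e₀).ncard) : G.E = {e₀} ∧ G.inc e₀ = G.V := by
  classical
  by_cases hex : ∃ u ∈ G.inc e₀, ∃ e₁ ∈ G.E, e₁ ≠ e₀ ∧ u ∈ G.inc e₁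
  swap
  · push Not at hex
    have hV : G.inc e₀ = G.V := by
      refine (G.inc_subset e₀ he₀).antisymm ?_
      by_contra hne
      obtain ⟨b, hb, hb'⟩ := Set.not_subset.1 hne
      obtain ⟨a, ha, -⟩ := exists_pair he₀
      obtain ⟨x, hx, y, hy, hxT, hyT, e, he, hxe, hye⟩ :=
        (isConnected_iff.1 hG.1).exists_crossing (G.inc_subset e₀ he₀ ha) hb ha hb'
      by_cases h : e = e₀
      · subst h; exact hyT hye
      · exact hex x hxT e he h hxe
    refine ⟨Set.eq_singleton_iff_unique_mem.2 ⟨he₀, fun e he => ?_⟩, hV⟩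
    by_contra h
    obtain ⟨a, ha, -⟩ := exists_pair he
    exact hex a (hV ▸ G.inc_subset e he ha) e he h ha
  exfalso
  obtain ⟨u, hu, e₁, he₁, hne, hu₁⟩ := hex
  have huV := G.inc_subset e₀ he₀ hu
  have : Nonempty γ := ⟨(hC.X_nonempty he₀ hu).choose⟩
  obtain ⟨φ₀, hφ₀⟩ := hC.exists_state huV
  obtain ⟨x₀, hx₀, hhit₀, -⟩ := exists_hit_of_mem_inc hC.matching hC.uncolorable huV hφ₀
    (hC.degree_le u huV) he₀ hu
  -- Routes for the hole: they avoid the edge `e₀` and never leave a vertex of `e₀` other than `u`,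
  -- so no vertex of `e₀` except `u` is recolored on the way.
  let step : α → α → Prop := fun a b => (a = u ∨ a ∉ G.inc e₀) ∧
    ∃ e ∈ G.E, e ≠ e₀ ∧ a ∈ G.inc e ∧ b ∈ G.inc e
  have hreachV : ∀ b, ReflTransGen step u b → b ∈ G.V := by
    intro b hb
    induction hb with
    | refl => exact huV
    | tail _ hs _ =>
      obtain ⟨-, e, he, -, -, h⟩ := hs
      exact G.inc_subset e he h
  -- Otherwise the vertices reached from `u` and the remaining ones, both taken with `u`, separate
  -- `G` at `u`.
  obtain ⟨v, hv, hvu, hreach⟩ : ∃ v ∈ G.inc e₀, v ≠ u ∧ ReflTransGen step u v := by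
    by_contra! hcon
    refine hG.2 u (isSeparatingVertex_iff.2 ⟨{b | ReflTransGen step u b},
      insert u (G.V \ {b | ReflTransGen step u b}), ⟨hreachV,
      Set.insert_subset huV Set.sdiff_subset, ?_, ?_, ?_⟩, ?_, ?_⟩)
    · intro x hx
      by_cases h : ReflTransGen step u x
      · exact .inl h
      · exact .inr (.inr ⟨hx, h⟩)
    · intro e he
      by_cases hee : e = e₀
      · subst hee
        refine .inr fun x hx => ?_
        by_cases hxu : x = u
        · exact .inl hxu
        · exact .inr ⟨G.inc_subset e he hx, fun h => hcon x hx hxu h⟩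
      · by_cases hx : ∃ x ∈ G.inc e, ReflTransGen step u x
        · obtain ⟨x, hxe, hx⟩ := hx
          refine .inl fun y hy => hx.tail ⟨?_, e, he, hee, hxe, hy⟩
          by_contra! h
          exact hcon x h.2 h.1 hx
        · push Not at hx
          exact .inr fun x hxe => .inr ⟨G.inc_subset e he hxe, hx x hxe⟩
    · ext x
      constructor
      · rintro ⟨h1, h2⟩
        exact h2.resolve_right fun h => h.2 h1
      · rintro rfl
        exact ⟨.refl, .inl rfl⟩
    · obtain ⟨a, ha, b, hb, hab⟩ := exists_pair he₁
      have hr : ∀ x ∈ G.inc e₁, ReflTransGen step u x := fun x hx =>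
        .single ⟨.inl rfl, e₁, he₁, hne, hu₁, hx⟩
      by_cases h : a = u
      · exact ⟨b, hr b hb, fun h' => hab (h.trans h'.symm)⟩
      · exact ⟨a, hr a ha, h⟩
    · obtain ⟨a, ha, b, hb, hab⟩ := exists_pair he₀
      have hr : ∀ x ∈ G.inc e₀, x ≠ u →
          x ∈ insert u (G.V \ {b | ReflTransGen step u b}) := fun x hx hxu =>
        .inr ⟨G.inc_subset e₀ he₀ hx, hcon x hx hxu⟩
      by_cases h : a = u
      · have hbu : b ≠ u := fun h' => hab (h.trans h'.symm)
        exact ⟨b, hr b hb hbu, hbu⟩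
      · exact ⟨a, hr a ha h, h⟩
  -- Whenever the route returns to `u`, the construction restarts from `φ₀`. Leaving `u` through an
  -- edge other than `e₀` forces a color other than `x₀`, because `x₀` hits only `e₀`.
  have key : ∀ b, ReflTransGen step u b → b = u ∨ ∃ φ, C.Proper (G.V \ {b}) φ ∧
      (∀ w ∈ G.inc e₀, w ≠ u → w ≠ b → φ w = φ₀ w) ∧ φ u ≠ x₀ := by
    intro b hb
    induction hb with
    | refl => exact .inl rfl
    | @tail a b hab hs ih =>
      obtain ⟨ha, e, he, hee, hae, hbe⟩ := hs
      have haV := G.inc_subset e he hae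
      by_cases hau : a = u
      · subst hau
        obtain ⟨x, hx, hhit, -⟩ := exists_hit_of_mem_inc hC.matching hC.uncolorable haV hφ₀
          (hC.degree_le a haV) he hae
        refine .inr ⟨update φ₀ a x, proper_move hC.matching hC.uncolorable haV hφ₀
          (hC.degree_le a haV) hx he hae hhit hbe, fun w _ hwa _ => update_of_ne hwa _ _, ?_⟩
        rw [update_self]
        rintro rfl
        exact hee (eq_of_hit hC.matching hC.uncolorable haV hφ₀ (hC.degree_le a haV) hx₀ he₀ hu
          hhit₀ he hae hhit)
      · obtain ⟨φ, hφ, hφ1, hφ2⟩ := ih.resolve_left hau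
        have hae₀ := ha.resolve_left hau
        obtain ⟨x, hx, hhit, -⟩ := exists_hit_of_mem_inc hC.matching hC.uncolorable haV hφ
          (hC.degree_le a haV) he hae
        refine .inr ⟨update φ a x, proper_move hC.matching hC.uncolorable haV hφ
          (hC.degree_le a haV) hx he hae hhit hbe, fun w hw hwu _ => ?_, ?_⟩
        · have hwa : w ≠ a := by rintro rfl; exact hae₀ hw
          rw [update_of_ne hwa]
          exact hφ1 w hw hwu hwa
        · rwa [update_of_ne (Ne.symm hau)]
  obtain ⟨φ, hφ, hφ1, hφ2⟩ := (key v hreach).resolve_left hvu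
  have hvV := G.inc_subset e₀ he₀ hv
  obtain ⟨y, hy, hhit, -⟩ := exists_hit_of_mem_inc hC.matching hC.uncolorable hvV hφ
    (hC.degree_le v hvV) he₀ hv
  obtain ⟨w, hw, hwuv⟩ : ∃ w ∈ G.inc e₀, w ∉ ({u, v} : Set α) := by
    by_contra! hcon
    have h1 := Set.ncard_le_ncard (show G.inc e₀ ⊆ {u, v} from hcon)
    have h2 := Set.ncard_pair (Ne.symm hvu)
    omega
  simp only [Set.mem_insert_iff, Set.mem_singleton_iff, not_or] at hwuv
  have := Hit.agree hC.matching he₀ hhit hhit₀ hw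
    (by rw [update_of_ne hwuv.2, update_of_ne hwuv.1]; exact hφ1 w hw hwuv.1 hwuv.2) hu
    (by rw [update_of_ne (Ne.symm hvu)]; exact hφ.1 u ⟨huV, Ne.symm hvu⟩) (by simpa using hx₀)
  rw [update_of_ne (Ne.symm hvu), update_self] at this
  exact hφ2 this

/-- All degrees are one, so there is a single choice of colors. Uncolorability provides an edge of
`H`, and any such edge contains all these colors, so the matching has just one. -/
theorem IsTight.isEConfiguration (hC : C.IsTight M) {e : β} (hE : G.E = {e})
    (hV : G.inc e = G.V) : C.IsEConfiguration := by
  classical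
  have he : e ∈ G.E := hE.ge rfl
  obtain ⟨a, ha, -⟩ := exists_pair he
  have : Nonempty γ := ⟨(hC.X_nonempty he ha).choose⟩
  have hone : ∀ v ∈ G.V, (C.X v).ncard = 1 := by
    intro v hv
    rw [hC.ncard_X hv, degree, Set.ncard_eq_one]
    refine ⟨e, ?_⟩
    ext e'
    simp only [hE, Set.mem_singleton_iff, Set.mem_ofPred_eq, and_iff_left_iff_imp]
    rintro rfl
    exact hV ▸ hv
  have hsing : ∀ v, ∃ x, v ∈ G.V → C.X v = {x} := by
    intro v
    by_cases hv : v ∈ G.V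
    · obtain ⟨x, hx⟩ := Set.ncard_eq_one.1 (hone v hv)
      exact ⟨x, fun _ => hx⟩
    · exact ⟨Classical.arbitrary γ, fun h => absurd h hv⟩
  choose φ hφ using hsing
  have hφX : ∀ v ∈ G.V, φ v ∈ C.X v := fun v hv => (hφ v hv).ge rfl
  have hinc : ∀ f ∈ C.H.E, ∀ v ∈ G.V, φ v ∈ C.H.inc f := by
    intro f hf v hv
    obtain ⟨e', he', hfe⟩ := hC.matching.exists_mem hf
    obtain rfl : e' = e := by rwa [hE] at he'
    obtain ⟨x, hx⟩ := hC.matching.exists_inc he hfe (hV ▸ hv : v ∈ G.inc e')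
    have hx' := hx.ge rfl
    have : x = φ v := (hφ v hv).le hx'.2
    exact this ▸ hx'.1
  obtain ⟨f, hf⟩ : ∃ f, f ∈ C.H.E := by
    by_contra! hcon
    exact hC.uncolorable φ ⟨hφX, fun f hf => absurd hf (hcon f)⟩
  have hEf : C.H.E = {f} := by
    refine Set.eq_singleton_iff_unique_mem.2 ⟨hf, fun f' hf' => ?_⟩
    obtain ⟨e₁, he₁, h1⟩ := hC.matching.exists_mem hf
    obtain ⟨e₂, he₂, h2⟩ := hC.matching.exists_mem hf'
    obtain rfl : e₁ = e := by rwa [hE] at he₁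
    obtain rfl : e₂ = e₁ := by rwa [hE] at he₂
    have haV := hV ▸ ha
    exact hC.matching.eq_of_mem_inc he h2 h1 (hinc f' hf' a haV) (hinc f hf a haV)
  have hHV : ∀ x ∈ C.H.V, ∃ v ∈ G.V, φ v = x := by
    intro x hx
    rw [C.vertices] at hx
    simp only [Set.mem_iUnion] at hx
    obtain ⟨v, hv, hx⟩ := hx
    exact ⟨v, hv, ((hφ v hv).le hx).symm⟩
  refine ⟨⟨e, hE, hV⟩, hone, ?_⟩
  let F : G.V → C.H.V := fun v => ⟨φ v, C.X_subset v.2 (hφX v v.2)⟩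
  have hF : Bijective F := by
    refine ⟨fun u v huv => Subtype.ext ?_, fun x => ?_⟩
    · have : φ u = φ v := congrArg Subtype.val huv
      exact C.eq_of_mem_X (hφX u u.2) (this ▸ hφX v v.2)
    · obtain ⟨v, hv, hvx⟩ := hHV x x.2
      exact ⟨⟨v, hv⟩, Subtype.ext hvx⟩
  have uE : Unique C.H.E := by rw [hEf]; infer_instance
  have uG : Unique G.E := by rw [hE]; infer_instance
  refine ⟨(Equiv.ofBijective F hF).symm, Equiv.ofUnique _ _, fun x f' => ?_⟩
  have h1 : (x : γ) ∈ C.H.inc f' := by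
    obtain ⟨v, hv, hvx⟩ := hHV x x.2
    rw [← hvx]
    exact hinc f' f'.2 v hv
  have h2 : ∀ (v : G.V) (e' : G.E), (v : α) ∈ G.inc e' := by
    intro v e'
    have : (e' : β) = e := hE.le e'.2
    rw [this, hV]
    exact v.2
  exact iff_of_true h1 (h2 _ _)

end Cover

/-! ### State systems: comparing conflicts along tours of the hole -/

/-- `φ` is a partial coloring of all of `V` except `v`, for the conflict relation `h`. -/
def IsState (V : Set α) (X : α → Set γ) (r : α → α → Prop) (h : γ → γ → Prop) (v : α)
    (φ : α → γ) : Prop :=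
  (∀ u ∈ V, u ≠ v → φ u ∈ X u) ∧
    ∀ u ∈ V, ∀ w ∈ V, u ≠ v → w ≠ v → r u w → ¬ h (φ u) (φ w)

/-- Axioms for an uncolorable degree-feasible configuration on a multigraph (with simple adjacency
`r` and multiplicities `m`) without cut vertex. -/
structure StateSystem (V : Set α) (X : α → Set γ) (r : α → α → Prop) (h : γ → γ → Prop)
    (m : α → α → ℕ) : Prop where
  finite : V.Finite
  X_finite : ∀ v, (X v).Finite
  r_symm : ∀ u v, r u v → r v u
  r_irrefl : ∀ v, ¬ r v v
  r_mem : ∀ u v, r u v → u ∈ V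
  h_symm : ∀ x y, h x y → h y x
  nocut : ∀ v ∈ V, PreconnOn r (V \ {v})
  tight : ∀ v ∈ V, ∀ φ, IsState V X r h v φ → ∀ x ∈ X v, ∃! u, r v u ∧ h x (φ u)
  extend_one : ∀ v ∈ V, ∀ a ∈ V, v ≠ a → ∀ x ∈ X a, ∃ φ, IsState V X r h v φ ∧ φ a = x
  extend_two : ∀ v ∈ V, ∀ a ∈ V, ∀ b ∈ V, v ≠ a → v ≠ b → a ≠ b → ¬ r a b →
    PreconnOn r (V \ {a, b}) → ∀ x ∈ X a, ∀ y ∈ X b,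
    ∃ φ, IsState V X r h v φ ∧ φ a = x ∧ φ b = y
  m_pos : ∀ u v, r u v → 0 < m u v
  m_symm : ∀ u v, m u v = m v u
  ncard_nbr : ∀ u v, r u v → ∀ y ∈ X u, {x | x ∈ X v ∧ h x y}.ncard = m u v
  X_nonempty : ∀ u v, r u v → (X u).Nonempty

namespace StateSystem

variable {V : Set α} {X : α → Set γ} {r : α → α → Prop} {h : γ → γ → Prop} {m : α → α → ℕ}

theorem ne (S : StateSystem V X r h m) {u v : α} (huv : r u v) : u ≠ v := by
  rintro rfl; exact S.r_irrefl _ huv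

theorem move [DecidableEq α] (S : StateSystem V X r h m) {v u : α} {φ : α → γ}
    (hφ : IsState V X r h v φ) {x : γ} (hx : x ∈ X v) (hvu : r v u) (hxu : h x (φ u)) :
    IsState V X r h u (update φ v x) := by
  have hv := S.r_mem v u hvu
  have huniq : ∀ w, r v w → h x (φ w) → w = u := fun w h1 h2 =>
    (S.tight v hv φ hφ x hx).unique ⟨h1, h2⟩ ⟨hvu, hxu⟩
  refine ⟨fun w hw hwu => ?_, fun a ha b hb hau hbu hab hh => ?_⟩
  · by_cases hwv : w = v
    · subst hwv; simpa using hx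
    · rw [update_of_ne hwv]; exact hφ.1 w hw hwv
  · by_cases hav : a = v
    · subst hav
      have hba : b ≠ a := fun h => S.ne hab h.symm
      rw [update_self, update_of_ne hba] at hh
      exact hbu (huniq b hab hh)
    · rw [update_of_ne hav] at hh
      by_cases hbv : b = v
      · subst hbv
        rw [update_self] at hh
        exact hau (huniq a (S.r_symm _ _ hab) (S.h_symm _ _ hh))
      · rw [update_of_ne hbv] at hh
        exact hφ.2 a ha b hb hav hbv hab hh

/-- The colors of `v` that are in conflict with `y`. -/
def nbr (X : α → Set γ) (h : γ → γ → Prop) (v : α) (y : γ) : Set γ := {x | x ∈ X v ∧ h x y}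

theorem nbr_finite (S : StateSystem V X r h m) (v : α) (y : γ) : (nbr X h v y).Finite :=
  (S.X_finite v).subset fun _ hx => hx.1

theorem nbr_nonempty (S : StateSystem V X r h m) {u v : α} (huv : r u v) {y : γ} (hy : y ∈ X u) :
    (nbr X h v y).Nonempty := by
  rw [← Set.ncard_pos (S.nbr_finite v y), nbr, S.ncard_nbr u v huv y hy]
  exact S.m_pos u v huv

theorem exists_conflict (S : StateSystem V X r h m) {v : α} (hv : v ∈ V) {φ : α → γ}
    (hφ : IsState V X r h v φ) {x : γ} (hx : x ∈ X v) : ∃ u, r v u ∧ h x (φ u) :=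
  (S.tight v hv φ hφ x hx).exists

theorem conflict_unique (S : StateSystem V X r h m) {v : α} {φ : α → γ}
    (hφ : IsState V X r h v φ) {x : γ} (hx : x ∈ X v) {u w : α} (hu : r v u) (hxu : h x (φ u))
    (hw : r v w) (hxw : h x (φ w)) : u = w :=
  (S.tight v (S.r_mem _ _ hu) φ hφ x hx).unique ⟨hu, hxu⟩ ⟨hw, hxw⟩

/-- In either state each color of `v` conflicts with exactly one neighbor. If the two states differ
only at `u`, the colors blamed on `u` cannot be blamed on anyone else. -/
theorem nbr_subset_of_agree (S : StateSystem V X r h m) {v u : α} {φ ψ : α → γ}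
    (hφ : IsState V X r h v φ) (hψ : IsState V X r h v ψ) (hu : r v u)
    (hagree : ∀ z, r v z → z ≠ u → φ z = ψ z) : nbr X h v (φ u) ⊆ nbr X h v (ψ u) := by
  intro x hx
  obtain ⟨z, hz, hxz⟩ := S.exists_conflict (S.r_mem _ _ hu) hψ hx.1
  by_cases hzu : z = u
  · subst hzu; exact ⟨hx.1, hxz⟩
  · rw [← hagree z hz hzu] at hxz
    exact absurd (S.conflict_unique hφ hx.1 hz hxz hu hx.2) hzu

/-- From a state with hole `u` and color `y` at `v`, give `u` the color `c` and then `v` the color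
`y'`. The hole is back at `u`, and among the neighbors of `u` only `v` has changed. -/
theorem nbr_eq_of_common (S : StateSystem V X r h m) {u v : α} (huv : r u v) {y y' c : γ}
    (hy : y ∈ X v) (hy' : y' ∈ X v) (hc : c ∈ nbr X h u y) (hc' : c ∈ nbr X h u y') :
    nbr X h u y = nbr X h u y' := by
  classical
  have hvu := S.r_symm _ _ huv
  obtain ⟨φ, hφ, rfl⟩ := S.extend_one u (S.r_mem _ _ huv) v (S.r_mem _ _ hvu) (S.ne huv) y hy
  have h1 := S.move hφ hc.1 huv hc.2
  have h2 := S.move h1 hy' hvu (by rw [update_self]; exact S.h_symm _ _ hc'.2)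
  have hag : ∀ z, r u z → z ≠ v → φ z = update (update φ u c) v y' z := by
    intro z hz hzv
    rw [update_of_ne hzv, update_of_ne (S.ne hz).symm]
  have e : update (update φ u c) v y' v = y' := update_self ..
  refine Set.Subset.antisymm ?_ ?_
  · have := S.nbr_subset_of_agree hφ h2 huv hag
    rwa [e] at this
  · have := S.nbr_subset_of_agree h2 hφ huv fun z hz hzv => (hag z hz hzv).symm
    rwa [e] at this

/-- Steps of a walk that avoids `v` and leaves no neighbor of `v` other than `u`. -/
def AvoidStep (r : α → α → Prop) (v u a b : α) : Prop := (a = u ∨ ¬ r v a) ∧ r a b ∧ b ≠ v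

/-- The hole leaves `v` through `u`, wanders among nonneighbors of `v`, and returns through `w`.
While it is away `v` has color `c`, so the new color of `w` can be chosen in conflict with `c`. -/
theorem exists_rotation (S : StateSystem V X r h m) {v u w : α} (hu : r v u) (hw : r v w)
    (huw : u ≠ w) (hreach : ReflTransGen (AvoidStep r v u) u w) {φ : α → γ}
    (hφ : IsState V X r h v φ) {c : γ} (hc : c ∈ nbr X h v (φ u)) :
    ∃ ψ, IsState V X r h v ψ ∧ (∀ z, r v z → z ≠ u → z ≠ w → ψ z = φ z) ∧ h c (ψ w) ∧
      ψ w ∈ X w := by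
  classical
  have h1 := S.move hφ hc.1 hu hc.2
  have key : ∀ b, ReflTransGen (AvoidStep r v u) u b → b ≠ v ∧ (b = u ∨
      ∃ ψ, IsState V X r h b ψ ∧ ψ v = c ∧ ∀ z, r v z → z ≠ u → z ≠ b → ψ z = φ z) := by
    intro b hb
    induction hb with
    | refl => exact ⟨(S.ne hu).symm, .inl rfl⟩
    | @tail a b _ hs ih =>
      obtain ⟨ha, hab, hbv⟩ := hs
      refine ⟨hbv, .inr ?_⟩
      have hba := S.r_symm _ _ hab
      by_cases hau : a = u
      · subst hau
        obtain ⟨x, hx, hxb⟩ := S.nbr_nonempty hba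
          (h1.1 b (S.r_mem _ _ hba) (S.ne hba))
        refine ⟨_, S.move h1 hx hab hxb, ?_, fun z hz hza _ => ?_⟩
        · rw [update_of_ne ih.1.symm, update_self]
        · rw [update_of_ne hza, update_of_ne (S.ne hz).symm]
      · obtain ⟨ψ, hψ, hψv, hψz⟩ := ih.2.resolve_left hau
        obtain ⟨x, hx, hxb⟩ := S.nbr_nonempty hba (hψ.1 b (S.r_mem _ _ hba) (S.ne hba))
        refine ⟨_, S.move hψ hx hab hxb, ?_, fun z hz hzu _ => ?_⟩
        · rw [update_of_ne ih.1.symm, hψv]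
        · have hza : z ≠ a := by rintro rfl; exact ha.resolve_left hau hz
          rw [update_of_ne hza]
          exact hψz z hz hzu hza
  obtain ⟨ψ, hψ, hψv, hψz⟩ := (key w hreach).2.resolve_left huw.symm
  obtain ⟨y, hy, hyc⟩ := S.nbr_nonempty hw hc.1
  have hwv := S.r_symm _ _ hw
  refine ⟨_, S.move hψ hy hwv (by rw [hψv]; exact hyc), fun z hz hzu hzw => ?_, ?_, ?_⟩
  · rw [update_of_ne hzw]
    exact hψz z hz hzu hzw
  · rw [update_self]; exact S.h_symm _ _ hyc
  · rw [update_self]; exact hy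

/-- After a rotation, a color `x` in conflict with `ψ w` was in conflict in `φ` with exactly one
neighbor. A neighbor other than `u` and `w` is unchanged and would give two conflicts in `ψ`. If it
were `w`, then `nbr_eq_of_common` would put `c` in conflict with both `u` and `w` in `φ`. So it is
`u`. -/
theorem exists_nbr_subset_of_reach (S : StateSystem V X r h m) {v u w : α} (hu : r v u)
    (hw : r v w) (hreach : ReflTransGen (AvoidStep r v u) u w) {y : γ} (hy : y ∈ X u) :
    ∃ y' ∈ X w, nbr X h v y' ⊆ nbr X h v y := by
  by_cases huw : u = w
  · subst huw; exact ⟨y, hy, subset_rfl⟩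
  have hv := S.r_mem _ _ hu
  have hwv := S.r_symm _ _ hw
  obtain ⟨φ, hφ, rfl⟩ := S.extend_one v hv u (S.r_mem _ _ (S.r_symm _ _ hu)) (S.ne hu) y hy
  obtain ⟨c, hc⟩ := S.nbr_nonempty (S.r_symm _ _ hu) hy
  obtain ⟨ψ, hψ, hag, hcw, hψw⟩ := S.exists_rotation hu hw huw hreach hφ hc
  refine ⟨ψ w, hψw, fun x hx => ?_⟩
  obtain ⟨z, hz, hxz⟩ := S.exists_conflict hv hφ hx.1
  by_cases hzu : z = u
  · subst hzu; exact ⟨hx.1, hxz⟩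
  by_cases hzw : z = w
  · subst hzw
    have heq := S.nbr_eq_of_common hz (hφ.1 z (S.r_mem _ _ hwv) (S.ne hwv)) hψw ⟨hx.1, hxz⟩ hx
    have : c ∈ nbr X h v (φ z) := heq ▸ ⟨hc.1, hcw⟩
    exact absurd (S.conflict_unique hφ hc.1 hu hc.2 hz this.2) huw
  · rw [← hag z hz hzu hzw] at hxz
    exact absurd (S.conflict_unique hψ hx.1 hz hxz hw hx.2) hzw

/-- A walk from `u` to `w` avoiding `v` splits at its visits to neighbors of `v`, and the previous
lemma applies to each piece. -/
theorem exists_nbr_subset (S : StateSystem V X r h m) {v u w : α} (hu : r v u) (hw : r v w) {y : γ}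
    (hy : y ∈ X u) : ∃ y' ∈ X w, nbr X h v y' ⊆ nbr X h v y := by
  have hmem : ∀ z, r v z → z ∈ V \ {v} := fun z hz =>
    ⟨S.r_mem _ _ (S.r_symm _ _ hz), (S.ne hz).symm⟩
  have key : ∀ b, ReflTransGen (Within r (V \ {v})) u b → ∃ u', r v u' ∧
      (∃ y' ∈ X u', nbr X h v y' ⊆ nbr X h v y) ∧ ReflTransGen (AvoidStep r v u') u' b := by
    intro b hb
    induction hb with
    | refl => exact ⟨u, hu, ⟨y, hy, subset_rfl⟩, .refl⟩
    | @tail a b _ hs ih =>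
      obtain ⟨u', hu', ⟨y', hy', hsub⟩, hreach⟩ := ih
      by_cases ha : r v a
      · obtain ⟨y'', hy'', hsub'⟩ := S.exists_nbr_subset_of_reach hu' ha hreach hy'
        exact ⟨a, ha, ⟨y'', hy'', hsub'.trans hsub⟩, .single ⟨.inl rfl, hs.2.2, hs.2.1.2⟩⟩
      · exact ⟨u', hu', ⟨y', hy', hsub⟩, hreach.tail ⟨.inr ha, hs.2.2, hs.2.1.2⟩⟩
  obtain ⟨u', hu', ⟨y', hy', hsub⟩, hreach⟩ :=
    key w (S.nocut v (S.r_mem _ _ hu) u (hmem u hu) w (hmem w hw))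
  obtain ⟨y'', hy'', hsub'⟩ := S.exists_nbr_subset_of_reach hu' hw hreach hy'
  exact ⟨y'', hy'', hsub'.trans hsub⟩

theorem m_le (S : StateSystem V X r h m) {v u w : α} (hu : r v u) (hw : r v w) : m w v ≤ m u v := by
  obtain ⟨y, hy⟩ := S.X_nonempty u v (S.r_symm _ _ hu)
  obtain ⟨y', hy', hsub⟩ := S.exists_nbr_subset hu hw hy
  rw [← S.ncard_nbr w v (S.r_symm _ _ hw) y' hy', ← S.ncard_nbr u v (S.r_symm _ _ hu) y hy]
  exact Set.ncard_le_ncard hsub (S.nbr_finite v y)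

theorem m_eq (S : StateSystem V X r h m) {v u w : α} (hu : r v u) (hw : r v w) : m w v = m u v :=
  (S.m_le hu hw).antisymm (S.m_le hw hu)

/-- Since multiplicities at `v` agree, the inclusion from `exists_nbr_subset` is an equality. So
`y'` may be replaced by a color of `u`, where `nbr_eq_of_common` applies. -/
theorem nbr_eq_of_mem (S : StateSystem V X r h m) {v u w : α} (hu : r v u) (hw : r v w)
    {y y' c : γ} (hy : y ∈ X u) (hy' : y' ∈ X w) (hc : c ∈ nbr X h v y) (hc' : c ∈ nbr X h v y') :
    nbr X h v y = nbr X h v y' := by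
  have hex : ∃ y'' ∈ X u, c ∈ nbr X h v y'' ∧ nbr X h v y'' = nbr X h v y' := by
    obtain ⟨y'', hy'', hsub⟩ := S.exists_nbr_subset hw hu hy'
    have heq : nbr X h v y'' = nbr X h v y' := by
      refine Set.eq_of_subset_of_ncard_le hsub ?_ (S.nbr_finite v y')
      rw [nbr, nbr, S.ncard_nbr w v (S.r_symm _ _ hw) y' hy',
        S.ncard_nbr u v (S.r_symm _ _ hu) y'' hy'']
      exact (S.m_eq hu hw).le
    exact ⟨y'', hy'', heq ▸ hc', heq⟩
  obtain ⟨y'', hy'', hc'', heq⟩ := hex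
  rw [← heq]
  exact S.nbr_eq_of_common hu hy hy'' hc hc''

/-- The hole runs through `v`, `u`, `w` and back to `v`, leaving `c` at `v`, `b` at `u` and some `y`
in conflict with `c` at `w`. As `y` and the old color of `u` share the conflict `c`, they have the
same conflicts at `v`. Hence a color blamed on `b` afterwards could only have been blamed on `a`
before. -/
theorem nbr_eq_of_triangle (S : StateSystem V X r h m) {u v w : α} (hu : r v u) (hw : r v w)
    (huw : r u w) {a b : γ} (ha : a ∈ X w) (hb : b ∈ X u) (hab : h a b) :
    nbr X h v a = nbr X h v b := by
  classical
  have hv := S.r_mem _ _ hu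
  have hwv := S.r_symm _ _ hw
  have huv := S.r_symm _ _ hu
  have hne := S.ne huw
  obtain ⟨φ, hφ, rfl⟩ := S.extend_one v hv w (S.r_mem _ _ hwv) (S.ne hw) a ha
  have hφu := hφ.1 u (S.r_mem _ _ huv) (S.ne huv)
  obtain ⟨c, hc⟩ := S.nbr_nonempty huv hφu
  have h1 := S.move hφ hc.1 hu hc.2
  have h2 := S.move h1 hb huw (by
    rw [update_of_ne (S.ne hwv)]; exact S.h_symm _ _ hab)
  obtain ⟨y, hy, hyc⟩ := S.nbr_nonempty hw hc.1
  have h3 := S.move h2 hy hwv (by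
    rw [update_of_ne (S.ne hu), update_self]; exact hyc)
  set ψ := update (update (update φ v c) u b) w y with hψ
  have hψw : ψ w = y := update_self ..
  have hψu : ψ u = b := by rw [hψ, update_of_ne hne, update_self]
  have hψz : ∀ z, r v z → z ≠ u → z ≠ w → ψ z = φ z := by
    intro z hz hzu hzw
    rw [hψ, update_of_ne hzw, update_of_ne hzu, update_of_ne (S.ne hz).symm]
  have heq : nbr X h v y = nbr X h v (φ u) :=
    S.nbr_eq_of_mem hw hu hy hφu ⟨hc.1, S.h_symm _ _ hyc⟩ hc
  have hsub : nbr X h v b ⊆ nbr X h v (φ w) := by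
    intro x hx
    obtain ⟨z, hz, hxz⟩ := S.exists_conflict hv hφ hx.1
    by_cases hzu : z = u
    · subst hzu
      have : x ∈ nbr X h v y := heq ▸ ⟨hx.1, hxz⟩
      exact absurd (S.conflict_unique h3 hx.1 hz (by rw [hψu]; exact hx.2) hw
        (by rw [hψw]; exact this.2)) hne
    by_cases hzw : z = w
    · subst hzw; exact ⟨hx.1, hxz⟩
    · rw [← hψz z hz hzu hzw] at hxz
      exact absurd (S.conflict_unique h3 hx.1 hz hxz hu (by rw [hψu]; exact hx.2)) hzu
  obtain ⟨x, hx⟩ := S.nbr_nonempty huv hb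
  exact S.nbr_eq_of_mem hw hu ha hb (hsub hx) hx

/-- If the rest were connected, `u` and `w` could be precolored with two colors in conflict with the
same `c ∈ X v` and extended to a state at `v`. There `c` would have two conflicts. -/
theorem not_preconnOn (S : StateSystem V X r h m) {u v w : α} (hu : r v u) (hw : r v w)
    (huw : u ≠ w) (hn : ¬ r u w) : ¬ PreconnOn r (V \ {u, w}) := by
  intro hconn
  have huv := S.r_symm _ _ hu
  have hwv := S.r_symm _ _ hw
  obtain ⟨a, ha⟩ := S.X_nonempty u v huv
  obtain ⟨c, hc⟩ := S.nbr_nonempty huv ha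
  obtain ⟨b, hb⟩ := S.nbr_nonempty hw hc.1
  obtain ⟨φ, hφ, rfl, rfl⟩ := S.extend_two v (S.r_mem _ _ hu) u (S.r_mem _ _ huv) w
    (S.r_mem _ _ hwv) (S.ne hu) (S.ne hw) huw hn hconn a ha b hb.1
  exact huw (S.conflict_unique hφ hc.1 hu hc.2 hw (S.h_symm _ _ hb.2))

theorem neighbors_finite (S : StateSystem V X r h m) (v : α) : {u | r v u}.Finite :=
  S.finite.subset fun u hu => S.r_mem u v (S.r_symm _ _ hu)

/-- In a state at `v`, the conflict sets of the neighbors' colors partition `X v` into parts of size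
`t`. -/
theorem ncard_X (S : StateSystem V X r h m) {t : ℕ} (ht : ∀ u v, r u v → m u v = t) {v u : α}
    (hu : r v u) : (X v).ncard = {u | r v u}.ncard * t := by
  classical
  have hv := S.r_mem _ _ hu
  have huv := S.r_symm _ _ hu
  obtain ⟨y, hy⟩ := S.X_nonempty u v huv
  obtain ⟨φ, hφ, -⟩ := S.extend_one v hv u (S.r_mem _ _ huv) (S.ne hu) y hy
  have hX : X v = ⋃ u ∈ (S.neighbors_finite v).toFinset, nbr X h v (φ u) := by
    ext x
    simp only [Set.Finite.mem_toFinset, Set.mem_iUnion]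
    constructor
    · intro hx
      obtain ⟨z, hz, hxz⟩ := S.exists_conflict hv hφ hx
      exact ⟨z, hz, hx, hxz⟩
    · rintro ⟨z, hz, hx⟩
      exact hx.1
  have hfin := fun u => S.nbr_finite v (φ u)
  have hX' : (S.X_finite v).toFinset =
      (S.neighbors_finite v).toFinset.biUnion fun u => (hfin u).toFinset := by
    ext x
    have := Set.ext_iff.1 hX x
    simpa using this
  rw [Set.ncard_eq_toFinset_card _ (S.X_finite v), hX', Finset.card_biUnion,
    Set.ncard_eq_toFinset_card _ (S.neighbors_finite v)]
  · rw [← smul_eq_mul, ← Finset.sum_const]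
    refine Finset.sum_congr rfl fun z hz => ?_
    have hz : r v z := by simpa using hz
    have hzv := S.r_symm _ _ hz
    rw [← Set.ncard_eq_toFinset_card _ (hfin z), ← ht z v hzv]
    exact S.ncard_nbr z v hzv _ (hφ.1 z (S.r_mem _ _ hzv) (S.ne hzv))
  · intro a ha b hb hab
    rw [Function.onFun, Finset.disjoint_left]
    intro x hxa hxb
    simp only [Set.Finite.mem_toFinset, Finset.mem_coe] at ha hb hxa hxb
    exact hab (S.conflict_unique hφ hxa.1 ha hxa.2 hb hxb.2)

/-- The conflicts between `X v` and `X u` form a bipartite graph regular of degree `m v u` on both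
sides. Together with `ncard_X` this makes the simple graph regular. -/
theorem ncard_X_eq (S : StateSystem V X r h m) {v u : α} (hvu : r v u) :
    (X v).ncard = (X u).ncard := by
  classical
  have huv := S.r_symm _ _ hvu
  rw [Set.ncard_eq_toFinset_card _ (S.X_finite v), Set.ncard_eq_toFinset_card _ (S.X_finite u)]
  refine Nat.eq_of_mul_eq_mul_right (S.m_pos _ _ hvu) (Finset.card_mul_eq_card_mul h ?_ ?_)
  · intro a ha
    rw [← S.ncard_nbr v u hvu a (by simpa using ha), ← Set.ncard_coe_finset]
    congr 1
    ext x
    simp only [Finset.bipartiteAbove, Finset.coe_filter, Set.Finite.mem_toFinset,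
      Set.mem_ofPred_eq]
    exact and_congr_right fun _ => ⟨S.h_symm _ _, S.h_symm _ _⟩
  · intro b hb
    rw [S.m_symm, ← S.ncard_nbr u v huv b (by simpa using hb), ← Set.ncard_coe_finset]
    congr 1
    ext x
    simp [Finset.bipartiteBelow]

end StateSystem

/-! ### Graph theory: nonseparating pairs of neighbors, and cycles -/

theorem reflTransGen_within_symm {r : α → α → Prop} (hr : ∀ u v, r u v → r v u) {W : Set α}
    {a b : α} (h : ReflTransGen (Within r W) a b) : ReflTransGen (Within r W) b a := by
  induction h with
  | refl => exact .refl
  | tail _ hs ih => exact .head ⟨hs.2.1, hs.1, hr _ _ hs.2.2⟩ ih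

theorem reflTransGen_within_mem {r : α → α → Prop} {W : Set α} {a b : α} (ha : a ∈ W)
    (h : ReflTransGen (Within r W) a b) : b ∈ W := by
  induction h with
  | refl => exact ha
  | tail _ hs _ => exact hs.2.1

/-- Let `u`, `w` be nonadjacent vertices that disconnect a graph without cut vertex. If `w` has
degree at least three, then two nonadjacent neighbors of `w` do not disconnect the graph. -/
theorem exists_nonseparating_neighbors {V : Set α} {r : α → α → Prop}
    (hsymm : ∀ u v, r u v → r v u) (hirr : ∀ v, ¬ r v v) (hmem : ∀ u v, r u v → u ∈ V)
    (hcut : ∀ v ∈ V, PreconnOn r (V \ {v})) {u w : α} (hu : u ∈ V) (hw : w ∈ V) (huw : u ≠ w)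
    (hn : ¬ r u w) (hdeg : 3 ≤ {z | r w z}.ncard) (hdis : ¬ PreconnOn r (V \ {u, w})) :
    ∃ x y, r w x ∧ r w y ∧ x ≠ y ∧ ¬ r x y ∧ PreconnOn r (V \ {x, y}) := by
  have hmem' : ∀ u v, r u v → v ∈ V := fun u v huv => hmem v u (hsymm _ _ huv)
  unfold PreconnOn at hdis
  push Not at hdis
  obtain ⟨d₁, hd₁, d₂, hd₂, hd⟩ := hdis
  let R : α → α → Prop := ReflTransGen (Within r (V \ {u, w}))
  have Rsymm : ∀ {a b}, R a b → R b a := fun hab => reflTransGen_within_symm hsymm hab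
  have Rmem : ∀ {a b}, a ∈ V \ {u, w} → R a b → b ∈ V \ {u, w} := fun ha hab =>
    reflTransGen_within_mem ha hab
  have Rstep : ∀ {a b c}, a ∈ V \ {u, w} → R a b → r b c → c ≠ u → c ≠ w → R a c := by
    intro a b c ha hab hbc hcu hcw
    exact hab.tail ⟨Rmem ha hab, ⟨hmem' _ _ hbc, by simp [hcu, hcw]⟩, hbc⟩
  have hNu : ∀ z, r w z → z ≠ u := by rintro z hz rfl; exact hn (hsymm _ _ hz)
  have hNw : ∀ z, r w z → z ≠ w := by rintro z hz rfl; exact hirr _ hz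
  have hNV : ∀ z, r w z → z ∈ V \ {u, w} := fun z hz =>
    ⟨hmem' _ _ hz, by simp [hNu z hz, hNw z hz]⟩
  -- A path from `u` inside `U` survives the deletion of any two neighbors of `w`.
  let U : Set α := {z | z ∈ V ∧ ¬ r w z ∧ z ≠ w}
  have huU : u ∈ U := ⟨hu, fun h => hn (hsymm _ _ h), huw⟩
  -- Every component of `V \ {u, w}` contains a neighbor `z` of `w` that is reached from `u` through
  -- nonneighbors of `w`. Deleting `w` shows that the component touches `u`, and deleting `u` shows
  -- that it touches `w`.
  have first : ∀ d ∈ V \ {u, w}, ∃ z q, R d z ∧ r w z ∧ r q z ∧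
      ReflTransGen (Within r U) u q := by
    intro d hd
    have hdu : d ≠ u := fun h => hd.2 (.inl h)
    have hdw : d ≠ w := fun h => hd.2 (.inr h)
    obtain ⟨a, ha, b, hb, hda, hdb, hab⟩ := (hcut w hw).exists_crossing (T := {z | R d z})
      ⟨hd.1, hdw⟩ ⟨hu, huw⟩ .refl (fun h => (Rmem hd h).2 (.inl rfl))
    have hbu : b = u := by
      by_contra hbu
      exact hdb (Rstep hd hda hab hbu hb.2)
    subst hbu
    by_cases hwa : r w a
    · exact ⟨a, b, hda, hwa, hsymm _ _ hab, .refl⟩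
    have haU : a ∈ U := ⟨ha.1, hwa, ha.2⟩
    have haQ : ReflTransGen (Within r U) b a := .single ⟨huU, haU, hsymm _ _ hab⟩
    obtain ⟨a', ha', b', hb', ⟨hda', haQ'⟩, hdb', hab'⟩ := (hcut b hu).exists_crossing
      (T := {z | R d z ∧ ReflTransGen (Within r U) b z})
      ⟨ha.1, fun h => hirr b (by rw [h] at hab; exact hab)⟩ ⟨hw, huw.symm⟩
      ⟨hda, haQ⟩ (fun h => (Rmem hd h.1).2 (.inr rfl))
    have haU' := reflTransGen_within_mem huU haQ'
    have hbw' : b' ≠ w := by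
      rintro rfl
      exact haU'.2.1 (hsymm _ _ hab')
    have hdR := Rstep hd hda' hab' hb'.2 hbw'
    have hwb : r w b' := by
      by_contra hwb
      exact hdb' ⟨hdR, haQ'.tail ⟨haU', ⟨hb'.1, hwb, hbw'⟩, hab'⟩⟩
    exact ⟨b', a', hdR, hwb, hab', haQ'⟩
  -- After deleting `x` and `y`, the vertices `u` and `w` remain joined through `z`. A vertex cut
  -- off from them would have its reach in one component of `V \ {u, w}`, which contains at most one
  -- of `x` and `y`. That vertex alone would then be a cut vertex.
  have main : ∀ x y z q, r w x → r w y → ¬ R x y → r w z → z ≠ x → z ≠ y → r q z →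
      ReflTransGen (Within r U) u q → PreconnOn r (V \ {x, y}) := by
    intro x y z q hx hy hxy hz hzx hzy hqz hq
    have hUsub : U ⊆ V \ {x, y} := by
      rintro s ⟨hs1, hs2, -⟩
      refine ⟨hs1, ?_⟩
      rintro (rfl | rfl)
      · exact hs2 hx
      · exact hs2 hy
    have hwxy : w ∈ V \ {x, y} := ⟨hw, by simp [(hNw x hx).symm, (hNw y hy).symm]⟩
    have hzxy : z ∈ V \ {x, y} := ⟨hmem' _ _ hz, by simp [hzx, hzy]⟩
    have huw' : ReflTransGen (Within r (V \ {x, y})) u w := by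
      refine ((ReflTransGen.mono (fun a b hab => ?_) _ _ hq : ReflTransGen _ u q).tail
        (⟨?_, hzxy, hqz⟩ : Within r (V \ {x, y}) q z)).tail ⟨hzxy, hwxy, hsymm _ _ hz⟩
      · exact ⟨hUsub hab.1, hUsub hab.2.1, hab.2.2⟩
      · exact hUsub (reflTransGen_within_mem huU hq)
    have toW : ∀ p ∈ V \ {x, y}, ReflTransGen (Within r (V \ {x, y})) p w := by
      intro p hp
      by_contra hpw
      have hpu : ¬ ReflTransGen (Within r (V \ {x, y})) p u := fun h => hpw (h.trans huw')
      have hpV : p ∈ V \ {u, w} := ⟨hp.1, by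
        rintro (rfl | rfl)
        · exact hpu .refl
        · exact hpw .refl⟩
      have hsub : ∀ s, ReflTransGen (Within r (V \ {x, y})) p s → R p s := by
        intro s hs
        induction hs with
        | refl => exact .refl
        | @tail a b hpa hab ih =>
          refine Rstep hpV ih hab.2.2 ?_ ?_
          · rintro rfl; exact hpu (hpa.tail hab)
          · rintro rfl; exact hpw (hpa.tail hab)
      have side : ∀ x', r w x' → p ≠ x' → (∀ s, s ∉ ({x, y} : Set α) ∨ s = x' ∨ ¬ R p s) →
          False := by
        intro x' hx' hpx' hs
        obtain ⟨a, ha, b, hb, hpa, hpb, hab⟩ := (hcut x' (hmem' _ _ hx')).exists_crossing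
          (T := {s | ReflTransGen (Within r (V \ {x, y})) p s}) ⟨hp.1, hpx'⟩
          ⟨hw, (hNw x' hx').symm⟩ .refl hpw
        have haW := reflTransGen_within_mem hp hpa
        rcases hs b with h | h | h
        · exact hpb (hpa.tail ⟨haW, ⟨hb.1, h⟩, hab⟩)
        · exact hb.2 h
        · refine h (Rstep hpV (hsub a hpa) hab ?_ ?_)
          · rintro rfl
            exact hpb (hpa.tail ⟨haW, hUsub huU, hab⟩)
          · rintro rfl
            exact hpb (hpa.tail ⟨haW, hwxy, hab⟩)
      by_cases hpy : R p y
      · refine side y hy (fun h => hp.2 (.inr h)) fun s => ?_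
        by_cases hsx : s = x
        · subst hsx
          exact .inr (.inr fun h => hxy ((Rsymm h).trans hpy))
        · by_cases hsy : s = y
          · exact .inr (.inl hsy)
          · exact .inl (by simp [hsx, hsy])
      · refine side x hx (fun h => hp.2 (.inl h)) fun s => ?_
        by_cases hsy : s = y
        · subst hsy
          exact .inr (.inr hpy)
        · by_cases hsx : s = x
          · exact .inr (.inl hsx)
          · exact .inl (by simp [hsx, hsy])
    intro a ha b hb
    exact (toW a ha).trans (reflTransGen_within_symm hsymm (toW b hb))
  have fin : ∀ x y z q, r w x → r w y → ¬ R x y → r w z → z ≠ x → z ≠ y → r q z →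
      ReflTransGen (Within r U) u q →
      ∃ x y, r w x ∧ r w y ∧ x ≠ y ∧ ¬ r x y ∧ PreconnOn r (V \ {x, y}) := by
    intro x y z q hx hy hxy hz hzx hzy hqz hq
    refine ⟨x, y, hx, hy, ?_, fun h => ?_, main x y z q hx hy hxy hz hzx hzy hqz hq⟩
    · rintro rfl; exact hxy .refl
    · exact hxy (.single ⟨hNV x hx, hNV y hy, h⟩)
  obtain ⟨z₁, q₁, hR₁, hz₁, hq₁, hu₁⟩ := first d₁ hd₁
  obtain ⟨z₂, q₂, hR₂, hz₂, hq₂, hu₂⟩ := first d₂ hd₂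
  have h12 : ¬ R z₁ z₂ := fun h => hd (hR₁.trans (h.trans (Rsymm hR₂)))
  have hne12 : z₁ ≠ z₂ := by rintro rfl; exact h12 .refl
  obtain ⟨z₃, hz₃, hne⟩ : ∃ z, r w z ∧ z ∉ ({z₁, z₂} : Set α) := by
    by_contra! hcon
    have h1 := Set.ncard_le_ncard (show {z | r w z} ⊆ {z₁, z₂} from hcon)
    have h2 := Set.ncard_pair hne12
    omega
  simp only [Set.mem_insert_iff, Set.mem_singleton_iff, not_or] at hne
  -- The third neighbor `z₃` of `w` lies outside the component of `z₁` or outside that of `z₂`. It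
  -- is paired with such a one, and the other keeps `u` joined to `w`.
  by_cases h32 : R z₃ z₂
  · exact fin z₃ z₁ z₂ q₂ hz₃ hz₁ (fun h => h12 ((Rsymm h).trans h32)) hz₂ (Ne.symm hne.2)
      hne12.symm hq₂ hu₂
  · exact fin z₃ z₂ z₁ q₁ hz₃ hz₂ h32 hz₁ (Ne.symm hne.1) hne12 hq₁ hu₁

/-- Lovász's lemma: two vertices `a`, `y` at distance two either do not separate the graph, or `y`
has a suitable pair of neighbors. -/
theorem exists_nonseparating_triple {V : Set α} {r : α → α → Prop}
    (hsymm : ∀ u v, r u v → r v u) (hirr : ∀ v, ¬ r v v) (hmem : ∀ u v, r u v → u ∈ V)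
    (hconn : PreconnOn r V) (hcut : ∀ v ∈ V, PreconnOn r (V \ {v}))
    (hdeg : ∀ v ∈ V, 3 ≤ {z | r v z}.ncard) {a b : α} (ha : a ∈ V) (hb : b ∈ V) (hab : a ≠ b)
    (hn : ¬ r a b) :
    ∃ v u w, r v u ∧ r v w ∧ u ≠ w ∧ ¬ r u w ∧ PreconnOn r (V \ {u, w}) := by
  obtain ⟨x, hx, y, hy, hxT, hyT, hxy⟩ := hconn.exists_crossing (T := {z | z = a ∨ r a z}) ha hb
    (.inl rfl) (fun h => h.elim (fun h => hab h.symm) hn)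
  have hya : ¬ (y = a ∨ r a y) := hyT
  push Not at hya
  have hax : r a x := by
    rcases hxT with rfl | h
    · exact absurd hxy hya.2
    · exact h
  by_cases hdis : PreconnOn r (V \ {a, y})
  · exact ⟨x, a, y, hsymm _ _ hax, hxy, hya.1.symm, hya.2, hdis⟩
  · obtain ⟨p, q, h⟩ := exists_nonseparating_neighbors hsymm hirr hmem hcut ha hy hya.1.symm
      hya.2 (hdeg y hy) hdis
    exact ⟨y, p, q, h⟩

/-- A connected 2-regular graph is a cycle. -/
theorem exists_cycle {V : Set α} {r : α → α → Prop} (hfin : V.Finite) (hne : V.Nonempty)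
    (hsymm : ∀ u v, r u v → r v u) (hirr : ∀ v, ¬ r v v) (hmem : ∀ u v, r u v → u ∈ V)
    (hconn : PreconnOn r V) (hdeg : ∀ v ∈ V, {z | r v z}.ncard = 2) :
    ∃ (n : ℕ) (p : ℕ → α), 3 ≤ n ∧ (∀ i < n, p i ∈ V) ∧ (∀ i < n, ∀ j < n, p i = p j → i = j) ∧
      (∀ v ∈ V, ∃ i < n, p i = v) ∧
      ∀ i < n, ∀ j < n, (r (p i) (p j) ↔
        j = i + 1 ∨ i = j + 1 ∨ (i = 0 ∧ j = n - 1) ∨ (j = 0 ∧ i = n - 1)) := by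
  classical
  have nbrs : ∀ v a b c, r v a → r v b → a ≠ b → r v c → c = a ∨ c = b := by
    intro v a b c ha hb hab hc
    obtain ⟨x, y, -, hset⟩ := Set.ncard_eq_two.1 (hdeg v (hmem _ _ ha))
    have h1 : a ∈ ({x, y} : Set α) := hset ▸ ha
    have h2 : b ∈ ({x, y} : Set α) := hset ▸ hb
    have h3 : c ∈ ({x, y} : Set α) := hset ▸ hc
    simp only [Set.mem_insert_iff, Set.mem_singleton_iff] at h1 h2 h3
    grind
  -- Lengths of paths. On a longest path both neighbors of the last vertex lie on the path. Interior
  -- vertices already have their two neighbors there, so the path closes up at its first vertex.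
  let P : ℕ → Prop := fun k => ∃ p : ℕ → α, (∀ i < k, p i ∈ V) ∧
    (∀ i < k, ∀ j < k, p i = p j → i = j) ∧ ∀ i, i + 1 < k → r (p i) (p (i + 1))
  have hbound : ∀ k, P k → k ≤ V.ncard := by
    rintro k ⟨p, h1, h2, -⟩
    exact Set.le_ncard_of_inj_on_range p h1 h2 hfin
  obtain ⟨v₀, hv₀⟩ := hne
  have hP1 : P 1 := ⟨fun _ => v₀, fun _ _ => hv₀, by grind, by grind⟩
  have hspec : P (Nat.findGreatest P V.ncard) := Nat.findGreatest_spec (hbound 1 hP1) hP1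
  have hmax : ∀ k, P k → k ≤ Nat.findGreatest P V.ncard := fun k hk =>
    Nat.le_findGreatest (hbound k hk) hk
  generalize Nat.findGreatest P V.ncard = k at hspec hmax
  have hk1 := hmax 1 hP1
  obtain ⟨p, hpV, hpinj, hpr⟩ := hspec
  have hend : ∀ b, r (p (k - 1)) b → ∃ j < k, p j = b := by
    intro b hb
    by_contra! hcon
    have : P (k + 1) := by
      have hbV := hmem _ _ (hsymm _ _ hb)
      refine ⟨update p k b, fun i hi => ?_, fun i hi j hj hij => ?_, fun i hi => ?_⟩
      · by_cases h : i = k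
        · subst h; simpa using hbV
        · rw [update_of_ne h]; exact hpV i (by omega)
      · by_cases h : i = k <;> by_cases h' : j = k
        · omega
        · subst h; rw [update_self, update_of_ne h'] at hij
          exact absurd hij.symm (hcon j (by omega))
        · subst h'; rw [update_self, update_of_ne h] at hij
          exact absurd hij (hcon i (by omega))
        · rw [update_of_ne h, update_of_ne h'] at hij
          exact hpinj i (by omega) j (by omega) hij
      · have h : i ≠ k := by omega
        rw [update_of_ne h]
        by_cases h' : i + 1 = k
        · rw [h', update_self]
          have : i = k - 1 := by omega
          rw [this]; exact hb
        · rw [update_of_ne h']; exact hpr i (by omega)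
    have := hmax _ this
    omega
  obtain ⟨b₁, b₂, hb12, hset⟩ := Set.ncard_eq_two.1 (hdeg _ (hpV (k - 1) (by omega)))
  have hb₁ : r (p (k - 1)) b₁ := by
    have : b₁ ∈ {z | r (p (k - 1)) z} := by rw [hset]; simp
    exact this
  have hb₂ : r (p (k - 1)) b₂ := by
    have : b₂ ∈ {z | r (p (k - 1)) z} := by rw [hset]; simp
    exact this
  obtain ⟨j₁, hj₁, rfl⟩ := hend _ hb₁
  obtain ⟨j₂, hj₂, rfl⟩ := hend _ hb₂
  have hj12 : j₁ ≠ j₂ := by rintro rfl; exact hb12 rfl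
  have hj₁' : j₁ ≠ k - 1 := by rintro rfl; exact hirr _ hb₁
  have hj₂' : j₂ ≠ k - 1 := by rintro rfl; exact hirr _ hb₂
  have hk3 : 3 ≤ k := by omega
  have hback : ∀ i, 0 < i → i < k → r (p i) (p (i - 1)) := by
    intro i hi hik
    have := hpr (i - 1) (by omega)
    rw [Nat.sub_add_cancel hi] at this
    exact hsymm _ _ this
  have hzero : ∀ j < k, j ≠ k - 2 → r (p (k - 1)) (p j) → j = 0 := by
    intro j hj hj2 hr
    have hjk : j ≠ k - 1 := by rintro rfl; exact hirr _ hr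
    by_contra hj0
    rcases nbrs _ _ _ _ (hback j (by omega) hj) (hpr j (by omega))
      (fun h => by have := hpinj _ (by omega) _ (by omega) h; omega) (hsymm _ _ hr) with h | h
    · have := hpinj _ (by omega) _ (by omega) h; omega
    · have := hpinj _ (by omega) _ (by omega) h; omega
  have hclose : r (p (k - 1)) (p 0) := by
    by_cases h : j₁ = k - 2
    · have := hzero j₂ hj₂ (by omega) hb₂
      rwa [this] at hb₂
    · have := hzero j₁ hj₁ h hb₁
      rwa [this] at hb₁
  have hnext : ∀ i < k, ∀ c, r (p i) c → ∃ j < k, p j = c ∧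
      (j = i + 1 ∨ i = j + 1 ∨ (i = 0 ∧ j = k - 1) ∨ (j = 0 ∧ i = k - 1)) := by
    intro i hi c hc
    by_cases hi0 : i = 0
    · subst hi0
      rcases nbrs _ _ _ _ (hpr 0 (by omega)) (hsymm _ _ hclose)
        (fun h => by have := hpinj _ (by omega) _ (by omega) h; omega) hc with rfl | rfl
      · exact ⟨_, by omega, rfl, by omega⟩
      · exact ⟨_, by omega, rfl, by omega⟩
    · by_cases hik : i = k - 1
      · subst hik
        rcases nbrs _ _ _ _ (hback _ (by omega) hi) hclose
          (fun h => by have := hpinj _ (by omega) _ (by omega) h; omega) hc with rfl | rfl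
        · exact ⟨_, by omega, rfl, by omega⟩
        · exact ⟨_, by omega, rfl, by omega⟩
      · rcases nbrs _ _ _ _ (hback _ (by omega) hi) (hpr i (by omega))
          (fun h => by have := hpinj _ (by omega) _ (by omega) h; omega) hc with rfl | rfl
        · exact ⟨_, by omega, rfl, by omega⟩
        · exact ⟨_, by omega, rfl, by omega⟩
  refine ⟨k, p, hk3, hpV, hpinj, fun v hv => ?_, fun i hi j hj => ⟨fun h => ?_, ?_⟩⟩
  · by_contra hcon
    obtain ⟨x, hx, y, hy, ⟨i, hi, rfl⟩, hyT, hxy⟩ :=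
      hconn.exists_crossing (T := {v | ∃ i < k, p i = v}) (hpV 0 (by omega)) hv
        ⟨0, by omega, rfl⟩ hcon
    obtain ⟨j, hj, hjy, -⟩ := hnext i hi y hxy
    exact hyT ⟨j, hj, hjy⟩
  · obtain ⟨j', hj', heq, hor⟩ := hnext i hi _ h
    rwa [hpinj _ hj' _ hj heq] at hor
  · rintro (rfl | rfl | ⟨rfl, rfl⟩ | ⟨rfl, rfl⟩)
    · exact hpr i hj
    · exact hsymm _ _ (hpr j hi)
    · exact hsymm _ _ hclose
    · exact hclose

/-! ### Complete graphs and cycles, and their partitions of the colors -/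

namespace StateSystem

variable {V : Set α} {X : α → Set γ} {r : α → α → Prop} {h : γ → γ → Prop} {m : α → α → ℕ}

theorem eq_of_preconnOn {κ : Type*} {f : α → κ} (hconn : PreconnOn r V)
    (hf : ∀ u v, r u v → f u = f v) {u v : α} (hu : u ∈ V) (hv : v ∈ V) : f u = f v := by
  have hp := hconn u hu v hv
  clear hv
  induction hp with
  | refl => rfl
  | tail _ hs ih => exact ih.trans (hf _ _ hs.2.2)

theorem exists_adj (hconn : PreconnOn r V) {a b v : α} (ha : a ∈ V) (hb : b ∈ V) (hab : a ≠ b)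
    (hv : v ∈ V) : ∃ u, r v u := by
  have : ∃ w ∈ V, w ≠ v := by
    by_cases h : a = v
    · exact ⟨b, hb, fun h' => hab (h.trans h'.symm)⟩
    · exact ⟨a, ha, h⟩
  obtain ⟨w, hw, hwv⟩ := this
  obtain ⟨x, -, y, -, hx, -, hxy⟩ := hconn.exists_crossing (T := {v}) hv hw rfl hwv
  exact ⟨y, (show x = v from hx) ▸ hxy⟩

theorem exists_multiplicity (S : StateSystem V X r h m) (hconn : PreconnOn r V) {a b : α}
    (ha : a ∈ V) (hb : b ∈ V) (hab : a ≠ b) : ∃ t, 1 ≤ t ∧ ∀ u v, r u v → m u v = t := by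
  have hex := fun v (hv : v ∈ V) => exists_adj hconn ha hb hab hv
  have : Nonempty α := ⟨a⟩
  choose! g hg using hex
  have hloc : ∀ v u, r v u → m u v = m (g v) v := fun v u hvu =>
    S.m_eq (hg v (S.r_mem _ _ hvu)) hvu
  have hf : ∀ u v, r u v → m (g u) u = m (g v) v := by
    intro u v huv
    rw [← hloc u v huv, ← hloc v u (S.r_symm _ _ huv), S.m_symm]
  refine ⟨m (g a) a, S.m_pos _ _ (S.r_symm _ _ (hg a ha)), fun u v huv => ?_⟩
  rw [hloc v u (S.r_symm _ _ huv)]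
  exact eq_of_preconnOn (f := fun v => m (g v) v) hconn hf (S.r_mem _ _ (S.r_symm _ _ huv)) ha

theorem complete_or_cycle (S : StateSystem V X r h m) (hconn : PreconnOn r V) {a b : α}
    (ha : a ∈ V) (hb : b ∈ V) (hab : a ≠ b) {t : ℕ} (ht1 : 1 ≤ t)
    (ht : ∀ u v, r u v → m u v = t) :
    (∀ u ∈ V, ∀ v ∈ V, u ≠ v → r u v) ∨ ∃ (n : ℕ) (p : ℕ → α), 4 ≤ n ∧ (∀ i < n, p i ∈ V) ∧
      (∀ i < n, ∀ j < n, p i = p j → i = j) ∧ (∀ v ∈ V, ∃ i < n, p i = v) ∧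
      (∀ i < n, ∀ j < n, (r (p i) (p j) ↔
        j = i + 1 ∨ i = j + 1 ∨ (i = 0 ∧ j = n - 1) ∨ (j = 0 ∧ i = n - 1))) ∧
      ∀ v ∈ V, (X v).ncard = 2 * t := by
  by_cases hcomp : ∀ u ∈ V, ∀ v ∈ V, u ≠ v → r u v
  · exact .inl hcomp
  right
  push Not at hcomp
  obtain ⟨u, hu, v, hv, huv, hn⟩ := hcomp
  have hex := fun v (hv : v ∈ V) => exists_adj hconn ha hb hab hv
  have hdeg : ∀ v ∈ V, {z | r v z}.ncard = {z | r u z}.ncard := by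
    intro v hv
    refine eq_of_preconnOn (f := fun v => {z | r v z}.ncard) hconn (fun x y hxy => ?_) hv hu
    have := S.ncard_X_eq hxy
    rw [S.ncard_X ht hxy, S.ncard_X ht (S.r_symm _ _ hxy)] at this
    exact Nat.eq_of_mul_eq_mul_right ht1 this
  -- With degree at least three and a nonadjacent pair, Lovász's lemma contradicts `not_preconnOn`.
  have hle : {z | r u z}.ncard ≤ 2 := by
    by_contra! h3
    obtain ⟨z, x, y, hx, hy, hxy, hnxy, hpre⟩ := exists_nonseparating_triple S.r_symm S.r_irrefl
      S.r_mem hconn S.nocut (fun v hv => by rw [hdeg v hv]; exact h3) hu hv huv hn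
    exact S.not_preconnOn hx hy hxy hnxy hpre
  -- A vertex of degree one would be cut off from `v` by its only neighbor.
  have hge : 2 ≤ {z | r u z}.ncard := by
    obtain ⟨x, hx⟩ := hex u hu
    have hxv : x ≠ v := by rintro rfl; exact hn hx
    obtain ⟨p, hp, q, hq, hpT, -, hpq⟩ := (S.nocut x (S.r_mem _ _ (S.r_symm _ _ hx))).exists_crossing
      (T := {u}) ⟨hu, S.ne hx⟩ ⟨hv, hxv.symm⟩ rfl huv.symm
    obtain rfl : p = u := hpT
    exact (Set.one_lt_ncard (S.neighbors_finite p)).2 ⟨x, hx, q, hpq, fun h => hq.2 h.symm⟩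
  have h2 := hle.antisymm hge
  obtain ⟨n, p, hn3, hp1, hp2, hp3, hp4⟩ := exists_cycle S.finite ⟨u, hu⟩ S.r_symm S.r_irrefl
    S.r_mem hconn fun v hv => (hdeg v hv).trans h2
  refine ⟨n, p, ?_, hp1, hp2, hp3, hp4, fun v hv => ?_⟩
  · by_contra hlt
    obtain rfl : n = 3 := by omega
    obtain ⟨i, hi, rfl⟩ := hp3 u hu
    obtain ⟨j, hj, rfl⟩ := hp3 v hv
    rw [hp4 i hi j hj] at hn
    have : i ≠ j := by rintro rfl; exact huv rfl
    omega
  · obtain ⟨x, hx⟩ := hex v hv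
    rw [S.ncard_X ht hx, hdeg v hv, h2]

/-- The classes are indexed by the vertices other than `v₀`, which gives the required number `n -
1`. A state at `v₀` partitions `X v₀` according to the neighbor in conflict, and the triangle lemma
carries this partition consistently to all other vertices. -/
theorem exists_complete_partition (S : StateSystem V X r h m) {v₀ u₀ : α} (hv₀ : v₀ ∈ V)
    (hu₀ : u₀ ∈ V) (hne : v₀ ≠ u₀) {t : ℕ}
    (ht : ∀ u v, r u v → m u v = t) (hcomp : ∀ u ∈ V, ∀ v ∈ V, u ≠ v → r u v) :
    ∃ Q : ↥(V \ {v₀}) → α → Set γ, (∀ v ∈ V, X v = ⋃ j, Q j v) ∧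
      (∀ v ∈ V, Pairwise fun j k => Disjoint (Q j v) (Q k v)) ∧
      (∀ v ∈ V, ∀ j, (Q j v).ncard = t) ∧
      ∀ u ∈ V, ∀ v ∈ V, u ≠ v → ∀ j k, ∀ x ∈ Q j u, ∀ y ∈ Q k v, (h x y ↔ j = k) := by
  classical
  obtain ⟨y₀, hy₀⟩ := S.X_nonempty u₀ v₀ (hcomp u₀ hu₀ v₀ hv₀ hne.symm)
  obtain ⟨φ, hφ, -⟩ := S.extend_one v₀ hv₀ u₀ hu₀ hne y₀ hy₀
  have hr : ∀ i : ↥(V \ {v₀}), r v₀ i := fun i => hcomp v₀ hv₀ i i.2.1 (fun h => i.2.2 h.symm)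
  have hφi : ∀ i : ↥(V \ {v₀}), φ i ∈ X i := fun i => hφ.1 i i.2.1 i.2.2
  have hc := fun i : ↥(V \ {v₀}) => S.nbr_nonempty (S.r_symm _ _ (hr i)) (hφi i)
  choose c hc using hc
  -- classes at `v₀`
  have hclass : ∀ v ∈ V, v ≠ v₀ → ∀ y ∈ X v, ∀ i : ↥(V \ {v₀}), ∀ z ∈ nbr X h v₀ y, z ∈ nbr X h v₀ (φ i) →
      nbr X h v₀ y = nbr X h v₀ (φ i) := fun v hv hvv₀ y hy i z hz hz' =>
    S.nbr_eq_of_mem (hcomp v₀ hv₀ v hv hvv₀.symm) (hr i) hy (hφi i) hz hz'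
  have huniq : ∀ i j : ↥(V \ {v₀}), ∀ z, z ∈ nbr X h v₀ (φ i) → z ∈ nbr X h v₀ (φ j) → i = j :=
    fun i j z hi hj => Subtype.ext (S.conflict_unique hφ hi.1 (hr i) hi.2 (hr j) hj.2)
  have hfind : ∀ z ∈ X v₀, ∃ i : ↥(V \ {v₀}), z ∈ nbr X h v₀ (φ i) := by
    intro z hz
    obtain ⟨u, hu, hzu⟩ := S.exists_conflict hv₀ hφ hz
    exact ⟨⟨u, S.r_mem _ _ (S.r_symm _ _ hu), (S.ne hu).symm⟩, hz, hzu⟩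
  -- Away from `v₀` the class `i` consists of the colors in conflict with the representative `c i`;
  -- equivalently, their conflict set at `v₀` is that of `φ i`.
  let Q : ↥(V \ {v₀}) → α → Set γ := fun i v =>
    if v = v₀ then nbr X h v₀ (φ i) else nbr X h v (c i)
  have Q0 : ∀ i, Q i v₀ = nbr X h v₀ (φ i) := fun i => by simp [Q]
  have Q1 : ∀ i v, v ≠ v₀ → Q i v = nbr X h v (c i) := fun i v hv => by simp [Q, hv]
  -- the class at `v₀` of a color of another vertex
  have hlab : ∀ i, ∀ v ∈ V, v ≠ v₀ → ∀ x ∈ Q i v, x ∈ X v ∧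
      nbr X h v₀ x = nbr X h v₀ (φ i) := by
    intro i v hv hvv₀ x hx
    rw [Q1 i v hvv₀] at hx
    exact ⟨hx.1, hclass v hv hvv₀ x hx.1 i (c i) ⟨(hc i).1, S.h_symm _ _ hx.2⟩ (hc i)⟩
  have mem_of_lab : ∀ i : ↥(V \ {v₀}), ∀ v ∈ V, v ≠ v₀ → ∀ x ∈ X v, nbr X h v₀ x = nbr X h v₀ (φ i) →
      x ∈ Q i v := by
    intro i v hv hvv₀ x hx heq
    rw [Q1 i v hvv₀]
    exact ⟨hx, S.h_symm _ _ (heq.ge (hc i)).2⟩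
  have hmem0 : ∀ i, ∀ v ∈ V, v ≠ v₀ → ∀ x ∈ Q i v₀, ∀ j, ∀ y ∈ Q j v, (h x y ↔ i = j) := by
    intro i v hv hvv₀ x hx j y hy
    rw [Q0] at hx
    have hy' := hlab j v hv hvv₀ y hy
    constructor
    · intro hxy
      have : x ∈ nbr X h v₀ (φ j) := hy'.2 ▸ ⟨hx.1, hxy⟩
      exact huniq i j x hx this
    · rintro rfl
      exact (hy'.2.ge hx).2
  refine ⟨Q, fun v hv => ?_, fun v hv i j hij => ?_, fun v hv i => ?_, ?_⟩
  · ext x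
    rw [Set.mem_iUnion]
    by_cases hvv₀ : v = v₀
    · subst hvv₀
      simp only [Q0]
      exact ⟨fun hx => hfind x hx, fun ⟨i, hi⟩ => hi.1⟩
    · refine ⟨fun hx => ?_, fun ⟨i, hi⟩ => (hlab i v hv hvv₀ x hi).1⟩
      obtain ⟨z, hz⟩ := S.nbr_nonempty (hcomp v hv v₀ hv₀ hvv₀) hx
      obtain ⟨i, hi⟩ := hfind z hz.1
      exact ⟨i, mem_of_lab i v hv hvv₀ x hx (hclass v hv hvv₀ x hx i z hz hi)⟩
  · refine Set.disjoint_left.2 fun x hxi hxj => ?_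
    by_cases hvv₀ : v = v₀
    · subst hvv₀
      rw [Q0] at hxi hxj
      exact hij (huniq i j x hxi hxj)
    · have h1 := (hlab i v hv hvv₀ x hxi).2
      have h2 := (hlab j v hv hvv₀ x hxj).2
      exact hij (huniq i j (c i) (hc i) (h2.le (h1.ge (hc i))))
  · by_cases hvv₀ : v = v₀
    · subst hvv₀
      rw [Q0, nbr, S.ncard_nbr i v (S.r_symm _ _ (hr i)) _ (hφi i)]
      exact ht _ _ (S.r_symm _ _ (hr i))
    · have := hcomp v₀ hv₀ v hv (Ne.symm hvv₀)
      rw [Q1 i v hvv₀, nbr, S.ncard_nbr v₀ v this _ (hc i).1]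
      exact ht _ _ this
  · intro u hu v hv huv i j x hx y hy
    by_cases huv₀ : u = v₀
    · subst huv₀
      exact hmem0 i v hv huv.symm x hx j y hy
    by_cases hvv₀ : v = v₀
    · subst hvv₀
      exact ⟨fun hh => ((hmem0 j u hu huv y hy i x hx).1 (S.h_symm _ _ hh)).symm,
        fun hh => S.h_symm _ _ ((hmem0 j u hu huv y hy i x hx).2 hh.symm)⟩
    have hx' := hlab i u hu huv₀ x hx
    have hy' := hlab j v hv hvv₀ y hy
    constructor
    · intro hxy
      have h1 := S.nbr_eq_of_triangle (hcomp v₀ hv₀ u hu (Ne.symm huv₀))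
        (hcomp v₀ hv₀ v hv (Ne.symm hvv₀)) (hcomp u hu v hv huv) hy'.1 hx'.1 (S.h_symm _ _ hxy)
      have : c i ∈ nbr X h v₀ (φ j) := by
        rw [← hy'.2, h1, hx'.2]; exact hc i
      exact huniq i j _ (hc i) this
    · rintro rfl
      rw [Q1 i v hvv₀] at hy
      rw [Q1 i u huv₀] at hx
      have h1 := S.nbr_eq_of_triangle (hcomp v hv u hu huv.symm) (hcomp v hv v₀ hv₀ hvv₀)
        (hcomp u hu v₀ hv₀ huv₀) (hc i).1 hx'.1 (S.h_symm _ _ hx.2)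
      exact S.h_symm _ _ (h1.le hy).2

/-- The colors of `v` having a common conflict with `x`. -/
def cls (X : α → Set γ) (r : α → α → Prop) (h : γ → γ → Prop) (v : α) (x : γ) : Set γ :=
  {x' | x' ∈ X v ∧ ∃ u, r v u ∧ ∃ y ∈ X u, h x y ∧ h x' y}

/-- By `nbr_eq_of_mem` the choice of neighbor and of conflicting color is irrelevant. So the classes
partition `X v` without reference to a state. -/
theorem cls_eq (S : StateSystem V X r h m) {v u : α} (hvu : r v u) {x y : γ} (hx : x ∈ X v)
    (hy : y ∈ X u) (hxy : h x y) : cls X r h v x = nbr X h v y := by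
  ext x'
  constructor
  · rintro ⟨hx', w, hw, z, hz, hxz, hxz'⟩
    have := S.nbr_eq_of_mem hvu hw hy hz ⟨hx, hxy⟩ ⟨hx, hxz⟩
    exact this ▸ ⟨hx', hxz'⟩
  · rintro ⟨hx', hxy'⟩
    exact ⟨hx', u, hvu, y, hy, hxy, hxy'⟩

theorem mem_cls_self (S : StateSystem V X r h m) {v u : α} (hvu : r v u) {x : γ} (hx : x ∈ X v) :
    x ∈ cls X r h v x := by
  obtain ⟨y, hy, hyx⟩ := S.nbr_nonempty hvu hx
  exact ⟨hx, u, hvu, y, hy, S.h_symm _ _ hyx, S.h_symm _ _ hyx⟩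

theorem cls_eq_of_mem (S : StateSystem V X r h m) {v : α} {x x' : γ} (hx : x ∈ X v)
    (hx' : x' ∈ cls X r h v x) : cls X r h v x' = cls X r h v x := by
  obtain ⟨hx'v, u, hvu, y, hy, hxy, hxy'⟩ := hx'
  rw [S.cls_eq hvu hx'v hy hxy', S.cls_eq hvu hx hy hxy]

/-- Conflict between adjacent vertices depends only on the classes of the two colors. -/
theorem conflict_congr (S : StateSystem V X r h m) {u v : α} (huv : r u v) {x y x' y' : γ}
    (hx : x ∈ X u) (hy : y ∈ X v) (hxy : h x y) (hx' : x' ∈ cls X r h u x)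
    (hy' : y' ∈ cls X r h v y) : h x' y' := by
  rw [S.cls_eq huv hx hy hxy] at hx'
  rw [S.cls_eq (S.r_symm _ _ huv) hy hx'.1 (S.h_symm _ _ hx'.2)] at hy'
  exact S.h_symm _ _ hy'.2

theorem conflict_iff (S : StateSystem V X r h m) {u v : α} (huv : r u v) {x y x' y' : γ}
    (hx : x ∈ X u) (hy : y ∈ X v) (hx' : x' ∈ cls X r h u x)
    (hy' : y' ∈ cls X r h v y) : h x' y' ↔ h x y := by
  have hvu := S.r_symm _ _ huv
  refine ⟨fun hh => S.conflict_congr huv hx'.1 hy'.1 hh ?_ ?_, fun hh =>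
    S.conflict_congr huv hx hy hh hx' hy'⟩
  · rw [S.cls_eq_of_mem hx hx']; exact S.mem_cls_self huv hx
  · rw [S.cls_eq_of_mem hy hy']; exact S.mem_cls_self hvu hy

theorem not_conflict_of_cls_ne (S : StateSystem V X r h m) {u v : α} (huv : r u v) {x x' y : γ}
    (hx : x ∈ X u) (hx' : x' ∈ X u) (hy : y ∈ X v) (hne : cls X r h u x ≠ cls X r h u x')
    (hxy : h x y) : ¬ h x' y := fun h' =>
  hne ((S.cls_eq huv hx hy hxy).trans (S.cls_eq huv hx' hy h').symm)

theorem disjoint_cls (S : StateSystem V X r h m) {u : α} {x x' : γ}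
    (hx : x ∈ X u) (hx' : x' ∈ X u) (hne : cls X r h u x ≠ cls X r h u x') :
    Disjoint (cls X r h u x) (cls X r h u x') := by
  rw [Set.disjoint_left]
  intro z hz hz'
  exact hne ((S.cls_eq_of_mem hx hz).symm.trans (S.cls_eq_of_mem hx' hz'))

theorem ncard_cls (S : StateSystem V X r h m) {t : ℕ} (ht : ∀ u v, r u v → m u v = t) {v u : α}
    (hvu : r v u) {x : γ} (hx : x ∈ X v) : (cls X r h v x).ncard = t := by
  obtain ⟨y, hy, hyx⟩ := S.nbr_nonempty hvu hx
  have huv := S.r_symm _ _ hvu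
  rw [S.cls_eq hvu hx hy (S.h_symm _ _ hyx), nbr, S.ncard_nbr u v huv y hy, ht u v huv]

theorem X_eq_union (S : StateSystem V X r h m) {t : ℕ} (ht : ∀ u v, r u v → m u v = t) {v u : α}
    (hvu : r v u) (h2 : (X v).ncard = 2 * t) {x x' : γ} (hx : x ∈ X v) (hx' : x' ∈ X v)
    (hne : cls X r h v x ≠ cls X r h v x') : X v = cls X r h v x ∪ cls X r h v x' := by
  have hfin : ∀ z, (cls X r h v z).Finite := fun z => (S.X_finite v).subset fun _ hy => hy.1
  symm
  refine Set.eq_of_subset_of_ncard_le (Set.union_subset (fun _ hy => hy.1) fun _ hy => hy.1) ?_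
    (S.X_finite v)
  rw [Set.ncard_union_eq (S.disjoint_cls hx hx' hne) (hfin x) (hfin x'), S.ncard_cls ht hvu hx,
    S.ncard_cls ht hvu hx', h2]
  omega

theorem cls_ne_of_conflict (S : StateSystem V X r h m) {u v : α} (huv : r u v) {x x' y y' : γ}
    (hx : x ∈ X u) (hx' : x' ∈ X u) (hy : y ∈ X v) (hy' : y' ∈ X v) (hxy : h x y)
    (hxy' : h x' y') (hne : cls X r h u x ≠ cls X r h u x') :
    cls X r h v y ≠ cls X r h v y' := by
  intro heq
  have h1 : y' ∈ cls X r h v y := heq ▸ S.mem_cls_self (S.r_symm _ _ huv) hy'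
  exact S.not_conflict_of_cls_ne huv hx hx' hy' hne
    (S.conflict_congr huv hx hy hxy (S.mem_cls_self huv hx) h1) hxy'

/-- Two classes at `p 0` are transported along the path to `p (n - 1)`. On the closing edge they are
joined either straight or crossed, and parity decides: a coloring alternating between the classes is
a state at `p 0`, so it must conflict with `a 0` across that edge. -/
theorem exists_cycle_partition (S : StateSystem V X r h m) {t : ℕ} (ht1 : 1 ≤ t)
    (ht : ∀ u v, r u v → m u v = t) {n : ℕ} {p : ℕ → α} (hn : 4 ≤ n) (hpV : ∀ i < n, p i ∈ V)
    (hpinj : ∀ i < n, ∀ j < n, p i = p j → i = j) (hpsurj : ∀ v ∈ V, ∃ i < n, p i = v)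
    (hadj : ∀ i < n, ∀ j < n, (r (p i) (p j) ↔
        j = i + 1 ∨ i = j + 1 ∨ (i = 0 ∧ j = n - 1) ∨ (j = 0 ∧ i = n - 1)))
    (hX : ∀ v ∈ V, (X v).ncard = 2 * t) :
    ∃ Q : Fin 2 → α → Set γ, (∀ v ∈ V, X v = ⋃ j, Q j v) ∧
      (∀ v ∈ V, Pairwise fun j k => Disjoint (Q j v) (Q k v)) ∧
      (∀ v ∈ V, ∀ j, (Q j v).ncard = t) ∧
      (∀ u v, r u v → ({u, v} : Set α) ≠ {p (n - 1), p 0} →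
        ∀ j k, ∀ x ∈ Q j u, ∀ y ∈ Q k v, (h x y ↔ j = k)) ∧
      ∀ j k, ∀ x ∈ Q j (p (n - 1)), ∀ y ∈ Q k (p 0), (h x y ↔ (Odd n ↔ j = k)) := by
  classical
  have hr : ∀ i, i + 1 < n → r (p i) (p (i + 1)) := fun i hi =>
    (hadj i (by omega) (i + 1) hi).2 (by omega)
  have hlast : r (p (n - 1)) (p 0) := (hadj _ (by omega) _ (by omega)).2 (by omega)
  obtain ⟨a₀, ha₀, b₀, hb₀, hab₀⟩ : ∃ a ∈ X (p 0), ∃ b ∈ X (p 0),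
      cls X r h (p 0) a ≠ cls X r h (p 0) b := by
    obtain ⟨a, ha⟩ := S.X_nonempty (p 0) (p 1) (hr 0 (by omega))
    have hlt : (cls X r h (p 0) a).ncard < (X (p 0)).ncard := by
      rw [S.ncard_cls ht (hr 0 (by omega)) ha, hX _ (hpV 0 (by omega))]; omega
    obtain ⟨b, hb, hb'⟩ := Set.exists_mem_notMem_of_ncard_lt_ncard hlt
      ((S.X_finite (p 0)).subset fun _ hy => hy.1)
    exact ⟨a, ha, b, hb, fun heq => hb' (heq ▸ S.mem_cls_self (hr 0 (by omega)) hb)⟩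
  have hseq : ∀ c₀ ∈ X (p 0), ∃ c : ℕ → γ, c 0 = c₀ ∧ (∀ i < n, c i ∈ X (p i)) ∧
      ∀ i, i + 1 < n → h (c i) (c (i + 1)) := by
    intro c₀ hc₀
    have hstep : ∀ i x, ∃ y, i + 1 < n → x ∈ X (p i) → y ∈ X (p (i + 1)) ∧ h x y := by
      intro i x
      by_cases hi : i + 1 < n ∧ x ∈ X (p i)
      · obtain ⟨y, hy, hyx⟩ := S.nbr_nonempty (hr i hi.1) hi.2
        exact ⟨y, fun _ _ => ⟨hy, S.h_symm _ _ hyx⟩⟩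
      · exact ⟨x, fun h1 h2 => absurd ⟨h1, h2⟩ hi⟩
    choose g hg using hstep
    let c : ℕ → γ := fun i => Nat.rec c₀ (fun i x => g i x) i
    have hc : ∀ i < n, c i ∈ X (p i) := by
      intro i
      induction i with
      | zero => intro _; exact hc₀
      | succ i ih => intro hi; exact (hg i (c i) hi (ih (by omega))).1
    exact ⟨c, rfl, hc, fun i hi => (hg i (c i) hi (hc i (by omega))).2⟩
  obtain ⟨a, rfl, haX, hah⟩ := hseq a₀ ha₀
  obtain ⟨b, rfl, hbX, hbh⟩ := hseq b₀ hb₀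
  have hne : ∀ i < n, cls X r h (p i) (a i) ≠ cls X r h (p i) (b i) := by
    intro i
    induction i with
    | zero => intro _; exact hab₀
    | succ i ih =>
      intro hi
      exact S.cls_ne_of_conflict (hr i hi) (haX i (by omega)) (hbX i (by omega)) (haX _ hi)
        (hbX _ hi) (hah i hi) (hbh i hi) (ih (by omega))
  have hadj' : ∀ i < n, ∃ u, r (p i) u := by
    intro i hi
    by_cases h' : i = n - 1
    · subst h'; exact ⟨_, hlast⟩
    · exact ⟨_, hr i (by omega)⟩
  have hunion : ∀ i < n, X (p i) = cls X r h (p i) (a i) ∪ cls X r h (p i) (b i) := by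
    intro i hi
    obtain ⟨u, hu⟩ := hadj' i hi
    exact S.X_eq_union ht hu (hX _ (hpV i hi)) (haX i hi) (hbX i hi) (hne i hi)
  have hab : ∀ i, i + 1 < n → ¬ h (a i) (b (i + 1)) := fun i hi =>
    S.not_conflict_of_cls_ne (hr i hi) (hbX i (by omega)) (haX i (by omega)) (hbX _ hi)
      (hne i (by omega)).symm (hbh i hi)
  have hba : ∀ i, i + 1 < n → ¬ h (b i) (a (i + 1)) := fun i hi =>
    S.not_conflict_of_cls_ne (hr i hi) (haX i (by omega)) (hbX i (by omega)) (haX _ hi)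
      (hne i (by omega)) (hah i hi)
  -- an alternating coloring fails only on the last edge
  have hclose : h (if Even (n - 1) then a (n - 1) else b (n - 1)) (a 0) := by
    have : ∀ v, ∃ x, ∀ i < n, p i = v → x = if Even i then a i else b i := by
      intro v
      by_cases hv : ∃ i < n, p i = v
      · obtain ⟨i, hi, rfl⟩ := hv
        exact ⟨_, fun j hj hji => by rw [hpinj j hj i hi hji]⟩
      · exact ⟨a 0, fun i hi hiv => absurd ⟨i, hi, hiv⟩ hv⟩
    choose φ hφ using this
    have hφp : ∀ i < n, φ (p i) = if Even i then a i else b i := fun i hi => hφ (p i) i hi rfl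
    have hconsec : ∀ i, i + 1 < n → ¬ h (φ (p i)) (φ (p (i + 1))) := by
      intro i hi
      rw [hφp i (by omega), hφp (i + 1) hi]
      by_cases hev : Even i
      · simp [hev, Nat.even_add_one, hab i hi]
      · simp [hev, Nat.even_add_one, hba i hi]
    have hstate : IsState V X r h (p 0) φ := by
      refine ⟨fun u hu hu0 => ?_, fun u hu w hw hu0 hw0 huw => ?_⟩
      · obtain ⟨i, hi, rfl⟩ := hpsurj u hu
        rw [hφp i hi]
        split_ifs
        · exact haX i hi
        · exact hbX i hi
      · obtain ⟨i, hi, rfl⟩ := hpsurj u hu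
        obtain ⟨j, hj, rfl⟩ := hpsurj w hw
        have hi0 : i ≠ 0 := by rintro rfl; exact hu0 rfl
        have hj0 : j ≠ 0 := by rintro rfl; exact hw0 rfl
        rcases (hadj i hi j hj).1 huw with rfl | rfl | h' | h'
        · exact hconsec i hj
        · exact fun hh => hconsec j hi (S.h_symm _ _ hh)
        · exact absurd h'.1 hi0
        · exact absurd h'.1 hj0
    obtain ⟨u, hu, hau⟩ := S.exists_conflict (hpV 0 (by omega)) hstate (haX 0 (by omega))
    obtain ⟨i, hi, rfl⟩ := hpsurj u (S.r_mem _ _ (S.r_symm _ _ hu))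
    rcases (hadj 0 (by omega) i hi).1 hu with rfl | h' | h' | h'
    · have := hφp 1 hi
      simp only [Nat.not_even_one, if_false] at this
      rw [zero_add, this] at hau
      exact absurd hau (hab 0 hi)
    · omega
    · rw [h'.2, hφp (n - 1) (by omega)] at hau
      exact S.h_symm _ _ hau
    · omega
  have hpar : Even (n - 1) ↔ Odd n := by
    obtain ⟨k, rfl⟩ : ∃ k, n = k + 1 := ⟨n - 1, by omega⟩
    simp [Nat.odd_add_one]
  -- With two classes at each end, one known conflict on the closing edge determines the other three
  -- pairs.
  have hend : ∀ {x y : γ} {x' y' : γ}, x ∈ X (p (n - 1)) → x' ∈ X (p (n - 1)) → y ∈ X (p 0) →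
      cls X r h (p (n - 1)) x ≠ cls X r h (p (n - 1)) x' →
      X (p 0) = cls X r h (p 0) y ∪ cls X r h (p 0) y' → y' ∈ X (p 0) → h x y →
      (¬ h x' y) ∧ h x' y' ∧ (cls X r h (p 0) y ≠ cls X r h (p 0) y' → ¬ h x y') := by
    intro x y x' y' hx hx' hy hne' hun hy' hxy
    have hl' := S.r_symm _ _ hlast
    have h1 := S.not_conflict_of_cls_ne hlast hx hx' hy hne' hxy
    refine ⟨h1, ?_, fun hc hh => S.not_conflict_of_cls_ne hl' hy hy' hx hc (S.h_symm _ _ hxy)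
      (S.h_symm _ _ hh)⟩
    obtain ⟨z, hz, hzx⟩ := S.nbr_nonempty hlast hx'
    rw [hun] at hz
    rcases hz with hz | hz
    · exact absurd ((S.conflict_iff hlast hx' hy (S.mem_cls_self hlast hx') hz).1
        (S.h_symm _ _ hzx)) h1
    · exact (S.conflict_iff hlast hx' hy' (S.mem_cls_self hlast hx') hz).1 (S.h_symm _ _ hzx)
  have hn1 : n - 1 < n := by omega
  have hn0 : 0 < n := by omega
  have hfinal : (h (a (n - 1)) (a 0) ↔ Odd n) ∧ (h (b (n - 1)) (b 0) ↔ Odd n) ∧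
      (h (a (n - 1)) (b 0) ↔ ¬ Odd n) ∧ (h (b (n - 1)) (a 0) ↔ ¬ Odd n) := by
    by_cases hodd : Odd n
    · rw [if_pos (hpar.2 hodd)] at hclose
      obtain ⟨h1, h2, h3⟩ := hend (haX _ hn1) (hbX _ hn1) (haX 0 hn0) (hne _ hn1) (hunion 0 hn0)
        (hbX 0 hn0) hclose
      simp [hodd, hclose, h1, h2, h3 (hne 0 hn0)]
    · rw [if_neg (fun h => hodd (hpar.1 h))] at hclose
      obtain ⟨h1, h2, h3⟩ := hend (hbX _ hn1) (haX _ hn1) (haX 0 hn0) (hne _ hn1).symm (hunion 0 hn0)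
        (hbX 0 hn0) hclose
      simp [hodd, hclose, h1, h2, h3 (hne 0 hn0)]
  have hidx : ∀ v, ∃ i, v ∈ V → i < n ∧ p i = v := by
    intro v
    by_cases hv : v ∈ V
    · obtain ⟨i, hi, hiv⟩ := hpsurj v hv
      exact ⟨i, fun _ => ⟨hi, hiv⟩⟩
    · exact ⟨0, fun h => absurd h hv⟩
  choose idx hidx using hidx
  have hidxp : ∀ i < n, idx (p i) = i := fun i hi =>
    hpinj _ (hidx _ (hpV i hi)).1 i hi (hidx _ (hpV i hi)).2
  let c : Fin 2 → ℕ → γ := ![a, b]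
  have hcX : ∀ j, ∀ i < n, c j i ∈ X (p i) := by
    intro j i hi
    fin_cases j
    · exact haX i hi
    · exact hbX i hi
  let Q : Fin 2 → α → Set γ := fun j v => cls X r h v (c j (idx v))
  have hQ : ∀ j, ∀ i < n, Q j (p i) = cls X r h (p i) (c j i) := by
    intro j i hi
    simp only [Q, hidxp i hi]
  have hcons : ∀ i, i + 1 < n → ∀ j k, ∀ x ∈ Q j (p i), ∀ y ∈ Q k (p (i + 1)),
      (h x y ↔ j = k) := by
    intro i hi j k x hx y hy
    rw [hQ j i (by omega)] at hx
    rw [hQ k (i + 1) hi] at hy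
    rw [S.conflict_iff (hr i hi) (hcX j i (by omega)) (hcX k _ hi) hx hy]
    fin_cases j <;> fin_cases k
    · exact iff_of_true (hah i hi) rfl
    · exact iff_of_false (hab i hi) (by decide)
    · exact iff_of_false (hba i hi) (by decide)
    · exact iff_of_true (hbh i hi) rfl
  refine ⟨Q, fun v hv => ?_, fun v hv => ?_, fun v hv j => ?_, fun u v huv hne' j k x hx y hy => ?_,
    fun j k x hx y hy => ?_⟩
  · obtain ⟨i, hi, rfl⟩ := hpsurj v hv
    rw [hunion i hi]
    ext x
    simp only [Set.mem_iUnion, Fin.exists_fin_two, hQ _ i hi]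
    exact Iff.rfl
  · obtain ⟨i, hi, rfl⟩ := hpsurj v hv
    have hd := S.disjoint_cls (haX i hi) (hbX i hi) (hne i hi)
    intro j k hjk
    simp only [hQ _ i hi]
    fin_cases j <;> fin_cases k
    · exact absurd rfl hjk
    · exact hd
    · exact hd.symm
    · exact absurd rfl hjk
  · obtain ⟨i, hi, rfl⟩ := hpsurj v hv
    obtain ⟨u, hu⟩ := hadj' i hi
    rw [hQ j i hi]
    exact S.ncard_cls ht hu (hcX j i hi)
  · obtain ⟨i, hi, rfl⟩ := hpsurj u (S.r_mem _ _ huv)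
    obtain ⟨i', hi', rfl⟩ := hpsurj v (S.r_mem _ _ (S.r_symm _ _ huv))
    rcases (hadj i hi i' hi').1 huv with rfl | rfl | ⟨rfl, rfl⟩ | ⟨rfl, rfl⟩
    · exact hcons i hi' j k x hx y hy
    · rw [eq_comm (a := j), ← hcons i' hi k j y hy x hx]
      exact ⟨S.h_symm _ _, S.h_symm _ _⟩
    · exact absurd (Set.pair_comm _ _) hne'
    · exact absurd rfl hne'
  · rw [hQ j _ hn1] at hx
    rw [hQ k 0 hn0] at hy
    rw [S.conflict_iff hlast (hcX j _ hn1) (hcX k _ hn0) hx hy]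
    fin_cases j <;> fin_cases k
    · exact hfinal.1.trans (by simp)
    · exact hfinal.2.2.1.trans (by simp)
    · exact hfinal.2.2.2.trans (by simp)
    · exact hfinal.2.1.trans (by simp)

end StateSystem

/-! ### From tight multigraph configurations to state systems -/

theorem OrdAdj.symm {G : MultiHypergraph α β} {u v : α} (h : G.OrdAdj u v) : G.OrdAdj v u := by
  obtain ⟨hne, e, he, hinc⟩ := h
  exact ⟨hne.symm, e, he, by rw [hinc, Set.pair_comm]⟩

theorem OrdAdj.link {G : MultiHypergraph α β} {u v : α} (h : G.OrdAdj u v) : G.Link u v := by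
  obtain ⟨-, e, he, hinc⟩ := h
  exact ⟨e, he, by simp [hinc], by simp [hinc]⟩

/-- All edges are ordinary edges. -/
def IsMultigraph (G : MultiHypergraph α β) : Prop := ∀ e ∈ G.E, ∃ u v, u ≠ v ∧ G.inc e = {u, v}

/-- The number of edges joining `u` and `v`. -/
noncomputable def mult (G : MultiHypergraph α β) (u v : α) : ℕ :=
  {e | e ∈ G.E ∧ G.inc e = {u, v}}.ncard

theorem IsMultigraph.ordAdj_of_link {G : MultiHypergraph α β} (h2 : G.IsMultigraph) {u v : α}
    (h : G.Link u v) (huv : u ≠ v) : G.OrdAdj u v := by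
  obtain ⟨e, he, hu, hv⟩ := h
  obtain ⟨a, b, hab, hinc⟩ := h2 e he
  refine ⟨huv, e, he, ?_⟩
  rw [hinc] at hu hv ⊢
  simp only [Set.mem_insert_iff, Set.mem_singleton_iff] at hu hv
  rcases hu with rfl | rfl <;> rcases hv with rfl | rfl
  · exact absurd rfl huv
  · rfl
  · exact Set.pair_comm _ _
  · exact absurd rfl huv

theorem IsMultigraph.preconnOn {G : MultiHypergraph α β} (h2 : G.IsMultigraph)
    (hG : G.IsConnected) : PreconnOn G.OrdAdj G.V := by
  refine preconnOn_of_no_separation fun R hR ⟨a, ha⟩ ⟨b, hb⟩ => ?_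
  obtain ⟨x, hx, y, hy, hxR, hyR, hxy⟩ :=
    (isConnected_iff.1 hG).exists_crossing (hR ha) hb.1 ha hb.2
  exact ⟨x, hxR, y, ⟨hy, hyR⟩, h2.ordAdj_of_link hxy (by rintro rfl; exact hyR hxR)⟩

/-- A disconnection of `G.V \ {v}` gives a separation at `v` once `v` is added to both parts. -/
theorem IsMultigraph.preconnOn_sdiff {G : MultiHypergraph α β} (h2 : G.IsMultigraph)
    (hG : G.IsNonsep) {v : α} (hv : v ∈ G.V) : PreconnOn G.OrdAdj (G.V \ {v}) := by
  refine preconnOn_of_no_separation fun R hR ⟨a, ha⟩ ⟨b, hb⟩ => ?_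
  by_contra! hcon
  refine hG.2 v (isSeparatingVertex_iff.2 ⟨insert v R, insert v ((G.V \ {v}) \ R),
    ⟨Set.insert_subset hv fun x hx => (hR hx).1, Set.insert_subset hv fun x hx => hx.1.1, ?_, ?_,
    ?_⟩, ⟨a, .inr ha, (hR ha).2⟩, ⟨b, .inr hb, hb.1.2⟩⟩)
  · intro x hx
    by_cases hxv : x = v
    · exact .inl (.inl hxv)
    · by_cases hxR : x ∈ R
      · exact .inl (.inr hxR)
      · exact .inr (.inr ⟨⟨hx, hxv⟩, hxR⟩)
  · intro e he
    by_contra! hno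
    obtain ⟨⟨x, hxe, hx⟩, ⟨y, hye, hy⟩⟩ := Set.not_subset.1 hno.1, Set.not_subset.1 hno.2
    have hxV := G.inc_subset e he hxe
    have hyV := G.inc_subset e he hye
    simp only [Set.mem_insert_iff, not_or, Set.mem_sdiff, Set.mem_singleton_iff] at hx hy
    have hyR : y ∈ R := by
      by_contra h
      exact hy.2 ⟨⟨hyV, hy.1⟩, h⟩
    exact hcon y hyR x ⟨⟨hxV, hx.1⟩, hx.2⟩
      (h2.ordAdj_of_link ⟨e, he, hye, hxe⟩ (by rintro rfl; exact hx.2 hyR))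
  · ext x
    simp only [Set.mem_inter_iff, Set.mem_insert_iff, Set.mem_sdiff, Set.mem_singleton_iff]
    constructor
    · rintro ⟨h1 | h1, h2 | h2⟩
      · exact h1
      · exact h1
      · exact h2
      · exact absurd h1 h2.2
    · intro h; exact ⟨.inl h, .inl h⟩

namespace Cover

variable {G : MultiHypergraph α β} {C : G.Cover γ δ} {M : β → Set δ}

/-- `x` and `y` are joined by an ordinary edge of `H`. -/
def Conflict (C : G.Cover γ δ) (x y : γ) : Prop := ∃ f ∈ C.H.E, C.H.inc f = {x, y}

theorem Conflict.symm {x y : γ} (h : C.Conflict x y) : C.Conflict y x := by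
  obtain ⟨f, hf, hinc⟩ := h
  exact ⟨f, hf, by rw [hinc, Set.pair_comm]⟩

theorem IsMatchingFamily.exists_pair_inc (hM : C.IsMatchingFamily M) {e : β} (he : e ∈ G.E)
    {u v : α} (hinc : G.inc e = {u, v}) {f : δ} (hf : f ∈ M e) :
    ∃ x ∈ C.X u, ∃ y ∈ C.X v, C.H.inc f = {x, y} := by
  obtain ⟨x, hx⟩ := hM.exists_inc he hf (v := u) (by simp [hinc])
  obtain ⟨y, hy⟩ := hM.exists_inc he hf (v := v) (by simp [hinc])
  have hx' := hx.ge rfl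
  have hy' := hy.ge rfl
  refine ⟨x, hx'.2, y, hy'.2, Set.Subset.antisymm (fun z hz => ?_) ?_⟩
  · obtain ⟨w, hw, hzw⟩ := hM.exists_X he hf hz
    rw [hinc] at hw
    rcases hw with rfl | rfl
    · exact .inl (hx.le ⟨hz, hzw⟩)
    · exact .inr (hy.le ⟨hz, hzw⟩)
  · rintro z (rfl | rfl)
    · exact hx'.1
    · exact hy'.1

theorem IsMatchingFamily.exists_of_inc (hM : C.IsMatchingFamily M) (h2 : G.IsMultigraph) {f : δ}
    (hf : f ∈ C.H.E) : ∃ e ∈ G.E, f ∈ M e ∧ ∃ u v, u ≠ v ∧ G.inc e = {u, v} ∧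
      ∃ x ∈ C.X u, ∃ y ∈ C.X v, C.H.inc f = {x, y} := by
  obtain ⟨e, he, hfe⟩ := hM.exists_mem hf
  obtain ⟨u, v, huv, hinc⟩ := h2 e he
  exact ⟨e, he, hfe, u, v, huv, hinc, hM.exists_pair_inc he hinc hfe⟩

theorem Conflict.exists_edge (hM : C.IsMatchingFamily M) (h2 : G.IsMultigraph) {x y : γ}
    (h : C.Conflict x y) {u v : α} (hx : x ∈ C.X u) (hy : y ∈ C.X v) :
    u ≠ v ∧ ∃ e ∈ G.E, G.inc e = {u, v} ∧ ∃ f ∈ M e, C.H.inc f = {x, y} := by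
  obtain ⟨f, hf, hfinc⟩ := h
  obtain ⟨e, he, hfe, u', v', huv, hinc, x', hx', y', hy', hfinc'⟩ := hM.exists_of_inc h2 hf
  have hxy : ({x', y'} : Set γ) = {x, y} := hfinc'.symm.trans hfinc
  have h1 : x' = x ∧ y' = y ∨ x' = y ∧ y' = x := Set.pair_eq_pair_iff.1 hxy
  rcases h1 with ⟨rfl, rfl⟩ | ⟨rfl, rfl⟩
  · obtain rfl := C.eq_of_mem_X hx hx'
    obtain rfl := C.eq_of_mem_X hy hy'
    exact ⟨huv, e, he, hinc, f, hfe, hfinc⟩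
  · obtain rfl := C.eq_of_mem_X hx hy'
    obtain rfl := C.eq_of_mem_X hy hx'
    exact ⟨huv.symm, e, he, by rw [hinc, Set.pair_comm], f, hfe, hfinc⟩

theorem Hit.conflict (hM : C.IsMatchingFamily M) {e : β} (he : e ∈ G.E) {u v : α}
    (hinc : G.inc e = {u, v}) {φ : α → γ} (hu : φ u ∈ C.X u) (hv : φ v ∈ C.X v)
    (h : C.Hit M e φ) : C.Conflict (φ u) (φ v) := by
  obtain ⟨f, hf, h⟩ := h
  obtain ⟨x, hx, y, hy, hfinc⟩ := hM.exists_pair_inc he hinc hf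
  refine ⟨f, hM.mem_E he hf, ?_⟩
  rw [hM.eq_of_inc he hf (v := u) (by simp [hinc]) (h u (by simp [hinc])) hu
      (by simp [hfinc]) hx,
    hM.eq_of_inc he hf (v := v) (by simp [hinc]) (h v (by simp [hinc])) hv (by simp [hfinc]) hy,
    hfinc]

theorem hit_of_inc {e : β} {u v : α} (hinc : G.inc e = {u, v}) {f : δ} (hf : f ∈ M e)
    {φ : α → γ} (hfinc : C.H.inc f = {φ u, φ v}) : C.Hit M e φ := by
  refine ⟨f, hf, fun w hw => ?_⟩
  rw [hinc] at hw
  rw [hfinc]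
  rcases hw with rfl | rfl <;> simp

theorem proper_iff_conflict (hM : C.IsMatchingFamily M) (h2 : G.IsMultigraph) {S : Set α}
    {φ : α → γ} : C.Proper S φ ↔ (∀ v ∈ S, φ v ∈ C.X v) ∧
      ∀ u ∈ S, ∀ w ∈ S, G.OrdAdj u w → ¬ C.Conflict (φ u) (φ w) := by
  refine and_congr_right fun hφ => ⟨fun h u hu w hw _ ⟨f, hf, hinc⟩ => ?_, fun h f hf hsub => ?_⟩
  · refine h f hf ?_
    rw [hinc]
    rintro _ (rfl | rfl)
    · exact ⟨u, hu, rfl⟩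
    · exact ⟨w, hw, rfl⟩
  · obtain ⟨e, he, hfe, u, v, huv, hinc, x, hx, y, hy, hfinc⟩ := hM.exists_of_inc h2 hf
    obtain ⟨a, ha, rfl⟩ := hsub (by simp [hfinc] : x ∈ C.H.inc f)
    obtain ⟨b, hb, rfl⟩ := hsub (by simp [hfinc] : y ∈ C.H.inc f)
    obtain rfl := C.eq_of_mem_X (hφ a ha) hx
    obtain rfl := C.eq_of_mem_X (hφ b hb) hy
    exact h a ha b hb ⟨huv, e, he, hinc⟩ ⟨f, hf, hfinc⟩

theorem isState_iff (hM : C.IsMatchingFamily M) (h2 : G.IsMultigraph) {v : α} {φ : α → γ} :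
    IsState G.V C.X G.OrdAdj C.Conflict v φ ↔ C.Proper (G.V \ {v}) φ := by
  rw [proper_iff_conflict hM h2]
  simp only [IsState, Set.mem_sdiff, Set.mem_singleton_iff, and_imp]
  refine and_congr_right fun _ => ⟨fun h u hu huv w hw hwv => h u hu w hw huv hwv,
    fun h u hu w hw huv hwv => h u hu huv w hw hwv⟩

theorem IsTight.exists_extension_of_preconnOn (hC : C.IsTight M) (h2 : G.IsMultigraph)
    {S : Set α} (hS : S ⊆ G.V) {φ : α → γ} (hφ : C.Proper S φ) {v : α} (hv : v ∈ G.V) (hvS : v ∉ S)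
    (hconn : PreconnOn G.OrdAdj (G.V \ S)) :
    ∃ ψ, IsState G.V C.X G.OrdAdj C.Conflict v ψ ∧ ∀ s ∈ S, ψ s = φ s := by
  classical
  simp only [isState_iff hC.matching h2]
  refine exists_extension hC.matching hS hφ hv hvS (fun a ha b hb => ?_)
    fun u hu _ _ => hC.degree_le u hu
  exact ReflTransGen.mono (fun x y hxy => ⟨hxy.1, hxy.2.1, hxy.2.2.link⟩) _ _ (hconn a ha b hb)

theorem IsTight.stateSystem (hC : C.IsTight M) (h2 : G.IsMultigraph) (hG : G.IsNonsep) :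
    StateSystem G.V C.X G.OrdAdj C.Conflict G.mult := by
  classical
  have hM := hC.matching
  have ext1 : ∀ v ∈ G.V, ∀ a ∈ G.V, v ≠ a → ∀ x ∈ C.X a,
      ∃ φ, IsState G.V C.X G.OrdAdj C.Conflict v φ ∧ φ a = x := by
    intro v hv a ha hva x hx
    obtain ⟨ψ, hψ, hψa⟩ := hC.exists_extension_of_preconnOn h2 (S := {a}) (φ := fun _ => x)
      (by simpa using ha) ((proper_iff_conflict hM h2).2 ⟨by simpa using hx, by
        rintro u rfl w rfl h; exact absurd rfl h.1⟩) hv hva (h2.preconnOn_sdiff hG ha)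
    exact ⟨ψ, hψ, hψa a rfl⟩
  have memV : ∀ u v, G.OrdAdj u v → u ∈ G.V := fun u v h => h.link.left_mem
  refine
    { finite := G.finite_V
      X_finite := C.X_finite
      r_symm := fun u v h => h.symm
      r_irrefl := fun v h => h.1 rfl
      r_mem := memV
      h_symm := fun x y h => h.symm
      nocut := fun v hv => h2.preconnOn_sdiff hG hv
      tight := ?_
      extend_one := ext1
      extend_two := ?_
      m_pos := ?_
      m_symm := fun u v => by simp only [mult, Set.pair_comm]
      ncard_nbr := ?_
      X_nonempty := ?_ }
  · intro v hv φ hφ x hx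
    rw [isState_iff hM h2] at hφ
    have hval : ∀ w, w ≠ v → w ∈ G.V → update φ v x w ∈ C.X w := fun w hw hwV => by
      rw [update_of_ne hw]; exact hφ.1 w ⟨hwV, hw⟩
    obtain ⟨e, he, hve, hhit⟩ := exists_hit hM hC.uncolorable hv hφ hx
    obtain ⟨a, b, hab, hinc⟩ := h2 e he
    obtain ⟨u, huv, hinc⟩ : ∃ u, u ≠ v ∧ G.inc e = {v, u} := by
      rw [hinc] at hve
      rcases hve with rfl | rfl
      · exact ⟨b, hab.symm, hinc⟩
      · exact ⟨a, hab, by rw [hinc, Set.pair_comm]⟩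
    have hvu : G.OrdAdj v u := ⟨huv.symm, e, he, hinc⟩
    have hcon := hhit.conflict hM he hinc (by simpa using hx)
      (hval u huv (memV _ _ hvu.symm))
    rw [update_self, update_of_ne huv] at hcon
    refine ⟨u, ⟨hvu, hcon⟩, fun w hw => ?_⟩
    obtain ⟨-, e', he', hinc', f, hf, hfinc⟩ := hw.2.exists_edge hM h2 hx
      (hφ.1 w ⟨memV _ _ hw.1.symm, hw.1.1.symm⟩)
    have hhit' : C.Hit M e' (update φ v x) := hit_of_inc hinc' hf (by
      rw [update_self, update_of_ne hw.1.1.symm, hfinc])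
    have := eq_of_hit hM hC.uncolorable hv hφ (hC.degree_le v hv) hx he hve hhit he'
      (by simp [hinc']) hhit'
    rw [this, hinc] at hinc'
    have : w ∈ ({v, u} : Set α) := hinc' ▸ (by simp)
    exact this.resolve_left hw.1.1.symm
  · intro v hv a ha b hb hva hvb hab hn hconn x hx y hy
    obtain ⟨ψ, hψ, hψS⟩ := hC.exists_extension_of_preconnOn h2 (S := {a, b})
      (φ := update (fun _ => x) b y) (Set.insert_subset ha (by simpa using hb))
      ((proper_iff_conflict hM h2).2 ⟨by
        rintro w (rfl | rfl)
        · rwa [update_of_ne hab]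
        · rwa [update_self], by
        rintro u (rfl | rfl) w (rfl | rfl) h
        · exact absurd rfl h.1
        · exact absurd h hn
        · exact absurd h.symm hn
        · exact absurd rfl h.1⟩) hv (by simp [hva, hvb]) hconn
    exact ⟨ψ, hψ, by rw [hψS a (by simp), update_of_ne hab], by
      rw [hψS b (by simp), update_self]⟩
  · rintro u v ⟨-, e, he, hinc⟩
    exact (Set.ncard_pos (G.finite_E.subset fun _ h => h.1)).2 ⟨e, he, hinc⟩
  · intro u v huv y hy
    have hv := memV _ _ huv.symm
    -- In a state at `v` with `y` at `u`, each of the `m` parallel edges is hit by exactly one color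
    -- of `v`, and no color hits two of them. So edges correspond to colors in conflict with `y`.
    obtain ⟨φ, hφ, rfl⟩ := ext1 v hv u (memV _ _ huv) huv.1.symm y hy
    rw [isState_iff hM h2] at hφ
    have hve : ∀ e, e ∈ G.E ∧ G.inc e = {u, v} → v ∈ G.inc e := fun e he => by simp [he.2]
    have hex := fun e (he : e ∈ G.E ∧ G.inc e = {u, v}) =>
      exists_hit_of_mem_inc hM hC.uncolorable hv hφ (hC.degree_le v hv) he.1 (hve e he)
    choose g hg1 hg2 hg3 using hex
    symm
    refine Set.ncard_congr (s := {e | e ∈ G.E ∧ G.inc e = {u, v}}) (fun e he => g e he) ?_ ?_ ?_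
    · intro e he
      refine ⟨hg1 e he, ?_⟩
      have := (hg2 e he).conflict hM he.1 he.2 (by rwa [update_of_ne huv.1])
        (by rw [update_self]; exact hg1 e he)
      rw [update_self, update_of_ne huv.1] at this
      exact this.symm
    · intro e e' he he' heq
      have := hg2 e' he'
      rw [← heq] at this
      exact (hg3 e he e' he'.1 (hve e' he') this).symm
    · intro x hx
      obtain ⟨-, e, he, hinc, f, hf, hfinc⟩ := hx.2.symm.exists_edge hM h2 hy hx.1
      have hhit : C.Hit M e (update φ v x) := hit_of_inc hinc hf (by
        rw [update_self, update_of_ne huv.1, hfinc])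
      exact ⟨e, ⟨he, hinc⟩, update_hit_injective hM he (hve e ⟨he, hinc⟩) (hg1 e ⟨he, hinc⟩) hx.1
        (hg2 e ⟨he, hinc⟩) hhit⟩
  · rintro u v ⟨-, e, he, hinc⟩
    exact hC.X_nonempty he (by simp [hinc])

/-! ### Minimality and the assembly of basic configurations -/

/-- Deleting one of two parallel edges of `H` does not affect which transversals are independent.
This makes the multipartite pieces simple graphs. -/
theorem IsMinimalUncolorable.inc_injective (hC : C.IsMinimalUncolorable) {f f' : δ}
    (hf : f ∈ C.H.E) (hf' : f' ∈ C.H.E) (hinc : C.H.inc f = C.H.inc f') : f = f' := by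
  by_contra hne
  obtain ⟨φ, h1, h2⟩ := (C.isColorable_deleteEdge_iff hf).1 (hC.2 f hf)
  refine not_proper_of_not_isColorable hC.1 φ ⟨h1, fun k hk hsub => ?_⟩
  by_cases hkf : k = f
  · subst hkf
    exact h2 f' hf' (Ne.symm hne) (hinc ▸ hsub)
  · exact h2 k hk hkf hsub

theorem isCompleteMultipartite_induce (hmin : C.IsMinimalUncolorable)
    (hM : C.IsMatchingFamily M) (h2 : G.IsMultigraph) {ι : Type*} {P : ι → Set γ} {a : ι → α}
    (ha : Injective a) (haV : ∀ i, a i ∈ G.V) (hP : ∀ i, P i ⊆ C.X (a i)) {t : ℕ}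
    (hcard : ∀ i, (P i).ncard = t)
    (hconf : ∀ i k, i ≠ k → ∀ x ∈ P i, ∀ y ∈ P k, C.Conflict x y) {S : Set γ}
    (hS : S = ⋃ i, P i) : (C.H.induce S).IsCompleteMultipartite t P where
  vertices := by
    subst hS
    refine Set.inter_eq_right.2 (Set.iUnion_subset fun i => ?_)
    exact (hP i).trans (C.X_subset (haV i))
  disjoint := fun i k hik => Set.disjoint_left.2 fun x hx hx' =>
    hik (ha (C.eq_of_mem_X (hP i hx) (hP k hx')))
  card := hcard
  edges := by
    intro f hf
    rw [induce_inc hf]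
    obtain ⟨e, he, hfe, u, v, huv, hinc, x, hx, y, hy, hfinc⟩ := hM.exists_of_inc h2 hf.1
    have hsub := hf.2
    rw [hfinc, hS] at hsub
    have hxS := hsub (.inl rfl)
    have hyS := hsub (.inr rfl)
    simp only [Set.mem_iUnion] at hxS hyS
    obtain ⟨i, hi⟩ := hxS
    obtain ⟨k, hk⟩ := hyS
    refine ⟨i, k, ?_, x, hi, y, hk, hfinc⟩
    rintro rfl
    exact huv ((C.eq_of_mem_X hx (hP i hi)).trans (C.eq_of_mem_X (hP i hk) hy))
  joined := by
    intro i k hik x hx y hy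
    obtain ⟨f, hf, hfinc⟩ := hconf i k hik x hx y hy
    have hfS : f ∈ (C.H.induce S).E := by
      refine ⟨hf, ?_⟩
      rw [hfinc, hS]
      rintro _ (rfl | rfl)
      · exact Set.mem_iUnion.2 ⟨i, hx⟩
      · exact Set.mem_iUnion.2 ⟨k, hy⟩
    refine ⟨f, ⟨hfS, by rw [induce_inc hfS, hfinc]⟩, fun f' hf' => ?_⟩
    have hf2 := hf'.2
    rw [induce_inc hf'.1] at hf2
    exact hmin.inc_injective hf'.1.1 hf (hf2.trans hfinc.symm)

theorem isCompleteBetween_of_conflict (hmin : C.IsMinimalUncolorable)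
    (hM : C.IsMatchingFamily M) (h2 : G.IsMultigraph) {u v : α} (huv : G.OrdAdj u v)
    {Y Z : Set γ} (hY : Y ⊆ C.X u) (hZ : Z ⊆ C.X v) {t : ℕ} (hYt : Y.ncard = t)
    (hZt : Z.ncard = t) (hconf : ∀ x ∈ Y, ∀ y ∈ Z, C.Conflict x y) :
    C.IsCompleteBetween t Y Z := by
  refine isCompleteMultipartite_induce hmin hM h2 (a := ![u, v]) ?_ ?_ ?_ ?_ ?_ ?_
  · intro i j hij
    fin_cases i <;> fin_cases j
    · rfl
    · exact absurd hij huv.1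
    · exact absurd hij.symm huv.1
    · rfl
  · exact Fin.forall_fin_two.2 ⟨huv.link.left_mem, huv.link.right_mem⟩
  · exact Fin.forall_fin_two.2 ⟨hY, hZ⟩
  · exact Fin.forall_fin_two.2 ⟨hYt, hZt⟩
  · intro i k hik
    fin_cases i <;> fin_cases k
    · exact absurd rfl hik
    · exact hconf
    · exact fun x hx y hy => (hconf y hy x hx).symm
    · exact absurd rfl hik
  · ext x
    simp [Fin.exists_fin_two]

theorem isUnion_of_induce {H : MultiHypergraph γ δ} {F : Set (MultiHypergraph γ δ)}
    (hF : ∀ K ∈ F, ∃ S, K = H.induce S) (hV : ∀ x ∈ H.V, ∃ S, H.induce S ∈ F ∧ x ∈ S)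
    (hE : ∀ f ∈ H.E, ∃ S, H.induce S ∈ F ∧ H.inc f ⊆ S) : H.IsUnion F := by
  have hle : ∀ K ∈ F, K ≤ H := by
    intro K hK
    obtain ⟨S, rfl⟩ := hF K hK
    exact induce_le _ _
  refine ⟨hle, Set.Subset.antisymm (fun x hx => ?_) (Set.iUnion₂_subset fun K hK => (hle K hK).1),
    Set.Subset.antisymm (fun f hf => ?_) (Set.iUnion₂_subset fun K hK => (hle K hK).2.1)⟩
  · obtain ⟨S, hS, hxS⟩ := hV x hx
    exact Set.mem_biUnion hS ⟨hx, hxS⟩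
  · obtain ⟨S, hS, hfS⟩ := hE f hf
    exact Set.mem_biUnion hS ⟨hf, hfS⟩

theorem exists_mem_X (C : G.Cover γ δ) {x : γ} (hx : x ∈ C.H.V) : ∃ v ∈ G.V, x ∈ C.X v := by
  rw [C.vertices] at hx
  simpa using hx

end Cover

theorem cycleGraph_adj_iff {n : ℕ} (hn : 3 ≤ n) (i j : Fin n) :
    (SimpleGraph.cycleGraph n).Adj i j ↔ (j : ℕ) = i + 1 ∨ (i : ℕ) = j + 1 ∨
      ((i : ℕ) = 0 ∧ (j : ℕ) = n - 1) ∨ ((j : ℕ) = 0 ∧ (i : ℕ) = n - 1) := by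
  rw [SimpleGraph.cycleGraph_adj']
  have hi := i.2
  have hj := j.2
  rcases lt_trichotomy i j with h | h | h
  · rw [Fin.coe_sub_iff_lt.2 h, Fin.coe_sub_iff_le.2 h.le]
    have : (i : ℕ) < j := h
    omega
  · subst h
    rw [Fin.coe_sub_iff_le.2 le_rfl]
    omega
  · rw [Fin.coe_sub_iff_lt.2 h, Fin.coe_sub_iff_le.2 h.le]
    have : (j : ℕ) < i := h
    omega

theorem isMultiple_of_mult {G : MultiHypergraph α β} (h2 : G.IsMultigraph) {t : ℕ}
    (ht : ∀ u v, G.OrdAdj u v → G.mult u v = t) {W : Type*} {Γ : SimpleGraph W} (φ : W ≃ G.V)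
    (hφ : ∀ a b, Γ.Adj a b ↔ G.OrdAdj (φ a) (φ b)) : G.IsMultiple t Γ := by
  refine ⟨φ, fun e he => ?_, fun a b hab => ht _ _ ((hφ a b).1 hab)⟩
  obtain ⟨u, v, huv, hinc⟩ := h2 e he
  have hadj : G.OrdAdj u v := ⟨huv, e, he, hinc⟩
  refine ⟨φ.symm ⟨u, hadj.link.left_mem⟩, φ.symm ⟨v, hadj.link.right_mem⟩, ?_, ?_⟩
  · rw [hφ]; simpa using hadj
  · simpa using hinc

namespace Cover

variable {G : MultiHypergraph α β} {C : G.Cover γ δ} {M : β → Set δ}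

theorem IsTight.isKConfiguration_of_complete (hC : C.IsTight M) (hmin : C.IsMinimalUncolorable)
    (h2 : G.IsMultigraph) (hG : G.IsNonsep) {a b : α} (ha : a ∈ G.V) (hb : b ∈ G.V) (hab : a ≠ b)
    {t : ℕ} (ht1 : 1 ≤ t) (ht : ∀ u v, G.OrdAdj u v → G.mult u v = t)
    (hcomp : ∀ u ∈ G.V, ∀ v ∈ G.V, u ≠ v → G.OrdAdj u v) : C.IsKConfiguration := by
  have S := hC.stateSystem h2 hG
  obtain ⟨Q, hQX, hQd, hQt, hQ⟩ := S.exists_complete_partition ha hb hab ht hcomp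
  have : Finite G.V := G.finite_V
  have hcard : Nat.card ↥(G.V \ {a}) = G.V.ncard - 1 := by
    rw [Nat.card_coe_set_eq, Set.ncard_sdiff_singleton_of_mem ha]
  have : Finite ↥(G.V \ {a}) := G.finite_V.subset Set.sdiff_subset
  let ε : Fin (G.V.ncard - 1) ≃ ↥(G.V \ {a}) :=
    (finCongr hcard.symm).trans (Finite.equivFin ↥(G.V \ {a})).symm
  let φ : Fin G.V.ncard ≃ G.V := (Finite.equivFin G.V).symm
  have hunion : ∀ j, (⋃ v ∈ G.V, Q (ε j) v) = ⋃ v : G.V, Q (ε j) v := fun j =>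
    Set.biUnion_eq_iUnion G.V fun v _ => Q (ε j) v
  refine ⟨t, G.V.ncard, ht1, (Set.ncard_pos G.finite_V).2 ⟨a, ha⟩, isMultiple_of_mult h2 ht φ ?_,
    fun j => Q (ε j), fun v hv => ⟨?_, fun j => ?_, fun j k hjk => ?_⟩, fun j => ?_, ?_⟩
  · intro i j
    rw [SimpleGraph.top_adj]
    refine ⟨fun hij => hcomp _ (φ i).2 _ (φ j).2 fun h => hij (φ.injective (Subtype.ext h)), ?_⟩
    rintro h rfl
    exact h.1 rfl
  · rw [hQX v hv]
    exact (ε.surjective.iUnion_comp fun j => Q j v).symm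
  · exact Set.nonempty_of_ncard_ne_zero (by rw [hQt v hv]; omega)
  · exact hQd v hv fun h => hjk (ε.injective h)
  · refine isCompleteMultipartite_induce hmin hC.matching h2 (a := fun v : G.V => (v : α))
      Subtype.val_injective (fun v => v.2) (fun v => ?_) (fun v => hQt v v.2 _) ?_ (hunion j)
    · rw [hQX v v.2]
      exact Set.subset_iUnion (fun j => Q j (v : α)) (ε j)
    · intro u v huv x hx y hy
      exact (hQ u u.2 v v.2 (fun h => huv (Subtype.ext h)) _ _ x hx y hy).2 rfl
  · refine isUnion_of_induce ?_ (fun x hx => ?_) (fun f hf => ?_)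
    · rintro _ ⟨j, rfl⟩
      exact ⟨_, rfl⟩
    · obtain ⟨v, hv, hxv⟩ := C.exists_mem_X hx
      rw [hQX v hv, Set.mem_iUnion] at hxv
      obtain ⟨j, hj⟩ := hxv
      obtain ⟨i, rfl⟩ := ε.surjective j
      exact ⟨_, ⟨i, rfl⟩, Set.mem_biUnion hv hj⟩
    · obtain ⟨e, he, hfe, u, v, huv, hinc, x, hx, y, hy, hfinc⟩ := hC.matching.exists_of_inc h2 hf
      have hadj : G.OrdAdj u v := ⟨huv, e, he, hinc⟩
      have hu := hadj.link.left_mem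
      have hv := hadj.link.right_mem
      rw [hQX u hu, Set.mem_iUnion] at hx
      rw [hQX v hv, Set.mem_iUnion] at hy
      obtain ⟨j, hj⟩ := hx
      obtain ⟨k, hk⟩ := hy
      obtain rfl := (hQ u hu v hv huv j k x hj y hk).1 ⟨f, hf, hfinc⟩
      obtain ⟨i, rfl⟩ := ε.surjective j
      refine ⟨_, ⟨i, rfl⟩, ?_⟩
      rw [hfinc]
      rintro _ (rfl | rfl)
      · exact Set.mem_biUnion hu hj
      · exact Set.mem_biUnion hv hk

theorem IsTight.isCConfiguration_of_cycle (hC : C.IsTight M) (hmin : C.IsMinimalUncolorable)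
    (h2 : G.IsMultigraph) (hG : G.IsNonsep)
    {t : ℕ} (ht1 : 1 ≤ t) (ht : ∀ u v, G.OrdAdj u v → G.mult u v = t) {n : ℕ} {p : ℕ → α}
    (hn : 4 ≤ n) (hpV : ∀ i < n, p i ∈ G.V)
    (hpinj : ∀ i < n, ∀ j < n, p i = p j → i = j) (hpsurj : ∀ v ∈ G.V, ∃ i < n, p i = v)
    (hadj : ∀ i < n, ∀ j < n, (G.OrdAdj (p i) (p j) ↔
        j = i + 1 ∨ i = j + 1 ∨ (i = 0 ∧ j = n - 1) ∨ (j = 0 ∧ i = n - 1)))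
    (hX : ∀ v ∈ G.V, (C.X v).ncard = 2 * t) : C.IsCConfiguration := by
  have S := hC.stateSystem h2 hG
  obtain ⟨Q, hQX, hQd, hQt, hQ, hQl⟩ := S.exists_cycle_partition ht1 ht hn hpV hpinj hpsurj hadj hX
  have hlast : G.OrdAdj (p (n - 1)) (p 0) := (hadj _ (by omega) _ (by omega)).2 (by omega)
  generalize hw : p (n - 1) = w at hlast hQ hQl
  generalize hw' : p 0 = w' at hlast hQ hQl
  let φ : Fin n ≃ G.V := Equiv.ofBijective (fun i => ⟨p i, hpV i i.2⟩)
    ⟨fun i j hij => Fin.ext (hpinj i i.2 j j.2 (congrArg Subtype.val hij)), fun v => by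
      obtain ⟨i, hi, hiv⟩ := hpsurj v v.2
      exact ⟨⟨i, hi⟩, Subtype.ext hiv⟩⟩
  have hmult : G.IsMultiple t (SimpleGraph.cycleGraph n) := isMultiple_of_mult h2 ht φ fun i j => by
    rw [cycleGraph_adj_iff (by omega)]
    exact (hadj i i.2 j j.2).symm
  have hQsub : ∀ v ∈ G.V, ∀ j, Q j v ⊆ C.X v := by
    intro v hv j
    rw [hQX v hv]
    exact Set.subset_iUnion (fun j => Q j v) j
  have hpart : C.IsPartition Q := fun v hv => ⟨hQX v hv, fun j =>
    Set.nonempty_of_ncard_ne_zero (by rw [hQt v hv]; omega), hQd v hv⟩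
  have hnbr : ∀ v ∈ G.V, ∃ u, G.OrdAdj v u := by
    intro v hv
    have : w ∈ G.V ∧ w' ∈ G.V := ⟨hlast.link.left_mem, hlast.link.right_mem⟩
    exact StateSystem.exists_adj (h2.preconnOn hG.1) this.1 this.2 hlast.1 hv
  have between : ∀ u v, G.OrdAdj u v → ∀ j k, (∀ x ∈ Q j u, ∀ y ∈ Q k v, C.Conflict x y) →
      C.IsCompleteBetween t (Q j u) (Q k v) := fun u v huv j k hconf =>
    isCompleteBetween_of_conflict hmin hC.matching h2 huv (hQsub u huv.link.left_mem j)
      (hQsub v huv.link.right_mem k) (hQt u huv.link.left_mem j) (hQt v huv.link.right_mem k) hconf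
  have edge : ∀ f ∈ C.H.E, ∃ u v, G.OrdAdj u v ∧ ∃ j k, ∃ x ∈ Q j u, ∃ y ∈ Q k v,
      C.Conflict x y ∧ C.H.inc f = {x, y} := by
    intro f hf
    obtain ⟨e, he, hfe, u, v, huv, hinc, x, hx, y, hy, hfinc⟩ := hC.matching.exists_of_inc h2 hf
    have hadj : G.OrdAdj u v := ⟨huv, e, he, hinc⟩
    rw [hQX u hadj.link.left_mem, Set.mem_iUnion] at hx
    rw [hQX v hadj.link.right_mem, Set.mem_iUnion] at hy
    obtain ⟨j, hj⟩ := hx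
    obtain ⟨k, hk⟩ := hy
    exact ⟨u, v, hadj, j, k, x, hj, y, hk, ⟨f, hf, hfinc⟩, hfinc⟩
  have pair_sub : ∀ {x y : γ} {Y Z : Set γ}, x ∈ Y → y ∈ Z → ({x, y} : Set γ) ⊆ Y ∪ Z := by
    rintro x y Y Z hx hy _ (rfl | rfl)
    · exact .inl hx
    · exact .inr hy
  have vert : ∀ x ∈ C.H.V, ∃ v u, G.OrdAdj v u ∧ ∃ j, x ∈ Q j v := by
    intro x hx
    obtain ⟨v, hv, hxv⟩ := C.exists_mem_X hx
    rw [hQX v hv, Set.mem_iUnion] at hxv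
    obtain ⟨u, hu⟩ := hnbr v hv
    exact ⟨v, u, hu, hxv⟩
  by_cases hodd : Odd n
  · have hall : ∀ u v, G.OrdAdj u v → ∀ j k, ∀ x ∈ Q j u, ∀ y ∈ Q k v, (C.Conflict x y ↔ j = k) := by
      intro u v huv j k x hx y hy
      by_cases hne : ({u, v} : Set α) = {w, w'}
      · rcases Set.pair_eq_pair_iff.1 hne with ⟨rfl, rfl⟩ | ⟨rfl, rfl⟩
        · exact (hQl j k x hx y hy).trans (by simp [hodd])
        · have := hQl k j y hy x hx
          simp only [hodd, true_iff] at this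
          rw [eq_comm, ← this]
          exact ⟨fun h => h.symm, fun h => h.symm⟩
      · exact hQ u v huv hne j k x hx y hy
    refine .inl ⟨t, n, ht1, ?_, hodd, hmult, Q, hpart, fun j u v huv => between u v huv j j
      fun x hx y hy => (hall u v huv j j x hx y hy).2 rfl, isUnion_of_induce ?_ ?_ ?_⟩
    · obtain ⟨k, rfl⟩ := hodd
      omega
    · rintro _ ⟨j, u, v, -, rfl⟩
      exact ⟨_, rfl⟩
    · intro x hx
      obtain ⟨v, u, hvu, j, hj⟩ := vert x hx
      exact ⟨_, ⟨j, v, u, hvu, rfl⟩, .inl hj⟩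
    · intro f hf
      obtain ⟨u, v, huv, j, k, x, hx, y, hy, hxy, hfinc⟩ := edge f hf
      obtain rfl := (hall u v huv j k x hx y hy).1 hxy
      exact ⟨_, ⟨j, u, v, huv, rfl⟩, by rw [hfinc]; exact pair_sub hx hy⟩
  · have hQl' : ∀ j k, ∀ x ∈ Q j w, ∀ y ∈ Q k w', (C.Conflict x y ↔ j ≠ k) := by
      intro j k x hx y hy
      rw [hQl j k x hx y hy]
      simp [hodd]
    have memA : C.H.induce (Q 0 w ∪ Q 1 w') ∈ ({K | ∃ j u v, G.OrdAdj u v ∧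
        ({u, v} : Set α) ≠ {w, w'} ∧ K = C.H.induce (Q j u ∪ Q j v)} ∪
        {C.H.induce (Q 0 w ∪ Q 1 w'), C.H.induce (Q 1 w ∪ Q 0 w')}) := .inr (.inl rfl)
    have memB : C.H.induce (Q 1 w ∪ Q 0 w') ∈ ({K | ∃ j u v, G.OrdAdj u v ∧
        ({u, v} : Set α) ≠ {w, w'} ∧ K = C.H.induce (Q j u ∪ Q j v)} ∪
        {C.H.induce (Q 0 w ∪ Q 1 w'), C.H.induce (Q 1 w ∪ Q 0 w')}) := .inr (.inr rfl)
    refine .inr ⟨t, n, ht1, hn, Nat.not_odd_iff_even.1 hodd, hmult, Q, w, w', hpart, hlast,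
      fun j u v huv hne => between u v huv j j
        fun x hx y hy => (hQ u v huv hne j j x hx y hy).2 rfl,
      between w w' hlast 0 1 fun x hx y hy => (hQl' 0 1 x hx y hy).2 (by decide),
      between w w' hlast 1 0 fun x hx y hy => (hQl' 1 0 x hx y hy).2 (by decide),
      isUnion_of_induce ?_ ?_ ?_⟩
    · rintro _ (⟨j, u, v, -, -, rfl⟩ | rfl | rfl) <;> exact ⟨_, rfl⟩
    · intro x hx
      obtain ⟨v, u, hvu, j, hj⟩ := vert x hx
      by_cases hne : ({v, u} : Set α) = {w, w'}
      · rcases Set.pair_eq_pair_iff.1 hne with ⟨rfl, rfl⟩ | ⟨rfl, rfl⟩ <;> fin_cases j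
        · exact ⟨_, memA, .inl hj⟩
        · exact ⟨_, memB, .inl hj⟩
        · exact ⟨_, memB, .inr hj⟩
        · exact ⟨_, memA, .inr hj⟩
      · exact ⟨_, .inl ⟨j, v, u, hvu, hne, rfl⟩, .inl hj⟩
    · have hl : ∀ j k, ∀ x ∈ Q j w, ∀ y ∈ Q k w', C.Conflict x y → ∃ T, C.H.induce T ∈
          ({K | ∃ j u v, G.OrdAdj u v ∧
          ({u, v} : Set α) ≠ {w, w'} ∧ K = C.H.induce (Q j u ∪ Q j v)} ∪
          {C.H.induce (Q 0 w ∪ Q 1 w'), C.H.induce (Q 1 w ∪ Q 0 w')}) ∧ {x, y} ⊆ T := by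
        intro j k x hx y hy hxy
        have hjk := (hQl' j k x hx y hy).1 hxy
        fin_cases j <;> fin_cases k
        · exact absurd rfl hjk
        · exact ⟨_, memA, pair_sub hx hy⟩
        · exact ⟨_, memB, pair_sub hx hy⟩
        · exact absurd rfl hjk
      intro f hf
      obtain ⟨u, v, huv, j, k, x, hx, y, hy, hxy, hfinc⟩ := edge f hf
      rw [hfinc]
      by_cases hne : ({u, v} : Set α) = {w, w'}
      · rcases Set.pair_eq_pair_iff.1 hne with ⟨rfl, rfl⟩ | ⟨rfl, rfl⟩
        · exact hl j k x hx y hy hxy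
        · rw [Set.pair_comm x y]
          exact hl k j y hy x hx hxy.symm
      · obtain rfl := (hQ u v huv hne j k x hx y hy).1 hxy
        exact ⟨_, .inl ⟨j, u, v, huv, hne, rfl⟩, pair_sub hx hy⟩

/-- The degenerate K-configuration `n = 1`: a single vertex with no color, and no classes at all. An
empty `G` would be colorable. -/
theorem isKConfiguration_of_subsingleton (hmin : C.IsMinimalUncolorable)
    (hV : ∀ a ∈ G.V, ∀ b ∈ G.V, a = b) : C.IsKConfiguration := by
  have hE : ∀ e, e ∉ G.E := by
    intro e he
    obtain ⟨a, ha, b, hb, hab⟩ := exists_pair he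
    exact hab (hV a (G.inc_subset e he ha) b (G.inc_subset e he hb))
  obtain ⟨M, hM⟩ := C.exists_isMatchingFamily
  have hHE : ∀ f, f ∉ C.H.E := fun f hf => by
    obtain ⟨e, he, -⟩ := hM.exists_mem hf
    exact hE e he
  obtain ⟨v, hv⟩ : G.V.Nonempty := by
    by_contra hne
    rw [Set.not_nonempty_iff_eq_empty] at hne
    refine hmin.1 ⟨∅, Set.empty_subset _, by simp [hne], ?_⟩
    exact Set.eq_empty_of_forall_notMem fun f hf => hHE f hf.1
  have hXv : ∀ x, x ∉ C.X v := by
    intro x hx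
    refine not_proper_of_not_isColorable hmin.1 (fun _ => x) ⟨fun u hu => ?_, fun f hf =>
      absurd hf (hHE f)⟩
    rw [hV u hu v hv]
    exact hx
  have uV : Unique G.V := ⟨⟨⟨v, hv⟩⟩, fun u => Subtype.ext (hV u u.2 v hv)⟩
  refine ⟨1, 1, le_rfl, le_rfl, ⟨Equiv.ofUnique _ _, fun e he => absurd he (hE e), fun a b hab =>
    absurd (Subsingleton.elim a b) hab⟩, fun j => j.elim0, fun u hu => ⟨?_, fun j => j.elim0,
    fun j => j.elim0⟩, fun j => j.elim0, ⟨?_, ?_, ?_⟩⟩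
  · rw [hV u hu v hv, Set.eq_empty_of_forall_notMem hXv]
    simp
  · rintro _ ⟨j, rfl⟩
    exact j.elim0
  · refine (Set.eq_empty_of_forall_notMem fun x hx => ?_).trans (by simp)
    obtain ⟨u, hu, hxu⟩ := C.exists_mem_X hx
    exact hXv x (hV u hu v hv ▸ hxu)
  · exact (Set.eq_empty_of_forall_notMem hHE).trans (by simp)

theorem configuration_of_isNonsep (hG : G.IsNonsep) (hfeas : C.IsDegreeFeasible)
    (hmin : C.IsMinimalUncolorable) :
    C.IsKConfiguration ∨ C.IsCConfiguration ∨ C.IsEConfiguration := by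
  by_cases hV : ∀ a ∈ G.V, ∀ b ∈ G.V, a = b
  · exact .inl (isKConfiguration_of_subsingleton hmin hV)
  push Not at hV
  obtain ⟨a, ha, b, hb, hab⟩ := hV
  obtain ⟨M, hM⟩ := C.exists_isMatchingFamily
  have hC : C.IsTight M := ⟨hM, hG.1, not_proper_of_not_isColorable hmin.1, hfeas.2⟩
  by_cases h3 : ∃ e ∈ G.E, 3 ≤ (G.inc e).ncard
  · obtain ⟨e, he, h3⟩ := h3
    obtain ⟨hE, hV⟩ := hC.singleton_edge hG he h3
    exact .inr (.inr (hC.isEConfiguration hE hV))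
  push Not at h3
  have h2 : G.IsMultigraph := fun e he => Set.ncard_eq_two.1
    (le_antisymm (Nat.le_of_lt_succ (h3 e he)) (G.two_le_inc e he))
  have S := hC.stateSystem h2 hG
  have hconn := h2.preconnOn hG.1
  obtain ⟨t, ht1, ht⟩ := S.exists_multiplicity hconn ha hb hab
  rcases S.complete_or_cycle hconn ha hb hab ht1 ht with hcomp | ⟨n, p, hn, h1, h2', h3', h4, h5⟩
  · exact .inl (hC.isKConfiguration_of_complete hmin h2 hG ha hb hab ht1 ht hcomp)
  · exact .inr (.inl (hC.isCConfiguration_of_cycle hmin h2 hG ht1 ht hn h1 h2' h3' h4 h5))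

end Cover

/-! ### Splitting a configuration at a separating vertex -/

namespace Cover

variable {G : MultiHypergraph α β}

/-- The colors of vertices in `S`, where only the colors in `A` are kept at `v`. -/
def keep (C : G.Cover γ δ) (S : Set α) (v : α) (A : Set γ) (u : α) : Set γ :=
  {x | u ∈ S ∧ x ∈ C.X u ∧ (u = v → x ∈ A)}

theorem inc_subset_keep {C : G.Cover γ δ} {S : Set α} {v : α} {A : Set γ} {f : δ} {u : α} {x : γ}
    (hf : C.H.inc f ⊆ ⋃ u, C.keep S v A u) (hx : x ∈ C.H.inc f) (hu : x ∈ C.X u) :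
    x ∈ C.keep S v A u := by
  obtain ⟨w, hw⟩ := Set.mem_iUnion.1 (hf hx)
  obtain rfl := C.eq_of_mem_X hu hw.2.1
  exact hw

/-- The restriction of a cover to `G[S]`, where only the colors in `A` are kept at `v`. -/
def restrict (C : G.Cover γ δ) (S : Set α) (v : α) (A : Set γ) : (G.induce S).Cover γ δ where
  X := C.keep S v A
  H := C.H.induce (⋃ u, C.keep S v A u)
  X_eq_empty := fun u hu => Set.eq_empty_of_forall_notMem fun x hx =>
    hu ⟨C.mem_V_of_mem_X hx.2.1, hx.1⟩
  X_disjoint := fun u _ w _ huw => Set.disjoint_left.2 fun x hx hx' =>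
    huw (C.eq_of_mem_X hx.2.1 hx'.2.1)
  vertices := by
    ext x
    constructor
    · rintro ⟨-, hx⟩
      obtain ⟨u, hu⟩ := Set.mem_iUnion.1 hx
      exact Set.mem_biUnion ⟨C.mem_V_of_mem_X hu.2.1, hu.1⟩ hu
    · intro hx
      simp only [Set.mem_iUnion] at hx
      obtain ⟨u, hu, hx⟩ := hx
      exact ⟨C.X_subset hu.1 hx.2.1, Set.mem_iUnion.2 ⟨u, hx⟩⟩
  independent := by
    intro u hu
    refine Set.eq_empty_of_forall_notMem fun f hf => ?_
    have h1 := hf.2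
    rw [induce_inc hf.1] at h1
    have : f ∈ (C.H.induce (C.X u)).E := ⟨hf.1.1, fun x hx => (h1 hx).2.1⟩
    rw [C.independent u hu.1] at this
    exact this
  matchings := by
    obtain ⟨M, hM⟩ := C.exists_isMatchingFamily
    refine ⟨fun e => {f | f ∈ M e ∧ C.H.inc f ⊆ ⋃ u, C.keep S v A u}, fun e he => ⟨⟨?_, ?_⟩, ?_⟩,
      ?_⟩
    · rintro f ⟨hf, hsub⟩
      have hfE : f ∈ (C.H.induce (⋃ u, C.keep S v A u)).E := ⟨hM.mem_E he.1 hf, hsub⟩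
      refine ⟨hfE, ?_⟩
      rw [induce_inc hfE, induce_inc he]
      intro x hx
      obtain ⟨w, hw, hxw⟩ := hM.exists_X he.1 hf hx
      exact Set.mem_biUnion hw (inc_subset_keep hsub hx hxw)
    · rintro x - f ⟨hf, -⟩ f' ⟨hf', -⟩ hx hx'
      exact hM.eq_of_mem_inc he.1 hf hf' hx.2.2 hx'.2.2
    · rintro f ⟨hf, hsub⟩ w hw
      rw [induce_inc he] at hw
      have hfE : f ∈ (C.H.induce (⋃ u, C.keep S v A u)).E := ⟨hM.mem_E he.1 hf, hsub⟩
      rw [induce_inc hfE, ← (hM.1 e he.1).2 f hf w hw]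
      congr 1
      ext x
      exact ⟨fun h => ⟨h.1, h.2.2.1⟩, fun h => ⟨h.1, inc_subset_keep hsub h.1 h.2⟩⟩
    · ext f
      simp only [Set.mem_iUnion]
      constructor
      · rintro ⟨hf, hsub⟩
        obtain ⟨e, he, hfe⟩ := hM.exists_mem hf
        refine ⟨e, ⟨he, fun w hw => ?_⟩, hfe, hsub⟩
        obtain ⟨x, hx⟩ := hM.exists_inc he hfe hw
        have hx' := hx.ge rfl
        exact (inc_subset_keep hsub hx'.1 hx'.2).1
      · rintro ⟨e, he, hfe, hsub⟩
        exact ⟨hM.mem_E he.1 hfe, hsub⟩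

variable {C : G.Cover γ δ}

theorem mem_restrict_E {S : Set α} {v : α} {A : Set γ} {f : δ} {φ : α → γ}
    (hf : f ∈ C.H.E) (hφ : ∀ u ∈ S, φ u ∈ C.X u) (hv : φ v ∈ A) (hsub : C.H.inc f ⊆ φ '' S) :
    f ∈ (C.restrict S v A).H.E := by
  refine ⟨hf, fun x hx => ?_⟩
  obtain ⟨u, hu, rfl⟩ := hsub hx
  exact Set.mem_iUnion.2 ⟨u, hu, hφ u hu, by rintro rfl; exact hv⟩

theorem restrict_inc {S : Set α} {v : α} {A : Set γ} {f : δ}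
    (hf : f ∈ (C.restrict S v A).H.E) : (C.restrict S v A).H.inc f = C.H.inc f := induce_inc hf

theorem proper_restrict {S : Set α} {v : α} {A : Set γ} {φ : α → γ}
    (hφ : ∀ u ∈ S, φ u ∈ C.X u) (hv : φ v ∈ A)
    (h : ∀ f ∈ (C.restrict S v A).H.E, ¬ C.H.inc f ⊆ φ '' S) :
    (C.restrict S v A).Proper (G.induce S).V φ := by
  refine ⟨fun u hu => ⟨hu.2, hφ u hu.2, by rintro rfl; exact hv⟩, fun f hf hsub => ?_⟩
  rw [restrict_inc hf] at hsub
  exact h f hf (hsub.trans (Set.image_mono fun u hu => hu.2))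

theorem proper_of_proper_restrict {S : Set α} {v : α} {A : Set γ} {φ : α → γ} (hS : S ⊆ G.V)
    (hvS : v ∈ S) (h : (C.restrict S v A).Proper (G.induce S).V φ) :
    C.Proper S φ ∧ φ v ∈ A := by
  have hV : (G.induce S).V = S := Set.inter_eq_right.2 hS
  rw [hV] at h
  have hv := (h.1 v hvS).2.2 rfl
  refine ⟨⟨fun u hu => (h.1 u hu).2.1, fun f hf hsub => ?_⟩, hv⟩
  have hfE := mem_restrict_E hf (fun u hu => (h.1 u hu).2.1) hv hsub
  exact h.2 f hfE (by rw [restrict_inc hfE]; exact hsub)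

theorem degree_induce_le (G : MultiHypergraph α β) (S : Set α) (u : α) :
    (G.induce S).degree u ≤ G.degree u :=
  Set.ncard_le_ncard (fun _ he => ⟨he.1.1, he.2.2⟩) (G.finite_E.subset fun _ h => h.1)

/-- The colors of `v` that do not extend to `S`. -/
def blocked (C : G.Cover γ δ) (S : Set α) (v : α) : Set γ :=
  {x | x ∈ C.X v ∧ ∀ φ, C.Proper S φ → φ v ≠ x}

theorem not_proper_restrict_blocked {S : Set α} {v : α} (hS : S ⊆ G.V) (hvS : v ∈ S) (φ : α → γ) :
    ¬ (C.restrict S v (C.blocked S v)).Proper (G.induce S).V φ := fun h => by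
  obtain ⟨h1, h2⟩ := proper_of_proper_restrict hS hvS h
  exact h2.2 φ h1 rfl

theorem ncard_restrict_X {S : Set α} {v : α} (hvS : v ∈ S) :
    ((C.restrict S v (C.blocked S v)).X v).ncard = (C.blocked S v).ncard := by
  congr 1
  ext x
  exact ⟨fun h => h.2.2 rfl, fun h => ⟨hvS, h.1, fun _ => h⟩⟩

theorem degree_le_restrict {S : Set α} {v : α} {A : Set γ}
    (hfeas : C.IsDegreeFeasible) {u : α} (hu : u ∈ (G.induce S).V) (huv : u ≠ v) :
    (G.induce S).degree u ≤ ((C.restrict S v A).X u).ncard := by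
  refine (degree_induce_le G S u).trans ((hfeas.2 u hu.1).trans (le_of_eq ?_))
  congr 1
  ext x
  exact ⟨fun h => ⟨hu.2, h, fun h' => absurd h' huv⟩, fun h => h.2.1⟩

/-- Keeping only the blocked colors at `v` makes the side uncolorable. A state at `v` still exists,
because the degree condition is not needed at `v` itself, and it charges each blocked color to its
own edge. -/
theorem ncard_blocked_le [Nonempty γ] {v : α} {S₁ S₂ : Set α} (hsep : G.IsSeparation v S₁ S₂)
    (hfeas : C.IsDegreeFeasible) : (C.blocked S₁ v).ncard ≤ (G.induce S₁).degree v := by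
  classical
  obtain ⟨M, hM⟩ := (C.restrict S₁ v (C.blocked S₁ v)).exists_isMatchingFamily
  have hv : v ∈ (G.induce S₁).V := ⟨hsep.1 hsep.mem_left, hsep.mem_left⟩
  obtain ⟨φ, hφ⟩ := exists_proper_sdiff_singleton hM (hsep.isConnected_induce hfeas.1) hv
    fun u hu huv => degree_le_restrict hfeas hu huv
  rw [← ncard_restrict_X hsep.mem_left]
  exact ncard_le_degree hM (not_proper_restrict_blocked hsep.1 hsep.mem_left) hv hφ

/-- A color that extends to both sides extends to `G`: the two colorings agree at `v`, and every
edge lies in one side. -/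
theorem subset_blocked_union {v : α} {S₁ S₂ : Set α} (hsep : G.IsSeparation v S₁ S₂)
    (hC : ∀ φ, ¬ C.Proper G.V φ) : C.X v ⊆ C.blocked S₁ v ∪ C.blocked S₂ v := by
  classical
  intro x hx
  by_contra hcon
  have hex : ∀ S, x ∉ C.blocked S v → ∃ φ, C.Proper S φ ∧ φ v = x := by
    intro S h
    by_contra! h'
    exact h ⟨hx, h'⟩
  obtain ⟨φ₁, h₁, h₁v⟩ := hex S₁ fun h => hcon (.inl h)
  obtain ⟨φ₂, h₂, h₂v⟩ := hex S₂ fun h => hcon (.inr h)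
  obtain ⟨M, hM⟩ := C.exists_isMatchingFamily
  let φ : α → γ := fun u => if u ∈ S₁ then φ₁ u else φ₂ u
  have e1 : ∀ u ∈ S₁, φ u = φ₁ u := fun u hu => if_pos hu
  have e2 : ∀ u ∈ S₂, φ u = φ₂ u := by
    intro u hu
    by_cases h : u ∈ S₁
    · rw [e1 u h, hsep.eq_of_mem h hu, h₁v, h₂v]
    · exact if_neg h
  refine hC φ ((proper_iff hM).2 ⟨fun u hu => ?_, fun e he _ hh => ?_⟩)
  · rcases hsep.cover hu with h | h
    · rw [e1 u h]; exact h₁.1 u h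
    · rw [e2 u h]; exact h₂.1 u h
  · rcases hsep.edges e he with h | h
    · exact ((proper_iff hM).1 h₁).2 e he h (hh.congr fun u hu => e1 u (h hu))
    · exact ((proper_iff hM).1 h₂).2 e he h (hh.congr fun u hu => e2 u (h hu))

theorem degree_induce_add_le {v : α} {S₁ S₂ : Set α} (hsep : G.IsSeparation v S₁ S₂) :
    (G.induce S₁).degree v + (G.induce S₂).degree v ≤ G.degree v := by
  have hfin : ∀ S, {e | e ∈ (G.induce S).E ∧ v ∈ (G.induce S).inc e}.Finite := fun S =>
    (G.induce S).finite_E.subset fun _ h => h.1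
  unfold degree
  rw [← Set.ncard_union_eq ?_ (hfin S₁) (hfin S₂)]
  · refine Set.ncard_le_ncard ?_ (G.finite_E.subset fun _ h => h.1)
    rintro e (he | he) <;> exact ⟨he.1.1, he.2.2⟩
  · refine Set.disjoint_left.2 fun e he he' => ?_
    obtain ⟨a, ha, b, hb, hab⟩ := exists_pair he.1.1
    exact hab ((hsep.eq_of_mem (he.1.2 ha) (he'.1.2 ha)).trans
      (hsep.eq_of_mem (he.1.2 hb) (he'.1.2 hb)).symm)

/-- `C₁` and `C₂` are the two parts of `C` for a separation of `G`. -/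
structure IsSplit (C : G.Cover γ δ) {S₁ S₂ : Set α} (C₁ : (G.induce S₁).Cover γ δ)
    (C₂ : (G.induce S₂).Cover γ δ) : Prop where
  feasible_left : C₁.IsDegreeFeasible
  feasible_right : C₂.IsDegreeFeasible
  minimal_left : C₁.IsMinimalUncolorable
  minimal_right : C₂.IsMinimalUncolorable
  le_left : C₁.H ≤ C.H
  le_right : C₂.H ≤ C.H
  disjoint : C₁.H.IsDisjoint C₂.H
  vertices : C.H.V ⊆ C₁.H.V ∪ C₂.H.V
  edges : C.H.E ⊆ C₁.H.E ∪ C₂.H.E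
  colors : ∀ u, C.X u = C₁.X u ∪ C₂.X u

/-- A coloring violating only the edge `f` of this side cannot use a color of `v` blocked on the
other side, since `f` is not an edge there. So it uses a color kept on this side. -/
theorem minimal_restrict {v : α} {S₁ S₂ : Set α} (hsep : G.IsSeparation v S₁ S₂)
    (hmin : C.IsMinimalUncolorable) (hcov : C.X v ⊆ C.blocked S₁ v ∪ C.blocked S₂ v)
    (hdisj : Disjoint (C.blocked S₁ v) (C.blocked S₂ v)) :
    (C.restrict S₁ v (C.blocked S₁ v)).IsMinimalUncolorable := by
  have hV : (G.induce S₁).V = S₁ := Set.inter_eq_right.2 hsep.1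
  constructor
  · intro hcol
    have hγ : Nonempty γ := by
      obtain ⟨T, hT, hTv, -⟩ := hcol
      obtain ⟨x, -⟩ := Set.ncard_eq_one.1 (hTv v (by rw [hV]; exact hsep.mem_left))
      exact ⟨x⟩
    obtain ⟨φ, h1, h2⟩ := exists_of_isColorable _ hcol
    exact not_proper_restrict_blocked hsep.1 hsep.mem_left φ ⟨h1, h2⟩
  · intro f hf
    rw [isColorable_deleteEdge_iff _ hf]
    obtain ⟨φ, h1, h2⟩ := (C.isColorable_deleteEdge_iff hf.1).1 (hmin.2 f hf.1)
    have h1' : φ v ∈ C.blocked S₁ v := by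
      refine (hcov (h1 v (hsep.1 hsep.mem_left))).resolve_right fun hv => ?_
      refine not_proper_restrict_blocked hsep.2 hsep.mem_right φ
        (proper_restrict (fun u hu => h1 u (hsep.2 hu)) hv fun f' hf' hsub => ?_)
      -- An edge of both parts would have a vertex over `v` whose color is blocked on both sides.
      by_cases hff : f' = f
      · subst hff
        obtain ⟨x, hx, -⟩ := exists_pair hf.1
        obtain ⟨u, hu⟩ := Set.mem_iUnion.1 (hf.2 hx)
        obtain ⟨u', hu'⟩ := Set.mem_iUnion.1 (hf'.2 hx)
        obtain rfl := C.eq_of_mem_X hu.2.1 hu'.2.1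
        have huv := hsep.eq_of_mem hu.1 hu'.1
        exact Set.disjoint_left.1 hdisj (hu.2.2 huv) (hu'.2.2 huv)
      · exact h2 f' hf'.1 hff (hsub.trans (Set.image_mono hsep.2))
    refine ⟨φ, fun u hu => ⟨hu.2, h1 u hu.1, by rintro rfl; exact h1'⟩, fun f' hf' hff hsub => ?_⟩
    rw [restrict_inc hf'] at hsub
    exact h2 f' hf'.1 hff (hsub.trans (Set.image_mono fun u hu => hu.1))

theorem exists_isSplit {v a : α} {S₁ S₂ : Set α} (hsep : G.IsSeparation v S₁ S₂)
    (ha : a ∈ S₁) (hav : a ≠ v)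
    (hfeas : C.IsDegreeFeasible) (hmin : C.IsMinimalUncolorable) :
    ∃ (C₁ : (G.induce S₁).Cover γ δ) (C₂ : (G.induce S₂).Cover γ δ), C.IsSplit C₁ C₂ := by
  have hvV := hsep.1 hsep.mem_left
  obtain ⟨e, he, hve⟩ := exists_edge_of_isConnected hfeas.1 hvV (hsep.1 ha) hav.symm
  have hXv : (C.X v).Nonempty := (Set.ncard_pos (C.X_finite v)).1
    ((one_le_degree he hve).trans (hfeas.2 v hvV))
  have : Nonempty γ := ⟨hXv.choose⟩
  have hunc := not_proper_of_not_isColorable hmin.1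
  have hcov := subset_blocked_union hsep hunc
  have hfin : ∀ S, (C.blocked S v).Finite := fun S => (C.X_finite v).subset fun _ h => h.1
  have h1 := ncard_blocked_le hsep hfeas
  have h2 := ncard_blocked_le hsep.symm hfeas
  have h3 := degree_induce_add_le hsep
  have h4 := hfeas.2 v hvV
  have h5 := Set.ncard_le_ncard hcov ((hfin S₁).union (hfin S₂))
  have h6 := Set.ncard_union_add_ncard_inter (C.blocked S₁ v) (C.blocked S₂ v) (hfin S₁) (hfin S₂)
  -- The chain `|X_v| ≤ |b₁ ∪ b₂| ≤ |b₁| + |b₂| ≤ d₁ + d₂ ≤ d(v) ≤ |X_v|` for the blocked sets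
  -- consists of equalities. The same count later gives feasibility of both sides at `v`.
  have hdisj : Disjoint (C.blocked S₁ v) (C.blocked S₂ v) := by
    rw [Set.disjoint_iff_inter_eq_empty, ← Set.ncard_eq_zero ((hfin S₁).inter_of_left _)]
    omega
  have feas : ∀ S T, G.IsSeparation v S T → (G.induce S).degree v ≤ (C.blocked S v).ncard →
      (C.restrict S v (C.blocked S v)).IsDegreeFeasible := by
    intro S T hST hdeg
    refine ⟨hST.isConnected_induce hfeas.1, fun u hu => ?_⟩
    by_cases huv : u = v
    · subst huv
      rw [ncard_restrict_X hST.mem_left]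
      exact hdeg
    · exact degree_le_restrict hfeas hu huv
  have hcolors : ∀ u, C.X u = C.keep S₁ v (C.blocked S₁ v) u ∪ C.keep S₂ v (C.blocked S₂ v) u := by
    intro u
    refine Set.Subset.antisymm (fun x hx => ?_) (Set.union_subset (fun x h => h.2.1) fun x h => h.2.1)
    by_cases huv : u = v
    · subst huv
      exact (hcov hx).imp (fun h => ⟨hsep.mem_left, hx, fun _ => h⟩)
        fun h => ⟨hsep.mem_right, hx, fun _ => h⟩
    · exact (hsep.cover (C.mem_V_of_mem_X hx)).imp (fun h => ⟨h, hx, fun h' => absurd h' huv⟩)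
        fun h => ⟨h, hx, fun h' => absurd h' huv⟩
  have hdisjV : Disjoint (C.restrict S₁ v (C.blocked S₁ v)).H.V
      (C.restrict S₂ v (C.blocked S₂ v)).H.V := by
    refine Set.disjoint_left.2 fun x hx hx' => ?_
    obtain ⟨u, hu⟩ := Set.mem_iUnion.1 hx.2
    obtain ⟨u', hu'⟩ := Set.mem_iUnion.1 hx'.2
    obtain rfl := C.eq_of_mem_X hu.2.1 hu'.2.1
    have huv := hsep.eq_of_mem hu.1 hu'.1
    exact Set.disjoint_left.1 hdisj (hu.2.2 huv) (hu'.2.2 huv)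
  refine ⟨C.restrict S₁ v (C.blocked S₁ v), C.restrict S₂ v (C.blocked S₂ v),
    { feasible_left := feas S₁ S₂ hsep (by omega)
      feasible_right := feas S₂ S₁ hsep.symm (by omega)
      minimal_left := minimal_restrict hsep hmin hcov hdisj
      minimal_right := minimal_restrict hsep.symm hmin (by rw [Set.union_comm]; exact hcov)
        hdisj.symm
      le_left := induce_le _ _
      le_right := induce_le _ _
      disjoint := ⟨hdisjV, Set.disjoint_left.2 fun f hf hf' => ?_⟩
      vertices := fun x hx => ?_
      edges := fun f hf => ?_
      colors := hcolors }⟩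
  · obtain ⟨x, hx, -⟩ := exists_pair hf
    refine Set.disjoint_left.1 hdisjV (inc_subset _ f hf hx) (inc_subset _ f hf' ?_)
    rw [restrict_inc hf']
    rwa [restrict_inc hf] at hx
  · obtain ⟨u, hu, hxu⟩ := C.exists_mem_X hx
    rw [hcolors u] at hxu
    exact hxu.imp (fun h => ⟨hx, Set.mem_iUnion.2 ⟨u, h⟩⟩) fun h => ⟨hx, Set.mem_iUnion.2 ⟨u, h⟩⟩
  -- An edge in neither part contradicts minimality: a coloring violating at most that edge would
  -- properly color the side on which its color of `v` is blocked.
  · by_contra hcon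
    obtain ⟨φ, hφ, hφ'⟩ := (C.isColorable_deleteEdge_iff hf).1 (hmin.2 f hf)
    have side : ∀ S T, G.IsSeparation v S T → φ v ∈ C.blocked S v →
        f ∈ (C.restrict S v (C.blocked S v)).H.E := by
      intro S T hST hv
      by_contra hfS
      refine not_proper_restrict_blocked hST.1 hST.mem_left φ
        (proper_restrict (fun u hu => hφ u (hST.1 hu)) hv fun f' hf' hsub => ?_)
      refine hφ' f' hf'.1 ?_ (hsub.trans (Set.image_mono hST.1))
      rintro rfl
      exact hfS hf'
    exact hcon ((hcov (hφ v hvV)).imp (side S₁ S₂ hsep) (side S₂ S₁ hsep.symm))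

end Cover

/-! ### Gluing decompositions, and existence by induction -/

theorem IsSeparation.notMem_blocks {G B : MultiHypergraph α β} {v a : α} {S₁ S₂ : Set α}
    (h : G.IsSeparation v S₁ S₂) (hG : G.IsConnected) (ha : a ∈ S₁) (hav : a ≠ v)
    (h1 : B ∈ (G.induce S₁).blocks) : B ∉ (G.induce S₂).blocks := by
  intro h2
  obtain ⟨x, hx, y, hy, hxy⟩ := exists_ne_of_mem_blocks (h.isConnected_induce hG) h1
    ⟨h.1 ha, ha⟩ ⟨h.1 h.mem_left, h.mem_left⟩ hav
  have : ∀ z ∈ B.V, z = v := fun z hz => h.eq_of_mem (h1.1.1.1 hz).2 (h2.1.1.1 hz).2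
  exact hxy ((this x hx).trans (this y hy).symm)

namespace Cover

variable {G : MultiHypergraph α β}

/-- The family `D` decomposes the cover `C` into configurations on the blocks of `G`. -/
def IsDecomposition (C : G.Cover γ δ)
    (D : (B : G.blocks) → MultiHypergraph.Cover (B : MultiHypergraph α β) γ δ) : Prop :=
  (∀ B, (D B).IsKConfiguration ∨ (D B).IsCConfiguration ∨ (D B).IsEConfiguration) ∧
    ((Pairwise fun B B' => (D B).H.IsDisjoint (D B').H) ∧
      C.H.IsUnion (Set.range fun B => (D B).H)) ∧
    (∀ v ∈ G.V, C.X v = ⋃ (B : G.blocks) (_ : v ∈ (B : MultiHypergraph α β).V), (D B).X v)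

variable {C : G.Cover γ δ}

theorem exists_decomposition_of_isNonsep (hG : G.IsNonsep) (hfeas : C.IsDegreeFeasible)
    (hmin : C.IsMinimalUncolorable) : ∃ D, C.IsDecomposition D := by
  have hmem : G ∈ G.blocks := mem_blocks_iff.2 ⟨⟨le_rfl, hG⟩, fun K hK _ _ => hK⟩
  have hall : ∀ B : G.blocks, B = ⟨G, hmem⟩ := fun B => Subtype.ext (blocks_eq_of_isNonsep hG B.2)
  have hex : ∀ B : G.blocks, ∃ D : (B : MultiHypergraph α β).Cover γ δ,
      (D.IsKConfiguration ∨ D.IsCConfiguration ∨ D.IsEConfiguration) ∧ D.H = C.H ∧ D.X = C.X := by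
    intro B
    obtain rfl := hall B
    exact ⟨C, configuration_of_isNonsep hG hfeas hmin, rfl, rfl⟩
  choose D hD hDH hDX using hex
  refine ⟨D, hD, ⟨fun B B' hne => absurd ((hall B).trans (hall B').symm) hne, ?_⟩, fun v hv => ?_⟩
  · have hrange : Set.range (fun B => (D B).H) = {C.H} := by
      ext K
      simp only [Set.mem_range, hDH, Set.mem_singleton_iff]
      exact ⟨fun ⟨_, h⟩ => h.symm, fun h => ⟨⟨G, hmem⟩, h.symm⟩⟩
    rw [hrange]
    exact ⟨fun K hK => le_of_eq hK, by simp, by simp⟩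
  · ext x
    simp only [Set.mem_iUnion, hDX]
    exact ⟨fun h => ⟨⟨G, hmem⟩, hv, h⟩, fun ⟨_, _, h⟩ => h⟩

theorem IsDecomposition.le {D : (B : G.blocks) → MultiHypergraph.Cover (B : MultiHypergraph α β) γ δ}
    (h : C.IsDecomposition D) (B : G.blocks) : (D B).H ≤ C.H := h.2.1.2.1 _ ⟨B, rfl⟩

theorem IsDecomposition.exists_mem_V
    {D : (B : G.blocks) → MultiHypergraph.Cover (B : MultiHypergraph α β) γ δ}
    (h : C.IsDecomposition D) {x : γ} (hx : x ∈ C.H.V) : ∃ B, x ∈ (D B).H.V := by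
  rw [h.2.1.2.2.1] at hx
  simpa using hx

theorem IsDecomposition.exists_mem_E
    {D : (B : G.blocks) → MultiHypergraph.Cover (B : MultiHypergraph α β) γ δ}
    (h : C.IsDecomposition D) {f : δ} (hf : f ∈ C.H.E) : ∃ B, f ∈ (D B).H.E := by
  rw [h.2.1.2.2.2] at hf
  simpa using hf

theorem IsDecomposition.exists_mem_X
    {D : (B : G.blocks) → MultiHypergraph.Cover (B : MultiHypergraph α β) γ δ}
    (h : C.IsDecomposition D) {v : α} {x : γ} (hx : x ∈ C.X v) :
    ∃ B : G.blocks, v ∈ (B : MultiHypergraph α β).V ∧ x ∈ (D B).X v := by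
  rw [h.2.2 v (C.mem_V_of_mem_X hx)] at hx
  simpa using hx

theorem IsDecomposition.X_subset
    {D : (B : G.blocks) → MultiHypergraph.Cover (B : MultiHypergraph α β) γ δ}
    (h : C.IsDecomposition D) (B : G.blocks) (v : α) : (D B).X v ⊆ C.X v := by
  intro x hx
  have hv := (D B).mem_V_of_mem_X hx
  rw [h.2.2 v (B.2.1.1.1 hv)]
  exact Set.mem_iUnion₂.2 ⟨B, hv, hx⟩

theorem isDisjoint_of_le {H₁ H₂ K₁ K₂ : MultiHypergraph γ δ} (h : H₁.IsDisjoint H₂) (h1 : K₁ ≤ H₁)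
    (h2 : K₂ ≤ H₂) : K₁.IsDisjoint K₂ :=
  ⟨h.1.mono h1.1 h2.1, h.2.mono h1.2.1 h2.2.1⟩

theorem IsDisjoint.symm {H₁ H₂ : MultiHypergraph γ δ} (h : H₁.IsDisjoint H₂) : H₂.IsDisjoint H₁ :=
  ⟨h.1.symm, h.2.symm⟩

theorem IsSplit.exists_decomposition {v a b : α} {S₁ S₂ : Set α} (hG : G.IsConnected)
    (hsep : G.IsSeparation v S₁ S₂) (ha : a ∈ S₁) (hav : a ≠ v) (hb : b ∈ S₂) (hbv : b ≠ v)
    {C₁ : (G.induce S₁).Cover γ δ} {C₂ : (G.induce S₂).Cover γ δ} (hC : C.IsSplit C₁ C₂)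
    (h₁ : ∃ D, C₁.IsDecomposition D) (h₂ : ∃ D, C₂.IsDecomposition D) :
    ∃ D, C.IsDecomposition D := by
  obtain ⟨D₁, h₁⟩ := h₁
  obtain ⟨D₂, h₂⟩ := h₂
  have hor : ∀ B : G.blocks, (B : MultiHypergraph α β) ∈ (G.induce S₁).blocks ∨
      (B : MultiHypergraph α β) ∈ (G.induce S₂).blocks := fun B => hsep.mem_blocks_or B.2
  have hnot : ∀ B, B ∈ (G.induce S₁).blocks → B ∉ (G.induce S₂).blocks := fun B h =>
    hsep.notMem_blocks hG ha hav h
  have hex : ∀ B : G.blocks, ∃ D : (B : MultiHypergraph α β).Cover γ δ,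
      (∀ h : (B : MultiHypergraph α β) ∈ (G.induce S₁).blocks, D = D₁ ⟨B, h⟩) ∧
      ∀ h : (B : MultiHypergraph α β) ∈ (G.induce S₂).blocks, D = D₂ ⟨B, h⟩ := by
    intro B
    rcases hor B with h | h
    · exact ⟨D₁ ⟨B, h⟩, fun _ => rfl, fun h' => absurd h' (hnot B h)⟩
    · exact ⟨D₂ ⟨B, h⟩, fun h' => absurd h (hnot B h'), fun _ => rfl⟩
  choose D hD₁ hD₂ using hex
  -- The type of a cover depends on the block, so only the fields `H` and `X`, whose types do not,
  -- are compared.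
  have up₁ : ∀ B : (G.induce S₁).blocks, ∃ B' : G.blocks,
      (B' : MultiHypergraph α β) = B ∧ (D B').H = (D₁ B).H ∧ (D B').X = (D₁ B).X := fun B =>
    ⟨⟨B, hsep.mem_blocks hG ha hav B.2⟩, rfl, by rw [hD₁ _ B.2], by rw [hD₁ _ B.2]⟩
  have up₂ : ∀ B : (G.induce S₂).blocks, ∃ B' : G.blocks,
      (B' : MultiHypergraph α β) = B ∧ (D B').H = (D₂ B).H ∧ (D B').X = (D₂ B).X := fun B =>
    ⟨⟨B, hsep.symm.mem_blocks hG hb hbv B.2⟩, rfl, by rw [hD₂ _ B.2], by rw [hD₂ _ B.2]⟩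
  refine ⟨D, fun B => ?_, ⟨fun B B' hne => ?_, ?_, ?_, ?_⟩, fun u hu => ?_⟩
  · rcases hor B with h | h
    · rw [hD₁ B h]; exact h₁.1 _
    · rw [hD₂ B h]; exact h₂.1 _
  · rcases hor B with h | h <;> rcases hor B' with h' | h'
    · rw [hD₁ B h, hD₁ B' h']
      exact h₁.2.1.1 fun heq => hne (Subtype.ext (Subtype.mk.inj heq))
    · rw [hD₁ B h, hD₂ B' h']
      exact isDisjoint_of_le hC.disjoint (h₁.le _) (h₂.le _)
    · rw [hD₂ B h, hD₁ B' h']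
      exact isDisjoint_of_le (IsDisjoint.symm hC.disjoint) (h₂.le _) (h₁.le _)
    · rw [hD₂ B h, hD₂ B' h']
      exact h₂.2.1.1 fun heq => hne (Subtype.ext (Subtype.mk.inj heq))
  · rintro _ ⟨B, rfl⟩
    rcases hor B with h | h
    · simp only [hD₁ B h]; exact (h₁.le _).trans hC.le_left
    · simp only [hD₂ B h]; exact (h₂.le _).trans hC.le_right
  · ext x
    simp only [Set.mem_iUnion, Set.mem_range, exists_prop, exists_exists_eq_and]
    constructor
    · intro hx
      rcases hC.vertices hx with h | h
      · obtain ⟨B, hB⟩ := h₁.exists_mem_V h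
        obtain ⟨B', -, hH, -⟩ := up₁ B
        exact ⟨B', hH ▸ hB⟩
      · obtain ⟨B, hB⟩ := h₂.exists_mem_V h
        obtain ⟨B', -, hH, -⟩ := up₂ B
        exact ⟨B', hH ▸ hB⟩
    · rintro ⟨B, hB⟩
      rcases hor B with h | h
      · rw [hD₁ B h] at hB; exact hC.le_left.1 ((h₁.le _).1 hB)
      · rw [hD₂ B h] at hB; exact hC.le_right.1 ((h₂.le _).1 hB)
  · ext x
    simp only [Set.mem_iUnion, Set.mem_range, exists_prop, exists_exists_eq_and]
    constructor
    · intro hx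
      rcases hC.edges hx with h | h
      · obtain ⟨B, hB⟩ := h₁.exists_mem_E h
        obtain ⟨B', -, hH, -⟩ := up₁ B
        exact ⟨B', hH ▸ hB⟩
      · obtain ⟨B, hB⟩ := h₂.exists_mem_E h
        obtain ⟨B', -, hH, -⟩ := up₂ B
        exact ⟨B', hH ▸ hB⟩
    · rintro ⟨B, hB⟩
      rcases hor B with h | h
      · rw [hD₁ B h] at hB; exact hC.le_left.2.1 ((h₁.le _).2.1 hB)
      · rw [hD₂ B h] at hB; exact hC.le_right.2.1 ((h₂.le _).2.1 hB)
  · ext x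
    simp only [Set.mem_iUnion, exists_prop]
    constructor
    · intro hx
      rw [hC.colors u] at hx
      rcases hx with h | h
      · obtain ⟨B, huB, hB⟩ := h₁.exists_mem_X h
        obtain ⟨B', hV, -, hX⟩ := up₁ B
        exact ⟨B', by rw [hV]; exact huB, by rw [hX]; exact hB⟩
      · obtain ⟨B, huB, hB⟩ := h₂.exists_mem_X h
        obtain ⟨B', hV, -, hX⟩ := up₂ B
        exact ⟨B', by rw [hV]; exact huB, by rw [hX]; exact hB⟩
    · rintro ⟨B, -, hB⟩
      rw [hC.colors u]
      rcases hor B with h | h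
      · rw [hD₁ B h] at hB; exact .inl (h₁.X_subset _ u hB)
      · rw [hD₂ B h] at hB; exact .inr (h₂.X_subset _ u hB)

theorem exists_decomposition (n : ℕ) : ∀ (G : MultiHypergraph α β) (C : G.Cover γ δ),
    G.V.ncard = n → C.IsDegreeFeasible → C.IsMinimalUncolorable → ∃ D, C.IsDecomposition D := by
  induction n using Nat.strong_induction_on with
  | _ n ih =>
    rintro G C rfl hfeas hmin
    by_cases hG : G.IsNonsep
    · exact exists_decomposition_of_isNonsep hG hfeas hmin
    · obtain ⟨v, hv⟩ : ∃ v, G.IsSeparatingVertex v := by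
        by_contra! h
        exact hG ⟨hfeas.1, h⟩
      obtain ⟨S₁, S₂, hsep, ⟨a, ha, hav⟩, ⟨b, hb, hbv⟩⟩ := isSeparatingVertex_iff.1 hv
      obtain ⟨C₁, C₂, hC⟩ := exists_isSplit hsep ha hav hfeas hmin
      refine hC.exists_decomposition hfeas.1 hsep ha hav hb hbv
        (ih _ (Set.ncard_lt_ncard ?_ G.finite_V) _ C₁ rfl hC.feasible_left hC.minimal_left)
        (ih _ (Set.ncard_lt_ncard ?_ G.finite_V) _ C₂ rfl hC.feasible_right hC.minimal_right)
      · exact ⟨Set.inter_subset_left, fun h => hbv (hsep.eq_of_mem (h (hsep.2 hb)).2 hb)⟩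
      · exact ⟨Set.inter_subset_left, fun h => hav (hsep.eq_of_mem ha (h (hsep.1 ha)).2)⟩

/-! ### Uniqueness -/

theorem exists_edge_of_isCompleteBetween {t : ℕ} (ht : 1 ≤ t) {Y Z : Set γ}
    (h : C.IsCompleteBetween t Y Z) :
    (∀ x ∈ Y, ∃ f ∈ C.H.E, x ∈ C.H.inc f) ∧ ∀ x ∈ Z, ∃ f ∈ C.H.E, x ∈ C.H.inc f := by
  have hY : Y.ncard = t := h.card 0
  have hZ : Z.ncard = t := h.card 1
  obtain ⟨y, hy⟩ := Set.nonempty_of_ncard_ne_zero (s := Y) (by omega)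
  obtain ⟨z, hz⟩ := Set.nonempty_of_ncard_ne_zero (s := Z) (by omega)
  have key : ∀ y ∈ Y, ∀ z ∈ Z, ∃ f ∈ C.H.E, C.H.inc f = {y, z} := by
    intro y hy z hz
    obtain ⟨f, ⟨hf, hinc⟩, -⟩ := h.joined 0 1 (by decide) y hy z hz
    exact ⟨f, hf.1, by rw [← induce_inc hf, hinc]⟩
  constructor
  · intro x hx
    obtain ⟨f, hf, hinc⟩ := key x hx z hz
    exact ⟨f, hf, by simp [hinc]⟩
  · intro x hx
    obtain ⟨f, hf, hinc⟩ := key y hy x hx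
    exact ⟨f, hf, by simp [hinc]⟩

theorem exists_ordAdj_of_isMultiple_cycleGraph {t n : ℕ} (ht : 1 ≤ t) (hn : 3 ≤ n)
    (h : G.IsMultiple t (SimpleGraph.cycleGraph n)) {v : α} (hv : v ∈ G.V) :
    ∃ u, G.OrdAdj v u := by
  obtain ⟨φ, -, hφ⟩ := h
  obtain ⟨i, hi⟩ := φ.surjective ⟨v, hv⟩
  have hv' : v = φ i := by rw [hi]
  obtain ⟨j, hj⟩ : ∃ j, (SimpleGraph.cycleGraph n).Adj i j := by
    by_cases hlt : (i : ℕ) + 1 < n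
    · exact ⟨⟨i + 1, hlt⟩, (cycleGraph_adj_iff hn _ _).2 (.inl rfl)⟩
    · have := i.2
      refine ⟨⟨0, by omega⟩, (cycleGraph_adj_iff hn _ _).2 (.inr (.inr (.inr ⟨rfl, ?_⟩)))⟩
      omega
  obtain ⟨e, he, hinc⟩ := Set.nonempty_of_ncard_ne_zero (s := {e | e ∈ G.E ∧
    G.inc e = {(φ i : α), (φ j : α)}}) (by rw [hφ i j hj]; omega)
  refine ⟨φ j, ?_, e, he, by rw [hinc, hv']⟩
  rw [hv']
  exact fun h => hj.ne (φ.injective (Subtype.ext h))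

theorem exists_edge_of_configuration
    (h : C.IsKConfiguration ∨ C.IsCConfiguration ∨ C.IsEConfiguration) {x : γ} (hx : x ∈ C.H.V) :
    ∃ f ∈ C.H.E, x ∈ C.H.inc f := by
  obtain ⟨v, hv, hxv⟩ := C.exists_mem_X hx
  rcases h with ⟨t, n, ht, hn, ⟨φ, -⟩, P, hP, hmul, -⟩ |
    (⟨t, n, ht, hn, -, hmul, P, hP, hbet, -⟩ |
      ⟨t, n, ht, hn, -, hmul, P, w, w', hP, -, hbet, h01, h10, -⟩) | ⟨⟨e, hE, hV⟩, -, F, g, hFg⟩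
  · rw [(hP v hv).1, Set.mem_iUnion] at hxv
    obtain ⟨j, hj⟩ := hxv
    -- An index below `n - 1` forces `n ≥ 2`, so there is a second vertex to supply an edge.
    have hj2 := j.2
    have : Nontrivial (Fin n) := Fin.nontrivial_iff_two_le.2 (by omega)
    obtain ⟨i, hi⟩ := exists_ne (φ.symm ⟨v, hv⟩)
    have hne : φ i ≠ ⟨v, hv⟩ := fun h => hi (by rw [← h, Equiv.symm_apply_apply])
    have hcard := (hmul j).card (φ i)
    obtain ⟨y, hy⟩ := Set.nonempty_of_ncard_ne_zero (s := P j (φ i : α)) (by omega)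
    obtain ⟨f, ⟨hf, hinc⟩, -⟩ := (hmul j).joined ⟨v, hv⟩ (φ i) hne.symm x hj y hy
    rw [induce_inc hf] at hinc
    exact ⟨f, hf.1, by simp [hinc]⟩
  · obtain ⟨u, hu⟩ := exists_ordAdj_of_isMultiple_cycleGraph ht (by omega) hmul hv
    rw [(hP v hv).1, Set.mem_iUnion] at hxv
    obtain ⟨j, hj⟩ := hxv
    exact (exists_edge_of_isCompleteBetween ht (hbet j v u hu)).1 x hj
  · obtain ⟨u, hu⟩ := exists_ordAdj_of_isMultiple_cycleGraph ht (by omega) hmul hv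
    rw [(hP v hv).1, Set.mem_iUnion] at hxv
    obtain ⟨j, hj⟩ := hxv
    by_cases hne : ({v, u} : Set α) = {w, w'}
    · have hA := exists_edge_of_isCompleteBetween ht h01
      have hB := exists_edge_of_isCompleteBetween ht h10
      rcases Set.pair_eq_pair_iff.1 hne with ⟨rfl, rfl⟩ | ⟨rfl, rfl⟩ <;> fin_cases j
      · exact hA.1 x hj
      · exact hB.1 x hj
      · exact hB.2 x hj
      · exact hA.2 x hj
    · exact (exists_edge_of_isCompleteBetween ht (hbet j v u hu hne)).1 x hj
  · have he : e ∈ G.E := hE.ge rfl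
    refine ⟨g.symm ⟨e, he⟩, (g.symm ⟨e, he⟩).2, (hFg ⟨x, hx⟩ _).2 ?_⟩
    rw [Equiv.apply_symm_apply]
    change _ ∈ G.inc e
    rw [hV]
    exact (F ⟨x, hx⟩).2

/-- An edge of `H` in the part of `B` meets the color sets of two vertices of an edge of `B`. If it
also belongs to the part of `B'`, these vertices lie in `B'` as well, and two common vertices force
`B = B'`. -/
theorem IsDecomposition.edges_subset
    {D D' : (B : G.blocks) → MultiHypergraph.Cover (B : MultiHypergraph α β) γ δ}
    (h : C.IsDecomposition D) (h' : C.IsDecomposition D') (B : G.blocks) :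
    (D B).H.E ⊆ (D' B).H.E := by
  intro f hf
  obtain ⟨B', hf'⟩ := h'.exists_mem_E ((h.le B).2.1 hf)
  suffices B = B' by rw [this]; exact hf'
  obtain ⟨M, hM⟩ := (D B).exists_isMatchingFamily
  obtain ⟨e, he, hfe⟩ := hM.exists_mem hf
  have key : ∀ u ∈ (B : MultiHypergraph α β).inc e, u ∈ (B' : MultiHypergraph α β).V := by
    intro u hu
    obtain ⟨x, hx⟩ := hM.exists_inc he hfe hu
    have hx' := hx.ge rfl
    have hxf : x ∈ (D' B').H.inc f := by
      rw [inc_of_le (h'.le B') hf', ← inc_of_le (h.le B) hf]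
      exact hx'.1
    obtain ⟨w, hw, hxw⟩ := (D' B').exists_mem_X ((D' B').H.inc_subset f hf' hxf)
    obtain rfl := C.eq_of_mem_X (h.X_subset B u hx'.2) (h'.X_subset B' w hxw)
    exact hw
  obtain ⟨a, ha, b, hb, hab⟩ := exists_pair he
  have hsub := inc_subset _ e he
  exact Subtype.ext (eq_of_mem_blocks B.2 B'.2 (hsub ha) (key a ha) (hsub hb) (key b hb) hab)

/-- No vertex of a basic configuration is isolated in `H`, so the edges determine the vertices. -/
theorem IsDecomposition.V_subset
    {D D' : (B : G.blocks) → MultiHypergraph.Cover (B : MultiHypergraph α β) γ δ}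
    (h : C.IsDecomposition D) (h' : C.IsDecomposition D') (B : G.blocks) :
    (D B).H.V ⊆ (D' B).H.V := by
  intro x hx
  obtain ⟨f, hf, hxf⟩ := exists_edge_of_configuration (h.1 B) hx
  have hf' := h.edges_subset h' B hf
  refine (D' B).H.inc_subset f hf' ?_
  rw [inc_of_le (h'.le B) hf', ← inc_of_le (h.le B) hf]
  exact hxf

theorem IsDecomposition.X_subset_X
    {D D' : (B : G.blocks) → MultiHypergraph.Cover (B : MultiHypergraph α β) γ δ}
    (h : C.IsDecomposition D) (h' : C.IsDecomposition D') (B : G.blocks) (v : α) :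
    (D B).X v ⊆ (D' B).X v := by
  intro x hx
  obtain ⟨u, hu, hxu⟩ := (D' B).exists_mem_X
    (h.V_subset h' B ((D B).X_subset ((D B).mem_V_of_mem_X hx) hx))
  obtain rfl := C.eq_of_mem_X (h.X_subset B v hx) (h'.X_subset B u hxu)
  exact hxu

theorem IsDecomposition.H_le
    {D D' : (B : G.blocks) → MultiHypergraph.Cover (B : MultiHypergraph α β) γ δ}
    (h : C.IsDecomposition D) (h' : C.IsDecomposition D') (B : G.blocks) :
    (D B).H ≤ (D' B).H := by
  refine ⟨h.V_subset h' B, h.edges_subset h' B, fun f hf => ?_⟩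
  rw [inc_of_le (h.le B) hf, inc_of_le (h'.le B) (h.edges_subset h' B hf)]

theorem IsDecomposition.unique
    {D D' : (B : G.blocks) → MultiHypergraph.Cover (B : MultiHypergraph α β) γ δ}
    (h : C.IsDecomposition D) (h' : C.IsDecomposition D') : D = D' := by
  funext B
  refine Cover.ext (funext fun v => (h.X_subset_X h' B v).antisymm (h'.X_subset_X h B v))
    (le_antisymm (h.H_le h' B) (h'.H_le h B))

end Cover

end MultiHypergraph

theorem mainTheorem2 {α β γ δ : Type*} (G : MultiHypergraph α β) (C : G.Cover γ δ)
    (hfeasible : C.IsDegreeFeasible) (hminimal : C.IsMinimalUncolorable) :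
    ∃! D : (B : G.blocks) → MultiHypergraph.Cover (B : MultiHypergraph α β) γ δ,
      (∀ B, (D B).IsKConfiguration ∨ (D B).IsCConfiguration ∨ (D B).IsEConfiguration) ∧
      ((Pairwise fun B B' => (D B).H.IsDisjoint (D B').H) ∧
        C.H.IsUnion (Set.range fun B => (D B).H)) ∧
      (∀ v ∈ G.V, C.X v = ⋃ (B : G.blocks) (_ : v ∈ (B : MultiHypergraph α β).V), (D B).X v) := by
  obtain ⟨D, hD⟩ := MultiHypergraph.Cover.exists_decomposition _ G C rfl hfeasible hminimal
  exact ⟨D, hD, fun D' hD' => MultiHypergraph.Cover.IsDecomposition.unique hD' hD⟩
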